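/- Let $\mathbb K\in\{\mathbb R,\mathbb C\}$, let $V,H$ be separable Hilbert spaces over $\mathbb K$ with $V$ continuously and densely embedded in $H$, and let $T>0$. Let $V'$ be the antidual of $V$, with $H$ embedded in $V'$ by $\langle h,v\rangle=(h\mid v)_H$. Let $\mathfrak a=\mathfrak a_1+\mathfrak a_2$ and $\mathfrak b=\mathfrak b_1+\mathfrak b_2$, where $\mathfrak a_i,\mathfrak b_i\colon[0,T]\times V\times V\to\mathbb K$ are families of sesquilinear forms on $V$ (linear in the first, antilinear in the second variable), satisfying the following for some constants $M,L\ge 0$, $\alpha>0$. For $\mathfrak c\in\{\mathfrak a_1,\mathfrak b_1\}$, all $t\in[0,T]$ and all $u,v\in V$: - $|\mathfrak c(t,u,v)|\le M\|u\|_V\|v\|_V$; - $\mathfrak c(t,u,u)\ge\alpha\|u\|_V^2$; - $\mathfrak c(t,u,v)=\overline{\mathfrak c(t,v,u)}$; - $\mathfrak c$ is piecewise Lipschitz continuous in time: there are $0=\tau_0<\tau_1<\dots<\tau_n=T$ such that $|\mathfrak c(t,u,v)-\mathfrak c(s,u,v)|\le L|t-s|\,\|u\|_V\|v\|_V$ for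 all $s,t\in(\tau_{i-1},\tau_i)$, $i=1,\dots,n$, $u,v\in V$. For $\mathfrak c\in\{\mathfrak a_2,\mathfrak b_2\}$ and all $u,v\in V$: the function $\mathfrak c(\cdot,u,v)$ is measurable, and $|\mathfrak c(t,u,v)|\le M\|u\|_V\|v\|_H$ for all $t\in[0,T]$. Let $\mathcal A(t),\mathcal B(t)\in\mathcal L(V,V')$ be given by $\langle\mathcal A(t)u,v\rangle=\mathfrak a(t,u,v)$ and $\langle\mathcal B(t)u,v\rangle=\mathfrak b(t,u,v)$. Then for all $u_0,u_1\in V$ and $f\in L^2(0,T;H)$ there is a unique $u\in H^1(0,T;V)\cap H^2(0,T;H)$ such that $$\ddot u(t)+\mathcal B(t)\dot u(t)+\mathcal A(t)u(t)=f(t)\ \text{ in } V' \text{ for a.e. } t\in(0,T),\qquad u(0)=u_0,\quad \dot u(0)=u_1 .$$ Moreover, $\dot u(t)\in V$ for all $t\in[0,T]$. (Point values of $u$ and $\dot u$ are those of the continuous representatives $u\in C([0,T];V)$ and $\dot u\in C([0,T];H)$.) -/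

import Mathlib

open MeasureTheory Set
open scoped ContDiff ENNReal

namespace DampedWave

noncomputable section

/-! ### Vector-valued Lebesgue and Sobolev spaces on `(0,T)` -/

/-- `L²(0,T;E)`, with respect to Lebesgue measure. -/
abbrev L2 (T : ℝ) (E : Type*) [NormedAddCommGroup E] : Type _ :=
  Lp E 2 (volume.restrict (Ioo (0 : ℝ) T))

/-- `v` is the weak derivative of `u` on `(0,T)`: `∫ φ' u = - ∫ φ v` for all `φ ∈ C_c^∞(0,T)`.
The space `E` is regarded as a real normed space by restriction of scalars from `𝕜` to `ℝ`. -/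
def HasWeakDeriv (𝕜 : Type*) [RCLike 𝕜] {E : Type*} [NormedAddCommGroup E] [NormedSpace 𝕜 E]
    {T : ℝ} (u v : L2 T E) : Prop :=
  letI : NormedSpace ℝ E := NormedSpace.restrictScalars ℝ 𝕜 E
  ∀ φ : ℝ → ℝ, ContDiff ℝ ∞ φ → HasCompactSupport φ → tsupport φ ⊆ Ioo (0 : ℝ) T →
    ∫ t in Ioo (0 : ℝ) T, deriv φ t • u t = - ∫ t in Ioo (0 : ℝ) T, φ t • v t

/-- `u ∈ H^k(0,T;E)`: the function `u ∈ L²(0,T;E)` has weak derivatives up to order `k` in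
`L²(0,T;E)`. -/
def MemHk (𝕜 : Type*) [RCLike 𝕜] {E : Type*} [NormedAddCommGroup E] [NormedSpace 𝕜 E]
    {T : ℝ} : ℕ → L2 T E → Prop
  | 0, _ => True
  | k + 1, u => ∃ v : L2 T E, HasWeakDeriv 𝕜 u v ∧ MemHk 𝕜 k v

/-- `w` is the continuous representative on `[0,T]` of the class `u ∈ L²(0,T;E)`. For `T > 0`
it is unique on `[0,T]`; point values of functions in Sobolev spaces are those of `w`. -/
def IsContRep {E : Type*} [NormedAddCommGroup E] {T : ℝ} (u : L2 T E) (w : ℝ → E) : Prop :=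
  ContinuousOn w (Icc (0 : ℝ) T) ∧ w =ᵐ[volume.restrict (Ioo (0 : ℝ) T)] u

section Forms

variable {𝕜 : Type*} [RCLike 𝕜]
  {V : Type*} [NormedAddCommGroup V] [InnerProductSpace 𝕜 V]
  {H : Type*} [NormedAddCommGroup H] [InnerProductSpace 𝕜 H]

/-! ### Non-autonomous sesquilinear forms

A non-autonomous form is a family `c : ℝ → V →ₗ[𝕜] V →ₗ⋆[𝕜] 𝕜`, linear in the first and
antilinear in the second variable, of which only the values at times `t ∈ [0,T]` matter. -/

/-- `V`-boundedness: `|c(t,u,v)| ≤ M ‖u‖_V ‖v‖_V` for `t ∈ [0,T]`. -/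
def IsVBounded (T : ℝ) (c : ℝ → V →ₗ[𝕜] V →ₗ⋆[𝕜] 𝕜) : Prop :=
  ∃ M : ℝ, ∀ t ∈ Icc (0 : ℝ) T, ∀ u v : V, ‖c t u v‖ ≤ M * ‖u‖ * ‖v‖

/-- Coercivity: `Re c(t,u,u) ≥ α ‖u‖_V²` for `t ∈ [0,T]`, with some `α > 0`. -/
def IsCoerciveForm (T : ℝ) (c : ℝ → V →ₗ[𝕜] V →ₗ⋆[𝕜] 𝕜) : Prop :=
  ∃ α : ℝ, 0 < α ∧ ∀ t ∈ Icc (0 : ℝ) T, ∀ u : V, α * ‖u‖ ^ 2 ≤ RCLike.re (c t u u)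

/-- Symmetry: `c(t,u,v)` is the conjugate of `c(t,v,u)` for `t ∈ [0,T]`. -/
def IsSymmetricForm (T : ℝ) (c : ℝ → V →ₗ[𝕜] V →ₗ⋆[𝕜] 𝕜) : Prop :=
  ∀ t ∈ Icc (0 : ℝ) T, ∀ u v : V, c t u v = starRingEnd 𝕜 (c t v u)

/-- Piecewise Lipschitz continuity in time: there are `0 = τ_0 < ⋯ < τ_n = T` and a constant `L`
with `|c(t,u,v) - c(s,u,v)| ≤ L |t-s| ‖u‖_V ‖v‖_V` for `s, t` in the same interval
`(τ_{i-1}, τ_i)`. Jumps at the points `τ_i` are allowed. -/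
def IsPiecewiseLipschitz (T : ℝ) (c : ℝ → V →ₗ[𝕜] V →ₗ⋆[𝕜] 𝕜) : Prop :=
  ∃ (n : ℕ) (τ : Fin (n + 1) → ℝ) (L : ℝ), StrictMono τ ∧ τ 0 = 0 ∧ τ (Fin.last n) = T ∧
    ∀ i : Fin n, ∀ s ∈ Ioo (τ i.castSucc) (τ i.succ), ∀ t ∈ Ioo (τ i.castSucc) (τ i.succ),
      ∀ u v : V, ‖c t u v - c s u v‖ ≤ L * |t - s| * ‖u‖ * ‖v‖

/-- (Lebesgue) measurability of `c(·,u,v)` on `[0,T]` for all `u, v ∈ V`. -/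
def IsMeasurableForm (T : ℝ) (c : ℝ → V →ₗ[𝕜] V →ₗ⋆[𝕜] 𝕜) : Prop :=
  ∀ u v : V, AEStronglyMeasurable (fun t => c t u v) (volume.restrict (Icc (0 : ℝ) T))

/-- `V × H`-boundedness: `|c(t,u,v)| ≤ M ‖u‖_V ‖v‖_H` for `t ∈ [0,T]`. The embedding of `V`
into `H` is `ι`. -/
def IsVHBounded (ι : V →L[𝕜] H) (T : ℝ) (c : ℝ → V →ₗ[𝕜] V →ₗ⋆[𝕜] 𝕜) : Prop :=
  ∃ M : ℝ, ∀ t ∈ Icc (0 : ℝ) T, ∀ u v : V, ‖c t u v‖ ≤ M * ‖u‖ * ‖ι v‖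

/-! ### The antidual of `V` and the operators associated with forms -/

variable (𝕜 V) in
/-- The antidual `V'` of `V` (the dual if `𝕜 = ℝ`). -/
abbrev Antidual : Type _ := V →L⋆[𝕜] 𝕜

/-- The embedding of `H` into `V'` which sends `h` to `v ↦ (h | v)_H`. The scalar product
`(h | v)_H`, linear in `h` and antilinear in `v`, is `inner 𝕜 v h` in Mathlib. -/
def toAntidual (ι : V →L[𝕜] H) (h : H) : Antidual 𝕜 V :=
  ((innerSL 𝕜).flip h).comp ι

theorem toAntidual_apply (ι : V →L[𝕜] H) (h : H) (v : V) :
    toAntidual ι h v = inner 𝕜 (ι v) h := rfl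

open Classical in
/-- The operator `𝒜 : V → V'` associated with a bounded sesquilinear form `c`, given by
`⟨𝒜 u, v⟩ = c(u,v)` (and `0` if `c` is unbounded). -/
def formOp (c : V →ₗ[𝕜] V →ₗ⋆[𝕜] 𝕜) : V →L[𝕜] Antidual 𝕜 V :=
  if h : ∃ M : ℝ, ∀ u v : V, ‖c u v‖ ≤ M * ‖u‖ * ‖v‖ then
    c.mkContinuous₂ h.choose h.choose_spec
  else 0

theorem formOp_apply {c : V →ₗ[𝕜] V →ₗ⋆[𝕜] 𝕜}
    (h : ∃ M : ℝ, ∀ u v : V, ‖c u v‖ ≤ M * ‖u‖ * ‖v‖) (u v : V) :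
    formOp c u v = c u v := by
  rw [formOp, dif_pos h]
  rfl

/-! ### The damped wave equation -/

/-- The maximal regularity space `MR(V,V,H) = H¹(0,T;V) ∩ H²(0,T;H)`. -/
def MR (ι : V →L[𝕜] H) (T : ℝ) : Set (L2 T V) :=
  {u | MemHk 𝕜 1 u ∧ MemHk 𝕜 2 (ι.compLp u)}

/-- `u` solves `ü(t) + ℬ(t) u̇(t) + 𝒜(t) u(t) = f(t)` in `V'` for almost every `t ∈ (0,T)`, with
`u(0) = u₀` in `V` and `u̇(0) = u₁` in `H`. Here `u'`, `u''` are the weak derivatives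
`u̇ ∈ L²(0,T;V)` and `ü ∈ L²(0,T;H)`. -/
def IsSolution (ι : V →L[𝕜] H) {T : ℝ} (a b : ℝ → V →ₗ[𝕜] V →ₗ⋆[𝕜] 𝕜)
    (f : L2 T H) (u₀ u₁ : V) (u : L2 T V) : Prop :=
  ∃ (u' : L2 T V) (u'' : L2 T H),
    HasWeakDeriv 𝕜 u u' ∧ HasWeakDeriv 𝕜 (ι.compLp u') u'' ∧
    (∀ᵐ t ∂(volume.restrict (Ioo (0 : ℝ) T)),
      toAntidual ι (u'' t) + formOp (b t) (u' t) + formOp (a t) (u t) = toAntidual ι (f t)) ∧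
    (∃ w : ℝ → V, IsContRep u w ∧ w 0 = u₀) ∧
    (∃ w : ℝ → H, IsContRep (ι.compLp u') w ∧ w 0 = ι u₁)

end Forms

end

end DampedWave

/-! Taking real parts turns the sesquilinear forms into real bilinear ones without loss, since an
element of the antidual with vanishing real part is zero (`antidual_equation_iff`). Integrating the
weak derivatives, a solution becomes a pair of a velocity `v` and an acceleration `w` with `ι v = ι
u₁ + ∫ w`, and `u₀ + ∫ v` is the position in the equation (`IsVelocitySolution`).

On an interval where the principal parts are Lipschitz, existence follows from Lions' representation
theorem. The equation is tested with `exp (-r (t - p)) ψ`, where `ψ` is continuous with values in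
`V`, and the trial function paired with `ψ` is `φ = ∫ ψ`: the test function is the derivative of the
trial velocity. The acceleration term then gives `‖ι ψ‖²`. By symmetry, `b₁(φ, φ')` is half a total
derivative up to an error of order `L ‖φ‖²`, so for large `r` the weight produces a large multiple
of `∫ ‖φ‖²`, together with `‖φ(q)‖²`. The `a₁` term is integrated by parts and the `V × H`-bounded
terms are absorbed by Young's inequality (`LipschitzSetting.exists_coercive`). The same integration
by parts bounds the data functional by these quantities.

Since the final value `φ(q)` is controlled in `V`, Lions' theorem can be applied to triples `(v, w,
z)` whose third entry is the final velocity. The solution therefore ends with a velocity in `V`, not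
merely in `H`. That velocity is an admissible initial value on the next interval, so solutions can
be glued across the jumps (`PiecewiseSetting.solvable`).

Uniqueness is an energy estimate followed by Gronwall's inequality and needs no regularity in time
(`IsVelocitySolution.eq_zero`). For the last claim, solve on `[0,t]`: by uniqueness the result is
the restriction of the given solution, and its final velocity lies in `V`. -/

namespace DampedWave

open Filter Topology NNReal

/-! ### Absolutely continuous primitives of vector-valued functions -/

section Calculus

variable {E : Type*} [NormedAddCommGroup E]

theorem absolutelyContinuousOnInterval_of_dist_le {X Y : Type*} [PseudoMetricSpace X]
    [PseudoMetricSpace Y] {f : ℝ → X} {g : ℝ → Y} {a b K : ℝ}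
    (hg : AbsolutelyContinuousOnInterval g a b)
    (h : ∀ x ∈ uIcc a b, ∀ y ∈ uIcc a b, dist (f x) (f y) ≤ K * dist (g x) (g y)) :
    AbsolutelyContinuousOnInterval f a b := by
  have h0 : Tendsto (fun E : ℕ × (ℕ → ℝ × ℝ) ↦
      K * ∑ i ∈ Finset.range E.1, dist (g (E.2 i).1) (g (E.2 i).2))
      (AbsolutelyContinuousOnInterval.totalLengthFilter ⊓
        𝓟 (AbsolutelyContinuousOnInterval.disjWithin a b)) (𝓝 0) := by
    simpa using Filter.Tendsto.const_mul K hg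
  refine squeeze_zero' (Eventually.of_forall fun _ => Finset.sum_nonneg fun _ _ => dist_nonneg)
    ?_ h0
  filter_upwards [mem_inf_of_right (mem_principal_self _)] with I hI
  rw [Finset.mul_sum]
  refine Finset.sum_le_sum fun i hi => h _ (hI.1 i hi).1 _ (hI.1 i hi).2

variable [NormedSpace ℝ E]

theorem norm_integral_sub_le {w : ℝ → E} {p q : ℝ} (hw : IntervalIntegrable w volume p q)
    {x y : ℝ} (hx : x ∈ uIcc p q) (hy : y ∈ uIcc p q) :
    dist (∫ s in p..x, w s) (∫ s in p..y, w s)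
      ≤ dist (∫ s in p..x, ‖w s‖) (∫ s in p..y, ‖w s‖) := by
  have h1 : ∀ z ∈ uIcc p q, IntervalIntegrable w volume p z := fun z hz =>
    hw.mono_set (uIcc_subset_uIcc left_mem_uIcc hz)
  rw [dist_eq_norm, dist_eq_norm, intervalIntegral.integral_interval_sub_left (h1 x hx) (h1 y hy),
    intervalIntegral.integral_interval_sub_left (h1 x hx).norm (h1 y hy).norm]
  refine (intervalIntegral.norm_integral_le_abs_integral_norm).trans ?_
  rw [Real.norm_eq_abs]

theorem absolutelyContinuousOnInterval_integral {w : ℝ → E} {p q : ℝ}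
    (hw : IntervalIntegrable w volume p q) :
    AbsolutelyContinuousOnInterval (fun t => ∫ s in p..t, w s) p q :=
  absolutelyContinuousOnInterval_of_dist_le (K := 1)
    (hw.norm.absolutelyContinuousOnInterval_intervalIntegral left_mem_uIcc)
    (fun x hx y hy => by rw [one_mul]; exact norm_integral_sub_le hw hx hy)

/-- The difference of `f` and the primitive of `f'` is absolutely continuous with derivative zero
almost everywhere, hence constant. -/
theorem integral_eq_sub_of_ae_hasDerivAt [CompleteSpace E] {f f' : ℝ → E} {p q : ℝ}
    (hf : AbsolutelyContinuousOnInterval f p q) (hf' : IntervalIntegrable f' volume p q)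
    (h : ∀ᵐ x, x ∈ uIcc p q → HasDerivAt f (f' x) x) :
    ∫ t in p..q, f' t = f q - f p := by
  obtain ⟨C, hC⟩ := (hf.sub (absolutelyContinuousOnInterval_integral hf')).const_of_ae_hasDerivAt_zero
    (by
      filter_upwards [h, hf'.ae_hasDerivAt_integral] with x h1 h2 hx
      simpa using! (h1 hx).sub (h2 hx p left_mem_uIcc))
  have h1 := hC p left_mem_uIcc
  have h2 := hC q right_mem_uIcc
  simp only [Pi.sub_apply, intervalIntegral.integral_same, sub_zero] at h1 h2
  rw [h1, ← h2]; abel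

theorem integral_smul_primitive [CompleteSpace E] {φ φ' : ℝ → ℝ} {w : ℝ → E} {p q : ℝ}
    (hφ : ∀ t, HasDerivAt φ (φ' t) t) (hφ' : Continuous φ')
    (hw : IntervalIntegrable w volume p q) :
    ∫ t in p..q, (φ' t • (∫ s in p..t, w s) + φ t • w t) = φ q • ∫ s in p..q, w s := by
  have hφc : Continuous φ := continuous_iff_continuousAt.2 fun t => (hφ t).continuousAt
  have hφ1 : ContDiff ℝ 1 φ := by
    rw [contDiff_one_iff_deriv]
    refine ⟨fun t => (hφ t).differentiableAt, ?_⟩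
    have : deriv φ = φ' := funext fun t => (hφ t).deriv
    rwa [this]
  have hW := absolutelyContinuousOnInterval_integral hw
  have := integral_eq_sub_of_ae_hasDerivAt (f := φ • fun t => ∫ s in p..t, w s)
    (f' := fun t => φ t • w t + φ' t • (∫ s in p..t, w s)) (p := p) (q := q)
    ((hφ1.contDiffOn.absolutelyContinuousOnInterval).smul hW)
    (by
      refine IntervalIntegrable.add ?_ ?_
      · exact hw.continuousOn_smul hφc.continuousOn
      · exact (hφ'.continuousOn.smul hW.continuousOn).intervalIntegrable)
    (by
      filter_upwards [hw.ae_hasDerivAt_integral] with x h2 hx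
      exact (hφ x).smul (h2 hx p left_mem_uIcc))
  simpa [add_comm] using this

/-- Cauchy–Schwarz against the constant function, obtained from the nonnegativity of the variance of
`‖g‖` on `[p,t]`. -/
theorem norm_integral_sq_le {g : ℝ → E} {p t : ℝ} (hpt : p ≤ t)
    (hg : MemLp g 2 (volume.restrict (Ioc p t))) :
    ‖∫ s in p..t, g s‖ ^ 2 ≤ (t - p) * ∫ s in p..t, ‖g s‖ ^ 2 := by
  have hg2 : IntervalIntegrable (fun s => ‖g s‖ ^ 2) volume p t :=
    (intervalIntegrable_iff_integrableOn_Ioc_of_le hpt).2 hg.integrable_norm_pow'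
  have hg1 : IntervalIntegrable g volume p t :=
    (intervalIntegrable_iff_integrableOn_Ioc_of_le hpt).2 (hg.integrable (by norm_num))
  set m := ∫ s in p..t, ‖g s‖ with hm
  have h1 : ‖∫ s in p..t, g s‖ ≤ m := intervalIntegral.norm_integral_le_integral_norm hpt
  refine (pow_le_pow_left₀ (norm_nonneg _) h1 2).trans ?_
  rcases hpt.eq_or_lt with rfl | hlt
  · simp [hm]
  have h2 : 0 ≤ ∫ s in p..t, (‖g s‖ - m / (t - p)) ^ 2 :=
    intervalIntegral.integral_nonneg hpt fun _ _ => sq_nonneg _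
  have h3 : ∫ s in p..t, (‖g s‖ - m / (t - p)) ^ 2
      = (∫ s in p..t, ‖g s‖ ^ 2) - m ^ 2 / (t - p) := by
    have : ∀ s, (‖g s‖ - m / (t - p)) ^ 2
        = ‖g s‖ ^ 2 - ((2 * (m / (t - p))) * ‖g s‖ - (m / (t - p)) ^ 2) := fun s => by ring
    simp_rw [this]
    rw [intervalIntegral.integral_sub hg2 ((hg1.norm.const_mul _).sub (by simp)),
      intervalIntegral.integral_sub (hg1.norm.const_mul _) (by simp),
      intervalIntegral.integral_const_mul, ← hm, intervalIntegral.integral_const]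
    have : t - p ≠ 0 := by linarith
    simp only [smul_eq_mul]
    field_simp
    ring
  rw [h3] at h2
  have h4 : m ^ 2 / (t - p) ≤ ∫ s in p..t, ‖g s‖ ^ 2 := by linarith
  rw [div_le_iff₀ (by linarith)] at h4
  linarith

end Calculus

section InnerCalculus

variable {E : Type*} [NormedAddCommGroup E] [InnerProductSpace ℝ E] [CompleteSpace E]

/-- The kinetic term of the energy identity: the squared norm of a primitive is absolutely
continuous, because the primitive is so and is bounded. -/
theorem integral_inner_primitive {w : ℝ → E} {p q : ℝ} (hw : IntervalIntegrable w volume p q) :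
    IntervalIntegrable (fun t => inner ℝ (∫ s in p..t, w s) (w t)) volume p q ∧
    2 * ∫ t in p..q, inner ℝ (∫ s in p..t, w s) (w t) = ‖∫ s in p..q, w s‖ ^ 2 := by
  have hW := absolutelyContinuousOnInterval_integral hw
  obtain ⟨C, hC⟩ := hW.exists_bound
  have hint : IntervalIntegrable (fun t => inner ℝ (∫ s in p..t, w s) (w t)) volume p q := by
    refine (hw.norm.const_mul C).mono_fun ?_ ?_
    · refine AEStronglyMeasurable.inner ?_ hw.def'.aestronglyMeasurable
      exact (hW.continuousOn.mono uIoc_subset_uIcc).aestronglyMeasurable measurableSet_uIoc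
    · filter_upwards [ae_restrict_mem measurableSet_uIoc] with t ht
      refine (norm_inner_le_norm _ _).trans ?_
      rw [norm_mul, norm_norm]
      gcongr
      exact (hC t (uIoc_subset_uIcc ht)).trans (le_abs_self _)
  refine ⟨hint, ?_⟩
  have := integral_eq_sub_of_ae_hasDerivAt (f := fun t => ‖∫ s in p..t, w s‖ ^ 2)
    (f' := fun t => 2 * inner ℝ (∫ s in p..t, w s) (w t)) (p := p) (q := q)
    (by
      refine absolutelyContinuousOnInterval_of_dist_le (K := 2 * C) hW fun x hx y hy => ?_
      rw [Real.dist_eq, sq_sub_sq, abs_mul]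
      have h1 := hC x hx
      have h2 := hC y hy
      have h3 := abs_norm_sub_norm_le (∫ s in p..x, w s) (∫ s in p..y, w s)
      rw [← dist_eq_norm] at h3
      refine mul_le_mul ?_ h3 (abs_nonneg _) (by linarith [norm_nonneg (∫ s in p..x, w s)])
      rw [abs_of_nonneg (by positivity)]; linarith)
    (hint.const_mul 2)
    (by
      filter_upwards [hw.ae_hasDerivAt_integral] with x h2 hx
      exact (h2 hx p left_mem_uIcc).norm_sq)
  rw [← intervalIntegral.integral_const_mul, this]
  simp

end InnerCalculus

/-! ### Integration by parts for forms that are Lipschitz in time -/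

section LipschitzForms

variable {V : Type*} [NormedAddCommGroup V] [NormedSpace ℝ V]

/-- A Lipschitz map into the space of forms need not be differentiable, so the product rule is
replaced by a comparison argument for right slopes. The variation of the form costs at most `L ‖g‖
‖φ‖`. -/
theorem sub_le_integral_of_lipschitz_form {c : ℝ → V →L[ℝ] V →L[ℝ] ℝ} {L : ℝ≥0}
    (hc : LipschitzWith L c) {g g' φ φ' : ℝ → V} (hg : ∀ t, HasDerivAt g (g' t) t)
    (hg' : Continuous g') (hφ : ∀ t, HasDerivAt φ (φ' t) t) (hφ' : Continuous φ')
    {p q : ℝ} (hpq : p ≤ q) :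
    c q (g q) (φ q) - c p (g p) (φ p) ≤
      ∫ t in p..q, (c t (g' t) (φ t) + c t (g t) (φ' t) + L * (‖g t‖ * ‖φ t‖)) := by
  have hgc : Continuous g := continuous_iff_continuousAt.2 fun t => (hg t).continuousAt
  have hφc : Continuous φ := continuous_iff_continuousAt.2 fun t => (hφ t).continuousAt
  have hcc : Continuous c := hc.continuous
  set B' : ℝ → ℝ := fun t => c t (g' t) (φ t) + c t (g t) (φ' t) + L * (‖g t‖ * ‖φ t‖) with hB'
  have hB'c : Continuous B' := by fun_prop
  have key := image_le_of_liminf_slope_right_le_deriv_boundary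
    (f := fun t => c t (g t) (φ t)) (a := p) (b := q)
    (B := fun t => c p (g p) (φ p) + ∫ s in p..t, B' s) (B' := B')
    (by fun_prop) (by simp)
    (by
      refine Continuous.continuousOn (continuous_const.add ?_)
      exact intervalIntegral.continuous_primitive (fun a b => hB'c.intervalIntegrable a b) p)
    (fun x _ => ((hB'c.integral_hasStrictDerivAt p x).hasDerivAt.const_add _).hasDerivWithinAt)
    (by
      intro x _ r hr
      refine Eventually.frequently ?_
      -- With the form frozen at time `x`, the ordinary product rule applies; the change from `c x`
      -- to `c z` is paid by the Lipschitz constant.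
      have h1 : HasDerivAt (fun z => c x (g z) (φ z)) (c x (g' x) (φ x) + c x (g x) (φ' x)) x := by
        have := ((c x).hasFDerivAt.comp_hasDerivAt x (hg x)).clm_apply (hφ x)
        simpa using this
      have h2 : Tendsto (fun z => slope (fun z => c x (g z) (φ z)) x z + L * (‖g z‖ * ‖φ z‖))
          (𝓝[>] x) (𝓝 (B' x)) := by
        refine Tendsto.add ?_ ?_
        · exact h1.tendsto_slope.mono_left (nhdsWithin_mono _ fun z hz => ne_of_gt hz)
        · exact (Continuous.tendsto (by fun_prop) x).mono_left nhdsWithin_le_nhds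
      filter_upwards [h2.eventually_lt_const hr, self_mem_nhdsWithin] with z hz hxz
      refine lt_of_le_of_lt ?_ hz
      have hxz' : 0 < z - x := sub_pos.2 hxz
      have h3 : (c z - c x) (g z) (φ z) ≤ L * (z - x) * ‖g z‖ * ‖φ z‖ := by
        refine (le_abs_self _).trans (((c z - c x).le_opNorm₂ _ _).trans ?_)
        gcongr
        have := hc.dist_le_mul z x
        rwa [dist_eq_norm, Real.dist_eq, abs_of_pos hxz'] at this
      simp only [sub_apply] at h3
      rw [slope_def_field, slope_def_field, div_add' _ _ _ hxz'.ne']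
      gcongr
      nlinarith)
  have := key (right_mem_Icc.2 hpq)
  linarith

/-- The one-sided estimate for `g` and for `-g` gives both bounds. -/
theorem abs_integral_sub_le_of_lipschitz_form {c : ℝ → V →L[ℝ] V →L[ℝ] ℝ} {L : ℝ≥0}
    (hc : LipschitzWith L c) {g g' φ φ' : ℝ → V} (hg : ∀ t, HasDerivAt g (g' t) t)
    (hg' : Continuous g') (hφ : ∀ t, HasDerivAt φ (φ' t) t) (hφ' : Continuous φ')
    {p q : ℝ} (hpq : p ≤ q) :
    |(∫ t in p..q, (c t (g' t) (φ t) + c t (g t) (φ' t)))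
        - (c q (g q) (φ q) - c p (g p) (φ p))| ≤ ∫ t in p..q, L * (‖g t‖ * ‖φ t‖) := by
  have hgc : Continuous g := continuous_iff_continuousAt.2 fun t => (hg t).continuousAt
  have hφc : Continuous φ := continuous_iff_continuousAt.2 fun t => (hφ t).continuousAt
  have hcc : Continuous c := hc.continuous
  have h1 := sub_le_integral_of_lipschitz_form hc hg hg' hφ hφ' hpq
  have h2 := sub_le_integral_of_lipschitz_form hc (fun t => (hg t).neg) hg'.neg hφ hφ' hpq
  rw [intervalIntegral.integral_add (Continuous.intervalIntegrable (by fun_prop) _ _)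
    (Continuous.intervalIntegrable (by fun_prop) _ _)] at h1 h2
  simp only [Pi.neg_apply, map_neg, neg_apply, norm_neg, ← neg_add,
    intervalIntegral.integral_neg] at h2
  rw [abs_le]
  constructor <;> linarith

end LipschitzForms

/-! ### The exponential weight -/

section Weight

/-- The exponential weight `t ↦ exp (-r (t - p))`. -/
noncomputable def expWeight (r p t : ℝ) : ℝ := Real.exp (-(r * (t - p)))

variable {r p t : ℝ}

theorem expWeight_pos : 0 < expWeight r p t := Real.exp_pos _

theorem expWeight_le_one (hr : 0 ≤ r) (h : p ≤ t) : expWeight r p t ≤ 1 :=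
  Real.exp_le_one_iff.2 (by nlinarith)

theorem expWeight_antitone (hr : 0 ≤ r) : Antitone (expWeight r p) := fun s t h =>
  Real.exp_le_exp.2 (by nlinarith)

theorem hasDerivAt_expWeight : HasDerivAt (expWeight r p) (-(r * expWeight r p t)) t := by
  have h := ((((hasDerivAt_id t).sub_const p).const_mul r).neg).exp
  refine h.congr_deriv ?_
  simp [expWeight]; ring

@[fun_prop]
theorem continuous_expWeight : Continuous (expWeight r p) := by
  unfold expWeight; fun_prop

/-- In the weighted norm, integration gains a factor `r⁻¹`. -/
theorem expWeight_mul_norm_primitive_sq_le {E : Type*} [NormedAddCommGroup E]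
    [InnerProductSpace ℝ E] {φ U : ℝ → E} (hr : 0 < r) (hφ : Continuous φ)
    (hU : ∀ t, HasDerivAt U (φ t) t) (hUp : U p = 0) (hpt : p ≤ t) :
    expWeight r p t * ‖U t‖ ^ 2 ≤ r⁻¹ * ∫ s in p..t, expWeight r p s * ‖φ s‖ ^ 2 := by
  have hc : Continuous fun s => expWeight r p s * ‖φ s‖ ^ 2 := by fun_prop
  have hd : ∀ s, HasDerivAt (fun t => (r⁻¹ * ∫ s in p..t, expWeight r p s * ‖φ s‖ ^ 2)
      - expWeight r p t * ‖U t‖ ^ 2)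
      (r⁻¹ * (expWeight r p s * ‖φ s‖ ^ 2) - (-(r * expWeight r p s) * ‖U s‖ ^ 2
        + expWeight r p s * (2 * inner ℝ (U s) (φ s)))) s := fun s =>
    ((hc.integral_hasStrictDerivAt p s).hasDerivAt.const_mul _).sub
      (hasDerivAt_expWeight.mul (hU s).norm_sq)
  -- The derivative of the difference of the two sides is `r⁻¹` times the weight times `‖φ - r U‖²`.
  have hmono := monotone_of_hasDerivAt_nonneg hd (fun s => by
    have h1 : 0 ≤ ‖φ s - r • U s‖ ^ 2 := sq_nonneg _
    rw [norm_sub_sq_real, inner_smul_right, norm_smul, Real.norm_of_nonneg hr.le, mul_pow,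
      real_inner_comm] at h1
    have h2 : r⁻¹ * (expWeight r p s * ‖φ s‖ ^ 2) - (-(r * expWeight r p s) * ‖U s‖ ^ 2
        + expWeight r p s * (2 * inner ℝ (U s) (φ s))) = expWeight r p s * r⁻¹ *
        (‖φ s‖ ^ 2 - 2 * (r * inner ℝ (U s) (φ s)) + r ^ 2 * ‖U s‖ ^ 2) := by
      field_simp; ring
    simp only [Pi.zero_apply, h2]
    have := (expWeight_pos (r := r) (p := p) (t := s)).le
    positivity)
  have := hmono hpt
  simp only [intervalIntegral.integral_same, hUp, norm_zero] at this
  linarith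

end Weight

/-! ### Measurability of a form along measurable curves -/

section Measurability

variable {V : Type*} [NormedAddCommGroup V] [NormedSpace ℝ V] [SecondCountableTopology V]

/-- A Carathéodory argument: the form is continuous in `(u, v)` and measurable in `t`. The
exceptional null set may depend on the pair `(u, v)`, so one works with the σ-algebra of
null-measurable sets, for which each `t ↦ c t u v` is genuinely measurable. -/
theorem aestronglyMeasurable_form_apply {μ : Measure ℝ} {c : ℝ → V →L[ℝ] V →L[ℝ] ℝ}
    (hc : ∀ u v, AEStronglyMeasurable (fun t => c t u v) μ) {v ψ : ℝ → V}
    (hv : AEStronglyMeasurable v μ) (hψ : AEStronglyMeasurable ψ μ) :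
    AEStronglyMeasurable (fun t => c t (v t) (ψ t)) μ := by
  borelize V
  set v' := hv.mk v
  set ψ' := hψ.mk ψ
  suffices h : AEStronglyMeasurable (fun t => c t (v' t) (ψ' t)) μ by
    refine h.congr ?_
    filter_upwards [hv.ae_eq_mk, hψ.ae_eq_mk] with t h1 h2
    simp only [v', ψ', ← h1, ← h2]
  have h1 : ∀ i : V × V, StronglyMeasurable
      (fun t : NullMeasurableSpace ℝ μ => c t i.1 i.2) := fun i =>
    Measurable.stronglyMeasurable ((hc i.1 i.2).aemeasurable.nullMeasurable.measurable')
  have h2 := stronglyMeasurable_uncurry_of_continuous_of_stronglyMeasurable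
    (u := fun (i : V × V) (t : NullMeasurableSpace ℝ μ) => c t i.1 i.2)
    (fun t => by fun_prop) h1
  have hid : @Measurable (NullMeasurableSpace ℝ μ) ℝ _ _ fun t => t := fun s hs =>
    MeasurableSet.nullMeasurableSet (μ := μ) hs
  have h3 : Measurable (fun t : NullMeasurableSpace ℝ μ => ((v' t, ψ' t), t)) :=
    ((hv.measurable_mk.comp hid).prodMk (hψ.measurable_mk.comp hid)).prodMk measurable_id
  have h4 : NullMeasurable (fun t => c t (v' t) (ψ' t)) μ := h2.measurable.comp h3
  exact h4.aemeasurable.aestronglyMeasurable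

end Measurability

/-! ### Weighted estimates for the principal parts -/

section Estimates

variable {V : Type*} [NormedAddCommGroup V] [InnerProductSpace ℝ V]
  {H : Type*} [NormedAddCommGroup H] [InnerProductSpace ℝ H]

theorem form_le {c : V →L[ℝ] V →L[ℝ] ℝ} {M : ℝ} (hM : ‖c‖ ≤ M) (u v : V) :
    |c u v| ≤ M * ‖u‖ * ‖v‖ :=
  (c.le_opNorm₂ u v).trans (by gcongr)

/-- Integration by parts moves the derivative from `φ` to the weighted `G`, so only `φ` and not `ψ`
has to be controlled in `V`. Differentiating the weight produces the term `r * M`, the time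
dependence of the form the term `L`. -/
theorem abs_integral_expWeight_form_le {c : ℝ → V →L[ℝ] V →L[ℝ] ℝ} {L : ℝ≥0}
    (hc : LipschitzWith L c) {M : ℝ} (hM : ∀ t, ‖c t‖ ≤ M) {r p q : ℝ} (hr : 0 ≤ r) (hpq : p ≤ q)
    {G G' φ ψ : ℝ → V} (hG : ∀ t, HasDerivAt G (G' t) t) (hG' : Continuous G')
    (hφ : ∀ t, HasDerivAt φ (ψ t) t) (hψ : Continuous ψ) (hφp : φ p = 0) :
    |∫ t in p..q, expWeight r p t * c t (G t) (ψ t)| ≤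
      expWeight r p q * (M * ‖G q‖ * ‖φ q‖) +
        ∫ t in p..q, expWeight r p t * ((M * ‖G' t‖ + (r * M + L) * ‖G t‖) * ‖φ t‖) := by
  have hGc : Continuous G := continuous_iff_continuousAt.2 fun t => (hG t).continuousAt
  have hφc : Continuous φ := continuous_iff_continuousAt.2 fun t => (hφ t).continuousAt
  have hcc : Continuous c := hc.continuous
  have hM0 : 0 ≤ M := (norm_nonneg (c 0)).trans (hM 0)
  have h1 := abs_integral_sub_le_of_lipschitz_form hc
    (g := fun t => expWeight r p t • G t)
    (fun t => (hasDerivAt_expWeight (r := r) (p := p) (t := t)).smul (hG t))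
    (by fun_prop) hφ hψ hpq
  simp only [hφp, map_zero, sub_zero, map_add, map_smul, add_apply,
    smul_apply, smul_eq_mul, norm_smul] at h1
  rw [intervalIntegral.integral_add (Continuous.intervalIntegrable (by fun_prop) _ _)
    (Continuous.intervalIntegrable (by fun_prop) _ _)] at h1
  have h2 : |expWeight r p q * c q (G q) (φ q)| ≤ expWeight r p q * (M * ‖G q‖ * ‖φ q‖) := by
    rw [abs_mul, abs_of_pos expWeight_pos]
    gcongr
    · exact expWeight_pos.le
    · exact form_le (hM q) _ _
  have h3 : |∫ t in p..q, (expWeight r p t * c t (G' t) (φ t)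
      + -(r * expWeight r p t) * c t (G t) (φ t))| ≤
      ∫ t in p..q, expWeight r p t * ((M * ‖G' t‖ + (r * M) * ‖G t‖) * ‖φ t‖) := by
    refine (intervalIntegral.abs_integral_le_integral_abs hpq).trans
      (intervalIntegral.integral_mono_on hpq (Continuous.intervalIntegrable (by fun_prop) _ _)
        (Continuous.intervalIntegrable (by fun_prop) _ _) fun t _ => ?_)
    have := expWeight_pos (r := r) (p := p) (t := t)
    refine (abs_add_le _ _).trans ?_
    rw [abs_mul, abs_mul, abs_neg, abs_mul, abs_of_pos this, abs_of_nonneg hr]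
    have h4 := form_le (hM t) (G' t) (φ t)
    have h5 := form_le (hM t) (G t) (φ t)
    calc _ ≤ expWeight r p t * (M * ‖G' t‖ * ‖φ t‖)
          + r * expWeight r p t * (M * ‖G t‖ * ‖φ t‖) := by gcongr
      _ = _ := by ring
  have h6 : ∫ t in p..q, expWeight r p t * ((M * ‖G' t‖ + (r * M + L) * ‖G t‖) * ‖φ t‖)
      = (∫ t in p..q, expWeight r p t * ((M * ‖G' t‖ + (r * M) * ‖G t‖) * ‖φ t‖))
        + ∫ t in p..q, L * (‖expWeight r p t‖ * ‖G t‖ * ‖φ t‖) := by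
    rw [← intervalIntegral.integral_add (Continuous.intervalIntegrable (by fun_prop) _ _)
      (Continuous.intervalIntegrable (by fun_prop) _ _)]
    refine intervalIntegral.integral_congr fun t _ => ?_
    simp only [Real.norm_of_nonneg expWeight_pos.le]
    ring
  rw [h6]
  rw [abs_le] at *
  constructor <;> linarith [h1.1, h1.2, h2.1, h2.2, h3.1, h3.2]

/-- By symmetry the integrand is half the derivative of the weighted `c(φ, φ)`, apart from the
derivative of the weight, which contributes the favourable `r * α`, and the Lipschitz error `L`. -/
theorem le_integral_expWeight_form {c : ℝ → V →L[ℝ] V →L[ℝ] ℝ} {L : ℝ≥0}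
    (hc : LipschitzWith L c) {α : ℝ} (hα : ∀ t u, α * ‖u‖ ^ 2 ≤ c t u u)
    (hsymm : ∀ t u v, c t u v = c t v u) {r p q : ℝ} (hr : 0 ≤ r) (hpq : p ≤ q)
    {φ ψ : ℝ → V} (hφ : ∀ t, HasDerivAt φ (ψ t) t) (hψ : Continuous ψ) (hφp : φ p = 0) :
    α / 2 * (expWeight r p q * ‖φ q‖ ^ 2)
      + (r * α - L) / 2 * ∫ t in p..q, expWeight r p t * ‖φ t‖ ^ 2 ≤
      ∫ t in p..q, expWeight r p t * c t (φ t) (ψ t) := by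
  have hφc : Continuous φ := continuous_iff_continuousAt.2 fun t => (hφ t).continuousAt
  have hcc : Continuous c := hc.continuous
  have h1 := (abs_le.1 (abs_integral_sub_le_of_lipschitz_form hc
    (g := fun t => expWeight r p t • φ t)
    (fun t => (hasDerivAt_expWeight (r := r) (p := p) (t := t)).smul (hφ t))
    (by fun_prop) hφ hψ hpq)).1
  simp only [hφp, map_zero, sub_zero, map_add, map_smul, add_apply,
    smul_apply, smul_eq_mul, norm_smul,
    Real.norm_of_nonneg expWeight_pos.le] at h1
  have h2 : ∫ t in p..q, (expWeight r p t * c t (ψ t) (φ t)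
      + -(r * expWeight r p t) * c t (φ t) (φ t) + expWeight r p t * c t (φ t) (ψ t))
      ≤ ∫ t in p..q, (2 * (expWeight r p t * c t (φ t) (ψ t))
        - r * α * (expWeight r p t * ‖φ t‖ ^ 2)) := by
    refine intervalIntegral.integral_mono_on hpq (Continuous.intervalIntegrable (by fun_prop) _ _)
        (Continuous.intervalIntegrable (by fun_prop) _ _) fun t _ => ?_
    rw [hsymm t (ψ t)]
    have := mul_le_mul_of_nonneg_left (hα t (φ t))
      (mul_nonneg hr (expWeight_pos (r := r) (p := p) (t := t)).le)
    linarith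
  rw [intervalIntegral.integral_sub (Continuous.intervalIntegrable (by fun_prop) _ _)
    (Continuous.intervalIntegrable (by fun_prop) _ _), intervalIntegral.integral_const_mul,
    intervalIntegral.integral_const_mul] at h2
  have h3 : ∫ t in p..q, L * (expWeight r p t * ‖φ t‖ * ‖φ t‖)
      = L * ∫ t in p..q, expWeight r p t * ‖φ t‖ ^ 2 := by
    rw [← intervalIntegral.integral_const_mul]
    refine intervalIntegral.integral_congr fun t _ => ?_
    ring
  rw [h3] at h1
  have h4 := mul_le_mul_of_nonneg_left (hα q (φ q)) (expWeight_pos (r := r) (p := p) (t := q)).le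
  linarith

end Estimates

/-! ### Coercivity when the test function is the derivative of the trial velocity -/

section Coercivity

variable {V : Type*} [NormedAddCommGroup V] [InnerProductSpace ℝ V]
  {H : Type*} [NormedAddCommGroup H] [InnerProductSpace ℝ H]

/-- Standing assumptions on the real forms on a time interval `[p,q]` on which the principal parts
`a₁`, `b₁` are Lipschitz continuous. -/
structure LipschitzSetting (ι : V →L[ℝ] H) (p q : ℝ) (a₁ a₂ b₁ b₂ : ℝ → V →L[ℝ] V →L[ℝ] ℝ)
    (L : ℝ≥0) (M α : ℝ) : Prop where
  le : p ≤ q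
  nonneg : 0 ≤ M
  pos : 0 < α
  lipschitz_a : LipschitzWith L a₁
  lipschitz_b : LipschitzWith L b₁
  bound_a : ∀ t, ‖a₁ t‖ ≤ M
  bound_b : ∀ t, ‖b₁ t‖ ≤ M
  coercive : ∀ t u, α * ‖u‖ ^ 2 ≤ b₁ t u u
  symm : ∀ t u v, b₁ t u v = b₁ t v u
  measurable_a : ∀ u v, AEStronglyMeasurable (fun t => a₂ t u v) (volume.restrict (Ioc p q))
  measurable_b : ∀ u v, AEStronglyMeasurable (fun t => b₂ t u v) (volume.restrict (Ioc p q))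
  bound_a₂ : ∀ t u v, |a₂ t u v| ≤ M * ‖u‖ * ‖ι v‖
  bound_b₂ : ∀ t u v, |b₂ t u v| ≤ M * ‖u‖ * ‖ι v‖

theorem intervalIntegrable_form_apply [SecondCountableTopology V] {ι : V →L[ℝ] H}
    {c : ℝ → V →L[ℝ] V →L[ℝ] ℝ} {p q M : ℝ} (hpq : p ≤ q)
    (hc : ∀ u v, AEStronglyMeasurable (fun t => c t u v) (volume.restrict (Ioc p q)))
    (hM : ∀ t u v, |c t u v| ≤ M * ‖u‖ * ‖ι v‖) {v ψ : ℝ → V} (hv : Continuous v)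
    (hψ : Continuous ψ) {e : ℝ → ℝ} (he : Continuous e) :
    IntervalIntegrable (fun t => e t * c t (v t) (ψ t)) volume p q := by
  have h1 : IntervalIntegrable (fun t => ‖e t‖ * (M * ‖v t‖ * ‖ι (ψ t)‖)) volume p q :=
    Continuous.intervalIntegrable (by fun_prop) _ _
  refine h1.mono_fun ?_ (Eventually.of_forall fun t => ?_)
  · rw [uIoc_of_le hpq]
    exact he.aestronglyMeasurable.mul
      (aestronglyMeasurable_form_apply hc hv.aestronglyMeasurable hψ.aestronglyMeasurable)
  · simp only [norm_mul, norm_norm]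
    gcongr
    refine (hM t _ _).trans ((le_abs_self _).trans_eq ?_)
    simp [abs_mul]

variable [SecondCountableTopology V] {ι : V →L[ℝ] H} {p q : ℝ}
  {a₁ a₂ b₁ b₂ : ℝ → V →L[ℝ] V →L[ℝ] ℝ} {L : ℝ≥0} {M α : ℝ}

set_option maxHeartbeats 800000 in
-- The good terms come from the inner product and from `b₁`; everything else is absorbed by taking
-- `r` large. The `a₁` term carries a factor `r` itself, but `U` is a primitive of `φ`, so its
-- weighted square gains `r⁻¹`, which compensates.
theorem LipschitzSetting.exists_coercive (h : LipschitzSetting ι p q a₁ a₂ b₁ b₂ L M α) :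
    ∃ r : ℝ, 0 < r ∧ ∀ U φ ψ : ℝ → V, Continuous ψ → (∀ t, HasDerivAt φ (ψ t) t) →
      (∀ t, HasDerivAt U (φ t) t) → φ p = 0 → U p = 0 →
      1 / 2 * (∫ t in p..q, expWeight r p t * ‖ι (ψ t)‖ ^ 2)
        + α / 4 * (expWeight r p q * ‖φ q‖ ^ 2) + ∫ t in p..q, expWeight r p t * ‖φ t‖ ^ 2 ≤
      ∫ t in p..q, expWeight r p t * (inner ℝ (ι (ψ t)) (ι (ψ t))
        + (b₁ t + b₂ t) (φ t) (ψ t) + (a₁ t + a₂ t) (U t) (ψ t)) := by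
  -- `C` collects every coefficient of `X` below that does not grow with `r`.
  set C : ℝ := L / 2 + M + 2 * (M + L) ^ 2 / α * (q - p) + M ^ 2 / α + M ^ 2 + M ^ 2 * (q - p)
    with hC
  have hM := h.nonneg
  have hα := h.pos
  have hpq := h.le
  have hpq' : 0 ≤ q - p := sub_nonneg.2 hpq
  have hC0 : 0 ≤ C := by positivity
  set r : ℝ := 1 + 4 * (C + 1) / α with hr
  have hr1 : 1 ≤ r := by rw [hr, le_add_iff_nonneg_right]; positivity
  have hr0 : 0 < r := by linarith
  have hrα : 4 * (C + 1) ≤ r * α := by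
    rw [hr, add_mul, div_mul_cancel₀ _ hα.ne']; linarith
  refine ⟨r, hr0, fun U φ ψ hψ hφ hU hφp hUp => ?_⟩
  have hφc : Continuous φ := continuous_iff_continuousAt.2 fun t => (hφ t).continuousAt
  have hUc : Continuous U := continuous_iff_continuousAt.2 fun t => (hU t).continuousAt
  have hac := h.lipschitz_a.continuous
  have hbc := h.lipschitz_b.continuous
  set e := expWeight r p with he
  have hepos : ∀ t, 0 < e t := fun t => expWeight_pos
  have hec : Continuous e := continuous_expWeight
  set X := ∫ t in p..q, e t * ‖φ t‖ ^ 2 with hX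
  set Y := ∫ t in p..q, e t * ‖ι (ψ t)‖ ^ 2 with hY
  have hXint : ∀ x y, IntervalIntegrable (fun t => e t * ‖φ t‖ ^ 2) volume x y := fun x y =>
    Continuous.intervalIntegrable (by fun_prop) _ _
  have hYint : IntervalIntegrable (fun t => e t * ‖ι (ψ t)‖ ^ 2) volume p q :=
    Continuous.intervalIntegrable (by fun_prop) _ _
  have hX0 : 0 ≤ X := intervalIntegral.integral_nonneg hpq fun t _ =>
    mul_nonneg (hepos t).le (sq_nonneg _)
  have hUb : ∀ t ∈ Icc p q, r * (e t * ‖U t‖ ^ 2) ≤ X := by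
    intro t ht
    have h1 := expWeight_mul_norm_primitive_sq_le hr0 hφc hU hUp ht.1
    have h2 : ∫ s in p..t, e s * ‖φ s‖ ^ 2 ≤ X :=
      intervalIntegral.integral_mono_interval le_rfl ht.1 ht.2
        (Eventually.of_forall fun t => mul_nonneg (hepos t).le (sq_nonneg _)) (hXint _ _)
    rw [inv_mul_eq_div, le_div_iff₀ hr0] at h1
    linarith
  have hUb' : ∀ t ∈ Icc p q, e t * ‖U t‖ ^ 2 ≤ X := fun t ht => by
    have := mul_nonneg (hepos t).le (sq_nonneg ‖U t‖)
    nlinarith [hUb t ht]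
  have hb₁ := le_integral_expWeight_form h.lipschitz_b h.coercive h.symm hr0.le hpq hφ hψ hφp
  have ha₁ := (abs_le.1 (abs_integral_expWeight_form_le h.lipschitz_a h.bound_a hr0.le hpq hU hφc
    hφ hψ hφp)).1
  rw [← he] at ha₁ hb₁
  rw [← hX] at hb₁
  have hI1 : IntervalIntegrable (fun t => e t * b₁ t (φ t) (ψ t)) volume p q :=
    Continuous.intervalIntegrable (by fun_prop) _ _
  have hI2 := intervalIntegrable_form_apply hpq h.measurable_b h.bound_b₂ hφc hψ hec
  have hI3 : IntervalIntegrable (fun t => e t * a₁ t (U t) (ψ t)) volume p q :=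
    Continuous.intervalIntegrable (by fun_prop) _ _
  have hI4 := intervalIntegrable_form_apply hpq h.measurable_a h.bound_a₂ hUc hψ hec
  have hsplit : ∫ t in p..q, e t * (inner ℝ (ι (ψ t)) (ι (ψ t))
        + (b₁ t + b₂ t) (φ t) (ψ t) + (a₁ t + a₂ t) (U t) (ψ t))
      = Y + (∫ t in p..q, e t * b₁ t (φ t) (ψ t)) + (∫ t in p..q, e t * b₂ t (φ t) (ψ t))
        + (∫ t in p..q, e t * a₁ t (U t) (ψ t)) + ∫ t in p..q, e t * a₂ t (U t) (ψ t) := by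
    rw [hY, ← intervalIntegral.integral_add hYint hI1,
      ← intervalIntegral.integral_add (hYint.add hI1) hI2,
      ← intervalIntegral.integral_add ((hYint.add hI1).add hI2) hI3,
      ← intervalIntegral.integral_add (((hYint.add hI1).add hI2).add hI3) hI4]
    refine intervalIntegral.integral_congr fun t _ => ?_
    simp only [real_inner_self_eq_norm_sq, add_apply]
    ring
  have hb₂ : -(1 / 4 * Y + M ^ 2 * X) ≤ ∫ t in p..q, e t * b₂ t (φ t) (ψ t) := by
    rw [hX, hY, ← intervalIntegral.integral_const_mul, ← intervalIntegral.integral_const_mul,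
      ← intervalIntegral.integral_add (hYint.const_mul _) ((hXint _ _).const_mul _),
      ← intervalIntegral.integral_neg]
    refine intervalIntegral.integral_mono_on hpq
      ((hYint.const_mul _).add ((hXint _ _).const_mul _)).neg hI2 fun t _ => ?_
    have h1 := (abs_le.1 (h.bound_b₂ t (φ t) (ψ t))).1
    have h2 : -(1 / 4 * ‖ι (ψ t)‖ ^ 2 + M ^ 2 * ‖φ t‖ ^ 2) ≤ b₂ t (φ t) (ψ t) := by
      nlinarith [sq_nonneg (1 / 2 * ‖ι (ψ t)‖ - M * ‖φ t‖)]
    linarith [mul_le_mul_of_nonneg_left h2 (hepos t).le]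
  have ha₂ : -(1 / 4 * Y + M ^ 2 * X * (q - p)) ≤ ∫ t in p..q, e t * a₂ t (U t) (ψ t) := by
    have : M ^ 2 * X * (q - p) = ∫ _t in p..q, M ^ 2 * X := by
      rw [intervalIntegral.integral_const, smul_eq_mul, mul_comm]
    rw [this, hY, ← intervalIntegral.integral_const_mul,
      ← intervalIntegral.integral_add (hYint.const_mul _) (by simp),
      ← intervalIntegral.integral_neg]
    refine intervalIntegral.integral_mono_on hpq
      ((hYint.const_mul _).add (by simp)).neg hI4 fun t ht => ?_
    have h1 := (abs_le.1 (h.bound_a₂ t (U t) (ψ t))).1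
    have h2 : -(1 / 4 * ‖ι (ψ t)‖ ^ 2 + M ^ 2 * ‖U t‖ ^ 2) ≤ a₂ t (U t) (ψ t) := by
      nlinarith [sq_nonneg (1 / 2 * ‖ι (ψ t)‖ - M * ‖U t‖)]
    have h3 := mul_le_mul_of_nonneg_left (hUb' t ht) (sq_nonneg M)
    linarith [mul_le_mul_of_nonneg_left h2 (hepos t).le]
  have ha₁' : ∫ t in p..q, e t * ((M * ‖φ t‖ + (r * M + L) * ‖U t‖) * ‖φ t‖) ≤
      (M + r * α / 8) * X + 2 * (M + L) ^ 2 / α * X * (q - p) := by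
    have : 2 * (M + L) ^ 2 / α * X * (q - p) = ∫ _t in p..q, 2 * (M + L) ^ 2 / α * X := by
      rw [intervalIntegral.integral_const, smul_eq_mul, mul_comm]
    rw [this, hX, ← intervalIntegral.integral_const_mul,
      ← intervalIntegral.integral_add ((hXint _ _).const_mul _) (by simp)]
    refine intervalIntegral.integral_mono_on hpq (Continuous.intervalIntegrable (by fun_prop) _ _)
      (((hXint _ _).const_mul _).add (by simp)) fun t ht => ?_
    rw [← hX]
    have h1 : (r * M + L) * ‖U t‖ * ‖φ t‖ ≤
        r * α / 8 * ‖φ t‖ ^ 2 + 2 * (M + L) ^ 2 / α * (r * ‖U t‖ ^ 2) := by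
      -- Since `1 ≤ r`, the common factor `r` can be pulled out; Young's inequality then puts it on
      -- `‖U t‖ ^ 2`, where it is absorbed by `hUb`.
      have h2 : (r * M + L) * ‖U t‖ * ‖φ t‖ ≤ r * (M + L) * ‖U t‖ * ‖φ t‖ := by
        gcongr
        nlinarith [L.2]
      refine h2.trans ?_
      have h3 : r * α / 8 * ‖φ t‖ ^ 2 + 2 * (M + L) ^ 2 / α * (r * ‖U t‖ ^ 2)
          - r * (M + L) * ‖U t‖ * ‖φ t‖
          = r / (8 * α) * (α * ‖φ t‖ - 4 * (M + L) * ‖U t‖) ^ 2 := by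
        field_simp; ring
      have : 0 ≤ r / (8 * α) * (α * ‖φ t‖ - 4 * (M + L) * ‖U t‖) ^ 2 := by positivity
      linarith
    have h4 := mul_le_mul_of_nonneg_left (hUb t ht)
      (show 0 ≤ 2 * (M + L) ^ 2 / α by positivity)
    have h5 := mul_le_mul_of_nonneg_left h1 (hepos t).le
    generalize 2 * (M + L) ^ 2 / α = K at h4 h5 ⊢
    linarith
  have hbd : e q * (M * ‖U q‖ * ‖φ q‖) ≤ α / 4 * (e q * ‖φ q‖ ^ 2) + M ^ 2 / α * X := by
    have h1 : M * ‖U q‖ * ‖φ q‖ ≤ α / 4 * ‖φ q‖ ^ 2 + M ^ 2 / α * ‖U q‖ ^ 2 := by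
      have h3 : α / 4 * ‖φ q‖ ^ 2 + M ^ 2 / α * ‖U q‖ ^ 2 - M * ‖U q‖ * ‖φ q‖
          = (4 * α)⁻¹ * (α * ‖φ q‖ - 2 * M * ‖U q‖) ^ 2 := by
        field_simp; ring
      have : 0 ≤ (4 * α)⁻¹ * (α * ‖φ q‖ - 2 * M * ‖U q‖) ^ 2 := by positivity
      linarith
    have h4 := mul_le_mul_of_nonneg_left (hUb' q (right_mem_Icc.2 hpq))
      (show 0 ≤ M ^ 2 / α by positivity)
    have h5 := mul_le_mul_of_nonneg_left h1 (hepos q).le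
    linarith
  rw [hsplit]
  -- Here `r * α / 2` comes from `b₁`, `r * α / 8` is spent on `a₁`, and one copy of `X` is left
  -- over. The two quarters of `Y` spent on `a₂` and `b₂` leave `Y / 2`; the boundary term of `a₁`
  -- leaves `α / 4` of `α / 2`.
  have hfin : 0 ≤ (r * α / 2 - r * α / 8 - C - 1) * X := mul_nonneg (by linarith) hX0
  rw [hC] at hfin
  linarith

end Coercivity

/-! ### Lions' representation theorem -/

/-- The bound makes `g` continuous on the range of `K`, and Hahn–Banach extends it. -/
theorem exists_clm_apply_eq {D : Type*} [NormedAddCommGroup D] [NormedSpace ℝ D] {F : Type*}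
    [AddCommGroup F] [Module ℝ F] (K : F →ₗ[ℝ] D) (g : D →ₗ[ℝ] ℝ) (C : ℝ)
    (h : ∀ ψ, |g (K ψ)| ≤ C * ‖K ψ‖) : ∃ G : D →L[ℝ] ℝ, ∀ ψ, G (K ψ) = g (K ψ) := by
  have hbd : ∀ y : LinearMap.range K, ‖(g.comp (LinearMap.range K).subtype) y‖ ≤ C * ‖y‖ := by
    rintro ⟨_, ψ, rfl⟩
    exact h ψ
  obtain ⟨G, hG, -⟩ := exists_extension_norm_eq _
    ((g.comp (LinearMap.range K).subtype).mkContinuous C hbd)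
  exact ⟨G, fun ψ => hG ⟨K ψ, ψ, rfl⟩⟩

/-- Lions' representation theorem: a linear functional `ℓ` which is dominated by the dual norm of
`K ψ` is represented by an element of the Hilbert space. -/
theorem exists_forall_apply_eq_of_abs_le {E : Type*} [NormedAddCommGroup E] [InnerProductSpace ℝ E]
    [CompleteSpace E] {F : Type*} [AddCommGroup F] [Module ℝ F] (K : F →ₗ[ℝ] (E →L[ℝ] ℝ))
    (ℓ : F →ₗ[ℝ] ℝ) (C : ℝ) (h : ∀ ψ, |ℓ ψ| ≤ C * ‖K ψ‖) : ∃ x : E, ∀ ψ, K ψ x = ℓ ψ := by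
  -- The bound forces `ℓ` to vanish on the kernel of `K`, so `ℓ` factors through `K`.
  have hmem : ℓ ∈ LinearMap.range K.dualMap := by
    rw [LinearMap.range_dualMap_eq_dualAnnihilator_ker, Submodule.mem_dualAnnihilator]
    intro ψ hψ
    have := h ψ
    rw [LinearMap.mem_ker.1 hψ, norm_zero, mul_zero] at this
    exact abs_nonpos_iff.1 this
  obtain ⟨g, hg⟩ := hmem
  have hgK : ∀ ψ, g (K ψ) = ℓ ψ := fun ψ => LinearMap.congr_fun hg ψ
  obtain ⟨G, hG⟩ := exists_clm_apply_eq K g C (fun ψ => by rw [hgK]; exact h ψ)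
  -- Reflexivity: the functional `G` on the dual is evaluation at a point, found by applying the
  -- Riesz isomorphism twice.
  let y := (InnerProductSpace.toDual ℝ E).symm
    (G.comp (InnerProductSpace.toDual ℝ E).toContinuousLinearEquiv.toContinuousLinearMap)
  refine ⟨y, fun ψ => ?_⟩
  have h1 : inner ℝ y ((InnerProductSpace.toDual ℝ E).symm (K ψ)) = G (K ψ) := by
    simp [y]
  rw [real_inner_comm, InnerProductSpace.toDual_symm_apply] at h1
  rw [h1, ← hgK, hG]

/-! ### Integration operators on `L²(p,q;E)` -/

section L2

/-- Lions' representation theorem on a closed subspace. -/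
theorem exists_mem_forall_apply_eq_of_abs_le {E : Type*} [NormedAddCommGroup E]
    [InnerProductSpace ℝ E] [CompleteSpace E] {S : Submodule ℝ E} (hS : IsClosed (S : Set E))
    {F : Type*} [AddCommGroup F] [Module ℝ F] (K : F →ₗ[ℝ] (E →L[ℝ] ℝ)) (ℓ : F →ₗ[ℝ] ℝ) (C : ℝ)
    (h : ∀ ψ D, 0 ≤ D → (∀ y ∈ S, |K ψ y| ≤ D * ‖y‖) → |ℓ ψ| ≤ C * D) :
    ∃ x ∈ S, ∀ ψ, K ψ x = ℓ ψ := by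
  have : CompleteSpace S := hS.completeSpace_coe
  let KS : F →ₗ[ℝ] (S →L[ℝ] ℝ) :=
    { toFun := fun ψ => (K ψ).comp S.subtypeL
      map_add' := fun ψ χ => by ext x; simp
      map_smul' := fun c ψ => by ext x; simp }
  obtain ⟨⟨x, hxS⟩, hx⟩ := exists_forall_apply_eq_of_abs_le KS ℓ C fun ψ =>
    h ψ ‖KS ψ‖ (KS ψ).opNorm_nonneg fun y hy => (KS ψ).le_opNorm ⟨y, hy⟩
  exact ⟨x, hxS, hx⟩

/-- The space `L²(p,q;E)`. -/
abbrev L2Ioc (p q : ℝ) (E : Type*) [NormedAddCommGroup E] : Type _ :=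
  Lp E 2 (volume.restrict (Ioc p q))

theorem L2Ioc.intervalIntegrable {E : Type*} [NormedAddCommGroup E] {p q : ℝ} (hpq : p ≤ q) (f : L2Ioc p q E) :
    IntervalIntegrable f volume p q :=
  (intervalIntegrable_iff_integrableOn_Ioc_of_le hpq).2 ((Lp.memLp f).integrable (by norm_num))

theorem integral_congr_of_ae_eq {E : Type*} [NormedAddCommGroup E] [NormedSpace ℝ E] {p q : ℝ}
    {f g : ℝ → E} (h : f =ᵐ[volume.restrict (Ioc p q)] g)
    {t : ℝ} (ht : t ∈ Icc p q) : ∫ s in p..t, f s = ∫ s in p..t, g s := by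
  rw [intervalIntegral.integral_of_le ht.1, intervalIntegral.integral_of_le ht.1]
  exact integral_congr_ae (ae_restrict_of_ae_restrict_of_subset (Ioc_subset_Ioc_right ht.2) h)

variable {E : Type*} [NormedAddCommGroup E] [InnerProductSpace ℝ E] {p q : ℝ}

theorem L2Ioc.norm_sq (hpq : p ≤ q) (f : L2Ioc p q E) : ‖f‖ ^ 2 = ∫ t in p..q, ‖f t‖ ^ 2 := by
  rw [← real_inner_self_eq_norm_sq, L2.inner_def, intervalIntegral.integral_of_le hpq]
  simp_rw [real_inner_self_eq_norm_sq]

theorem MemLp.norm_integral_sq_le_of_mem {f : ℝ → E}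
    (hf : MemLp f 2 (volume.restrict (Ioc p q))) {t : ℝ} (ht : t ∈ Icc p q) :
    ‖∫ s in p..t, f s‖ ^ 2 ≤ (q - p) * ∫ s in p..q, ‖f s‖ ^ 2 := by
  have hpq := ht.1.trans ht.2
  refine (norm_integral_sq_le ht.1
    (hf.mono_measure (Measure.restrict_mono (Ioc_subset_Ioc_right ht.2) le_rfl))).trans ?_
  gcongr
  · exact intervalIntegral.integral_nonneg ht.1 fun _ _ => sq_nonneg _
  · exact ht.2
  · exact intervalIntegral.integral_mono_interval le_rfl ht.1 ht.2
      (Eventually.of_forall fun t => sq_nonneg _)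
      ((intervalIntegrable_iff_integrableOn_Ioc_of_le hpq).2 hf.integrable_norm_pow')

theorem memLp_primitive (hpq : p ≤ q) {f : ℝ → E} (hf : IntervalIntegrable f volume p q) :
    MemLp (fun t => ∫ s in p..t, f s) 2 (volume.restrict (Ioc p q)) := by
  have h := absolutelyContinuousOnInterval_integral hf
  obtain ⟨C, hC⟩ := h.exists_bound
  have hsub : Ioc p q ⊆ uIcc p q := by rw [uIcc_of_le hpq]; exact Ioc_subset_Icc_self
  refine MemLp.of_bound ((h.continuousOn.mono hsub).aestronglyMeasurable measurableSet_Ioc) C ?_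
  filter_upwards [ae_restrict_mem measurableSet_Ioc] with t ht using hC t (hsub ht)

/-- The total integral as a continuous linear map on `L²(p,q;E)`. -/
noncomputable def integralCLM (E : Type*) [NormedAddCommGroup E] [InnerProductSpace ℝ E]
    (hpq : p ≤ q) : L2Ioc p q E →L[ℝ] E :=
  LinearMap.mkContinuous
    { toFun := fun f => ∫ s in p..q, f s
      map_add' := fun f g => by
        rw [integral_congr_of_ae_eq (Lp.coeFn_add f g) (right_mem_Icc.2 hpq)]
        exact intervalIntegral.integral_add (L2Ioc.intervalIntegrable hpq f)
          (L2Ioc.intervalIntegrable hpq g)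
      map_smul' := fun c f => by
        rw [integral_congr_of_ae_eq (Lp.coeFn_smul c f) (right_mem_Icc.2 hpq)]
        exact intervalIntegral.integral_smul _ _ } (√(q - p))
    (fun f => by
      refine abs_le_of_sq_le_sq' ?_ (by positivity) |>.2
      rw [mul_pow, Real.sq_sqrt (sub_nonneg.2 hpq), L2Ioc.norm_sq hpq]
      exact MemLp.norm_integral_sq_le_of_mem (Lp.memLp f) (right_mem_Icc.2 hpq))

/-- The primitive vanishing at `p` as a continuous linear map on `L²(p,q;E)`. -/
noncomputable def primitiveCLM (E : Type*) [NormedAddCommGroup E] [InnerProductSpace ℝ E]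
    (hpq : p ≤ q) : L2Ioc p q E →L[ℝ] L2Ioc p q E :=
  LinearMap.mkContinuous
    { toFun := fun f => (memLp_primitive hpq (L2Ioc.intervalIntegrable hpq f)).toLp
      map_add' := fun f g => by
        rw [← MemLp.toLp_add]
        refine (MemLp.toLp_eq_toLp_iff _ _).2 ?_
        filter_upwards [ae_restrict_mem measurableSet_Ioc] with t ht
        have ht' : uIcc p t ⊆ uIcc p q := by
          rw [uIcc_of_le ht.1.le, uIcc_of_le hpq]; exact Icc_subset_Icc_right ht.2
        rw [integral_congr_of_ae_eq (Lp.coeFn_add f g) (Ioc_subset_Icc_self ht)]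
        exact intervalIntegral.integral_add ((L2Ioc.intervalIntegrable hpq f).mono_set ht')
          ((L2Ioc.intervalIntegrable hpq g).mono_set ht')
      map_smul' := fun c f => by
        rw [RingHom.id_apply, ← MemLp.toLp_const_smul]
        refine (MemLp.toLp_eq_toLp_iff _ _).2 ?_
        filter_upwards [ae_restrict_mem measurableSet_Ioc] with t ht
        rw [integral_congr_of_ae_eq (Lp.coeFn_smul c f) (Ioc_subset_Icc_self ht)]
        exact intervalIntegral.integral_smul _ _ } (q - p)
    (fun f => by
      have hpq' := sub_nonneg.2 hpq
      refine abs_le_of_sq_le_sq' ?_ (by positivity) |>.2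
      rw [mul_pow, L2Ioc.norm_sq hpq, L2Ioc.norm_sq hpq]
      have h1 : ∫ t in p..q, (q - p) * ∫ s in p..q, ‖f s‖ ^ 2
          = (q - p) ^ 2 * ∫ s in p..q, ‖f s‖ ^ 2 := by
        rw [intervalIntegral.integral_const, smul_eq_mul]; ring
      rw [← h1]
      have hL := memLp_primitive hpq (L2Ioc.intervalIntegrable hpq f)
      have h2 := hL.coeFn_toLp
      simp only [LinearMap.coe_mk, AddHom.coe_mk]
      rw [intervalIntegral.integral_of_le hpq, intervalIntegral.integral_of_le hpq]
      refine integral_mono_ae (Lp.memLp hL.toLp).integrable_norm_pow'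
        (integrable_const _) ?_
      filter_upwards [h2, ae_restrict_mem measurableSet_Ioc] with t h3 ht
      rw [h3]
      exact MemLp.norm_integral_sq_le_of_mem (Lp.memLp f) (Ioc_subset_Icc_self ht))

theorem primitiveCLM_ae_eq (hpq : p ≤ q) (f : L2Ioc p q E) :
    primitiveCLM E hpq f =ᵐ[volume.restrict (Ioc p q)] fun t => ∫ s in p..t, f s :=
  (memLp_primitive hpq (L2Ioc.intervalIntegrable hpq f)).coeFn_toLp

/-- A uniformly bounded family of functionals defines a bounded functional on `L²(p,q;E)` by
Cauchy–Schwarz. Integrability is recorded as well, since the integrals are later added and split. -/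
theorem exists_clm_eq_integral (hpq : p ≤ q) {k : ℝ → E →L[ℝ] ℝ} {D : ℝ}
    (hk : ∀ v : L2Ioc p q E,
      AEStronglyMeasurable (fun t => k t (v t)) (volume.restrict (Ioc p q)))
    (hD : ∀ t ∈ Ioc p q, ‖k t‖ ≤ D) :
    ∃ Λ : L2Ioc p q E →L[ℝ] ℝ, ∀ v : L2Ioc p q E,
      IntervalIntegrable (fun t => k t (v t)) volume p q ∧ Λ v = ∫ t in p..q, k t (v t) := by
  have hpq' := sub_nonneg.2 hpq
  have hbd : ∀ v : L2Ioc p q E, ∀ᵐ t ∂(volume.restrict (Ioc p q)), ‖k t (v t)‖ ≤ D * ‖v t‖ := by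
    intro v
    filter_upwards [ae_restrict_mem measurableSet_Ioc] with t ht
    exact ((k t).le_opNorm _).trans (by gcongr; exact hD t ht)
  have hint : ∀ v : L2Ioc p q E, IntervalIntegrable (fun t => k t (v t)) volume p q := by
    intro v
    rw [intervalIntegrable_iff_integrableOn_Ioc_of_le hpq]
    refine Integrable.mono' (((Lp.memLp v).integrable (by norm_num)).norm.const_mul D) (hk v) (hbd v)
  refine ⟨LinearMap.mkContinuousOfExistsBound
    { toFun := fun v => ∫ t in p..q, k t (v t)
      map_add' := fun v w => by
        rw [← intervalIntegral.integral_add (hint v) (hint w)]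
        refine integral_congr_of_ae_eq ?_ (right_mem_Icc.2 hpq)
        filter_upwards [Lp.coeFn_add v w] with t ht
        rw [ht, Pi.add_apply, map_add]
      map_smul' := fun c v => by
        rw [RingHom.id_apply, ← intervalIntegral.integral_smul]
        refine integral_congr_of_ae_eq ?_ (right_mem_Icc.2 hpq)
        filter_upwards [Lp.coeFn_smul c v] with t ht
        rw [ht, Pi.smul_apply, map_smul] } ⟨|D| * √(q - p), fun v => ?_⟩, fun v => ⟨hint v, rfl⟩⟩
  simp only [LinearMap.coe_mk, AddHom.coe_mk]
  have h1 : ‖∫ t in p..q, k t (v t)‖ ≤ ∫ t in p..q, |D| * ‖v t‖ := by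
    refine (intervalIntegral.norm_integral_le_integral_norm hpq).trans ?_
    rw [intervalIntegral.integral_of_le hpq, intervalIntegral.integral_of_le hpq]
    refine integral_mono_ae ((intervalIntegrable_iff_integrableOn_Ioc_of_le hpq).1 (hint v).norm)
      (((Lp.memLp v).integrable (by norm_num)).norm.const_mul _) ?_
    filter_upwards [hbd v] with t ht
    exact ht.trans (by gcongr; exact le_abs_self _)
  refine h1.trans ?_
  rw [intervalIntegral.integral_const_mul, mul_assoc]
  gcongr
  refine abs_le_of_sq_le_sq' ?_ (by positivity) |>.2
  rw [mul_pow, Real.sq_sqrt hpq', L2Ioc.norm_sq hpq]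
  have h2 := MemLp.norm_integral_sq_le_of_mem (Lp.memLp v).norm (right_mem_Icc.2 hpq)
  simpa using h2

end L2

/-! ### Bounds for the functionals in the variational problem -/

section Functionals

variable {V : Type*} [NormedAddCommGroup V] [InnerProductSpace ℝ V]
  {H : Type*} [NormedAddCommGroup H] [InnerProductSpace ℝ H]
  {ι : V →L[ℝ] H} {p q : ℝ}

theorem exists_bound_of_continuous (hpq : p ≤ q) {E : Type*} [NormedAddCommGroup E] {ψ : ℝ → E}
    (hψ : Continuous ψ) : ∃ R : ℝ, 0 ≤ R ∧ ∀ t ∈ Icc p q, ‖ψ t‖ ≤ R := by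
  obtain ⟨R, hR⟩ := isCompact_Icc.exists_bound_of_continuousOn (hψ.continuousOn (s := Icc p q))
  exact ⟨R, (norm_nonneg _).trans (hR p (left_mem_Icc.2 hpq)), hR⟩

variable {L : ℝ≥0} {M : ℝ}

theorem abs_add_form_le {c₁ c₂ : V →L[ℝ] V →L[ℝ] ℝ} (h₁ : ‖c₁‖ ≤ M)
    (h₂ : ∀ u v, |c₂ u v| ≤ M * ‖u‖ * ‖ι v‖) (u v : V) :
    |(c₁ + c₂) u v| ≤ (M + M * ‖ι‖) * ‖u‖ * ‖v‖ := by
  have hM : 0 ≤ M := (norm_nonneg c₁).trans h₁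
  calc |(c₁ + c₂) u v| ≤ |c₁ u v| + |c₂ u v| := by
        simp only [add_apply]; exact abs_add_le _ _
    _ ≤ M * ‖u‖ * ‖v‖ + M * ‖u‖ * (‖ι‖ * ‖v‖) :=
        add_le_add (form_le h₁ u v) ((h₂ u v).trans (by gcongr; exact ι.le_opNorm v))
    _ = _ := by ring

theorem aestronglyMeasurable_add_form {c₁ c₂ : ℝ → V →L[ℝ] V →L[ℝ] ℝ} {μ : Measure ℝ}
    (h₁ : LipschitzWith L c₁) (h₂ : ∀ u v, AEStronglyMeasurable (fun t => c₂ t u v) μ) (u v : V) :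
    AEStronglyMeasurable (fun t => (c₁ t + c₂ t) u v) μ := by
  have := h₁.continuous
  exact (Continuous.aestronglyMeasurable (f := fun t => c₁ t u v) (by fun_prop)).add (h₂ u v)

/-- Young's inequality with a weight at most `1`. The bound is deliberately inhomogeneous;
`abs_le_of_quadratic_bound` makes it homogeneous at the end. -/
theorem exists_abs_integral_inner_le (hpq : p ≤ q) {f : ℝ → H}
    (hf : MemLp f 2 (volume.restrict (Ioc p q))) {r : ℝ} (hr : 0 ≤ r) :
    ∃ C : ℝ, 0 ≤ C ∧ ∀ ψ : ℝ → V, Continuous ψ →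
      IntervalIntegrable (fun t => expWeight r p t * inner ℝ (ι (ψ t)) (f t)) volume p q ∧
      |∫ t in p..q, expWeight r p t * inner ℝ (ι (ψ t)) (f t)| ≤
        C + ∫ t in p..q, expWeight r p t * ‖ι (ψ t)‖ ^ 2 := by
  have hf2 : IntervalIntegrable (fun t => ‖f t‖ ^ 2) volume p q :=
    (intervalIntegrable_iff_integrableOn_Ioc_of_le hpq).2 hf.integrable_norm_pow'
  refine ⟨∫ t in p..q, ‖f t‖ ^ 2, intervalIntegral.integral_nonneg hpq fun _ _ => sq_nonneg _,
    fun ψ hψ => ?_⟩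
  have hY : IntervalIntegrable (fun t => expWeight r p t * ‖ι (ψ t)‖ ^ 2) volume p q :=
    Continuous.intervalIntegrable (by fun_prop) _ _
  have hle : ∀ t, p ≤ t → ‖expWeight r p t * inner ℝ (ι (ψ t)) (f t)‖ ≤
      ‖f t‖ ^ 2 + expWeight r p t * ‖ι (ψ t)‖ ^ 2 := by
    intro t ht
    rw [norm_mul, Real.norm_of_nonneg expWeight_pos.le]
    have h1 : ‖(inner ℝ (ι (ψ t)) (f t) : ℝ)‖ ≤ ‖ι (ψ t)‖ * ‖f t‖ := norm_inner_le_norm _ _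
    have h2 := expWeight_pos (r := r) (p := p) (t := t)
    have h3 := expWeight_le_one (p := p) hr ht
    have h4 := mul_le_mul_of_nonneg_left h1 h2.le
    nlinarith [mul_nonneg h2.le (sq_nonneg (‖ι (ψ t)‖ - ‖f t‖)), mul_nonneg h2.le
      (sq_nonneg ‖ι (ψ t)‖), mul_nonneg (sub_nonneg.2 h3) (sq_nonneg ‖f t‖),
      mul_nonneg h2.le (sq_nonneg ‖f t‖)]
  have hint : IntervalIntegrable (fun t => expWeight r p t * inner ℝ (ι (ψ t)) (f t))
      volume p q := by
    refine (hf2.add hY).mono_fun' ?_ ?_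
    · rw [uIoc_of_le hpq]
      exact continuous_expWeight.aestronglyMeasurable.mul
        ((ι.continuous.comp hψ).aestronglyMeasurable.inner hf.1)
    · rw [uIoc_of_le hpq]
      filter_upwards [ae_restrict_mem measurableSet_Ioc] with t ht using hle t ht.1.le
  refine ⟨hint, ?_⟩
  rw [← intervalIntegral.integral_add hf2 hY]
  exact (intervalIntegral.abs_integral_le_integral_abs hpq).trans
    (intervalIntegral.integral_mono_on hpq hint.abs (hf2.add hY) fun t ht => hle t ht.1)

variable [SecondCountableTopology V]

theorem exists_clm_eq_integral_form (hpq : p ≤ q) {c : ℝ → V →L[ℝ] V →L[ℝ] ℝ} {M : ℝ}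
    (hc : ∀ u v, AEStronglyMeasurable (fun t => c t u v) (volume.restrict (Ioc p q)))
    (hM : ∀ t u v, |c t u v| ≤ M * ‖u‖ * ‖v‖) {ψ : ℝ → V} (hψ : Continuous ψ)
    {e : ℝ → ℝ} (he : Continuous e) :
    ∃ Λ : L2Ioc p q V →L[ℝ] ℝ, ∀ v : L2Ioc p q V,
      IntervalIntegrable (fun t => e t * c t (v t) (ψ t)) volume p q ∧
      Λ v = ∫ t in p..q, e t * c t (v t) (ψ t) := by
  obtain ⟨R, hR0, hR⟩ := exists_bound_of_continuous hpq (he.norm.mul hψ.norm)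
  refine exists_clm_eq_integral hpq (k := fun t => e t • (c t).flip (ψ t)) (D := |M| * R)
    (fun v => ?_) (fun t ht => ?_)
  · exact he.aestronglyMeasurable.mul
      (aestronglyMeasurable_form_apply hc (Lp.aestronglyMeasurable v) hψ.aestronglyMeasurable)
  · refine ContinuousLinearMap.opNorm_le_bound _ (by positivity) fun u => ?_
    have h1 : ‖e t‖ * ‖ψ t‖ ≤ R := by simpa using hR t (Ioc_subset_Icc_self ht)
    simp only [smul_apply, ContinuousLinearMap.flip_apply, smul_eq_mul, norm_mul]
    have h2 : ‖c t u (ψ t)‖ ≤ |M| * ‖u‖ * ‖ψ t‖ := (hM t u (ψ t)).trans (by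
      gcongr; exact le_abs_self _)
    calc ‖e t‖ * ‖c t u (ψ t)‖ ≤ ‖e t‖ * (|M| * ‖u‖ * ‖ψ t‖) := by gcongr
      _ = |M| * (‖e t‖ * ‖ψ t‖) * ‖u‖ := by ring
      _ ≤ |M| * R * ‖u‖ := by gcongr

theorem exists_clm_eq_integral_inner (hpq : p ≤ q) {χ : ℝ → H} (hχ : Continuous χ)
    {e : ℝ → ℝ} (he : Continuous e) :
    ∃ Λ : L2Ioc p q H →L[ℝ] ℝ, ∀ w : L2Ioc p q H,
      IntervalIntegrable (fun t => e t * inner ℝ (χ t) (w t)) volume p q ∧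
      Λ w = ∫ t in p..q, e t * inner ℝ (χ t) (w t) := by
  obtain ⟨R, hR0, hR⟩ := exists_bound_of_continuous hpq (he.norm.mul hχ.norm)
  refine exists_clm_eq_integral hpq (k := fun t => e t • innerSL ℝ (χ t)) (D := R)
    (fun w => ?_) (fun t ht => ?_)
  · exact he.aestronglyMeasurable.mul
      (hχ.aestronglyMeasurable.inner (Lp.aestronglyMeasurable w))
  · have h1 := hR t (Ioc_subset_Icc_self ht)
    simpa [norm_smul] using h1

/-- A functional induced by a fixed `C¹` function is bounded in terms of the test function. -/
theorem exists_abs_integral_add_form_le {c₁ c₂ : ℝ → V →L[ℝ] V →L[ℝ] ℝ}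
    (hpq : p ≤ q) (hc : LipschitzWith L c₁) (hM : ∀ t, ‖c₁ t‖ ≤ M)
    (hc₂ : ∀ u v, AEStronglyMeasurable (fun t => c₂ t u v) (volume.restrict (Ioc p q)))
    (hM₂ : ∀ t u v, |c₂ t u v| ≤ M * ‖u‖ * ‖ι v‖) {r : ℝ} (hr : 0 ≤ r) {G G' : ℝ → V}
    (hG : ∀ t, HasDerivAt G (G' t) t) (hG' : Continuous G') :
    ∃ C : ℝ, 0 ≤ C ∧ ∀ φ ψ : ℝ → V, Continuous ψ → (∀ t, HasDerivAt φ (ψ t) t) → φ p = 0 →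
      |∫ t in p..q, expWeight r p t * (c₁ t + c₂ t) (G t) (ψ t)| ≤
        C + expWeight r p q * ‖φ q‖ ^ 2 + (∫ t in p..q, expWeight r p t * ‖φ t‖ ^ 2)
          + ∫ t in p..q, expWeight r p t * ‖ι (ψ t)‖ ^ 2 := by
  have hGc : Continuous G := continuous_iff_continuousAt.2 fun t => (hG t).continuousAt
  have hM0 : 0 ≤ M := (norm_nonneg (c₁ 0)).trans (hM 0)
  have hcc := hc.continuous
  set C : ℝ := (M * ‖G q‖) ^ 2
    + (∫ t in p..q, (M * ‖G' t‖ + (r * M + L) * ‖G t‖) ^ 2) + ∫ t in p..q, (M * ‖G t‖) ^ 2 with hC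
  refine ⟨C, add_nonneg (add_nonneg (sq_nonneg _)
    (intervalIntegral.integral_nonneg hpq fun _ _ => sq_nonneg _))
    (intervalIntegral.integral_nonneg hpq fun _ _ => sq_nonneg _), fun φ ψ hψ hφ hφp => ?_⟩
  have hφc : Continuous φ := continuous_iff_continuousAt.2 fun t => (hφ t).continuousAt
  have young : ∀ {e x y : ℝ}, 0 < e → e ≤ 1 → e * (x * y) ≤ x ^ 2 + e * y ^ 2 := by
    intro e x y he he1
    nlinarith [mul_nonneg he.le (sq_nonneg (x - y)), mul_nonneg he.le (sq_nonneg y),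
      mul_nonneg (sub_nonneg.2 he1) (sq_nonneg x), mul_nonneg he.le (sq_nonneg x)]
  have hI1 : IntervalIntegrable (fun t => expWeight r p t * c₁ t (G t) (ψ t)) volume p q :=
    Continuous.intervalIntegrable (by fun_prop) _ _
  have hI2 := intervalIntegrable_form_apply hpq hc₂ hM₂ hGc hψ (continuous_expWeight (r := r) (p := p))
  have hsplit : ∫ t in p..q, expWeight r p t * (c₁ t + c₂ t) (G t) (ψ t)
      = (∫ t in p..q, expWeight r p t * c₁ t (G t) (ψ t))
        + ∫ t in p..q, expWeight r p t * c₂ t (G t) (ψ t) := by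
    rw [← intervalIntegral.integral_add hI1 hI2]
    refine intervalIntegral.integral_congr fun t _ => ?_
    simp only [add_apply]; ring
  -- The values of `ψ` are controlled only in `H`, so the `V`-bounded part must be integrated by
  -- parts; the `V × H`-bounded part is estimated directly.
  have h1 := abs_integral_expWeight_form_le hc hM hr hpq hG hG' hφ hψ hφp
  have h2 : expWeight r p q * (M * ‖G q‖ * ‖φ q‖) ≤
      (M * ‖G q‖) ^ 2 + expWeight r p q * ‖φ q‖ ^ 2 :=
    young expWeight_pos (expWeight_le_one hr hpq)
  have h3 : ∫ t in p..q, expWeight r p t * ((M * ‖G' t‖ + (r * M + L) * ‖G t‖) * ‖φ t‖) ≤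
      (∫ t in p..q, (M * ‖G' t‖ + (r * M + L) * ‖G t‖) ^ 2)
        + ∫ t in p..q, expWeight r p t * ‖φ t‖ ^ 2 := by
    rw [← intervalIntegral.integral_add (Continuous.intervalIntegrable (by fun_prop) _ _)
      (Continuous.intervalIntegrable (by fun_prop) _ _)]
    exact intervalIntegral.integral_mono_on hpq (Continuous.intervalIntegrable (by fun_prop) _ _)
      (Continuous.intervalIntegrable (by fun_prop) _ _)
      fun t ht => young expWeight_pos (expWeight_le_one hr ht.1)
  have h4 : |∫ t in p..q, expWeight r p t * c₂ t (G t) (ψ t)| ≤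
      (∫ t in p..q, (M * ‖G t‖) ^ 2) + ∫ t in p..q, expWeight r p t * ‖ι (ψ t)‖ ^ 2 := by
    rw [← intervalIntegral.integral_add (Continuous.intervalIntegrable (by fun_prop) _ _)
      (Continuous.intervalIntegrable (by fun_prop) _ _)]
    refine (intervalIntegral.abs_integral_le_integral_abs hpq).trans
      (intervalIntegral.integral_mono_on hpq hI2.abs
      (Continuous.intervalIntegrable (by fun_prop) _ _) fun t ht => ?_)
    rw [abs_mul, abs_of_pos expWeight_pos]
    exact (mul_le_mul_of_nonneg_left (hM₂ t _ _) expWeight_pos.le).trans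
      (young expWeight_pos (expWeight_le_one hr ht.1))
  rw [hsplit, hC]
  refine (abs_add_le _ _).trans ?_
  linarith

end Functionals

/-- Replace `x` by `s • x` and choose `s = (√(Q x))⁻¹`; if `Q x = 0`, a large `s` forces `ℓ x = 0`.
-/
theorem abs_le_of_quadratic_bound {F : Type*} [AddCommGroup F] [Module ℝ F] (ℓ : F →ₗ[ℝ] ℝ)
    (Q : F → ℝ) (hQ0 : ∀ x, 0 ≤ Q x) (hQ : ∀ (s : ℝ) x, Q (s • x) = s ^ 2 * Q x) (C : ℝ)
    (h : ∀ x, |ℓ x| ≤ C * (1 + Q x)) (x : F) : |ℓ x| ≤ 2 * C * √(Q x) := by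
  have key : ∀ s : ℝ, 0 < s → s * |ℓ x| ≤ C * (1 + s ^ 2 * Q x) := by
    intro s hs
    have := h (s • x)
    rwa [map_smul, hQ, smul_eq_mul, abs_mul, abs_of_pos hs] at this
  rcases (hQ0 x).eq_or_lt with h0 | h0
  · rw [← h0, Real.sqrt_zero, mul_zero]
    by_contra! hcon
    have := key ((|C| + 1) / |ℓ x|) (by positivity)
    rw [div_mul_cancel₀ _ hcon.ne', ← h0] at this
    linarith [le_abs_self C]
  · have hs := Real.sqrt_pos.2 h0
    have := key (√(Q x))⁻¹ (inv_pos.2 hs)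
    rw [inv_pow, Real.sq_sqrt h0.le, inv_mul_cancel₀ h0.ne', inv_mul_le_iff₀ hs] at this
    linarith

/-! ### The phase space and the linear maps of the variational problem -/

section Existence

variable {V : Type*} [NormedAddCommGroup V] [InnerProductSpace ℝ V]
  {H : Type*} [NormedAddCommGroup H] [InnerProductSpace ℝ H] {p q : ℝ}

/-- Mild form of the damped wave equation on `[p,q]` with velocity `v` and acceleration `w`. -/
structure IsVelocitySolution (ι : V →L[ℝ] H) (p q : ℝ) (a b : ℝ → V →L[ℝ] V →L[ℝ] ℝ)
    (f : ℝ → H) (u₀ u₁ : V) (v : ℝ → V) (w : ℝ → H) : Prop where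
  memLp_velocity : MemLp v 2 (volume.restrict (Ioc p q))
  memLp_acceleration : MemLp w 2 (volume.restrict (Ioc p q))
  velocity_eq : ∀ᵐ t ∂(volume.restrict (Ioc p q)), ι (v t) = ι u₁ + ∫ s in p..t, w s
  equation : ∀ᵐ t ∂(volume.restrict (Ioc p q)), ∀ x : V,
    inner ℝ (ι x) (w t) + b t (v t) x + a t (u₀ + ∫ s in p..t, v s) x = inner ℝ (ι x) (f t)

/-- Triples of a velocity, an acceleration and a final velocity. -/
def PhaseSpace (p q : ℝ) (V H : Type*) [NormedAddCommGroup V] [NormedAddCommGroup H] : Type _ :=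
  WithLp 2 (WithLp 2 (L2Ioc p q V × L2Ioc p q H) × V)

noncomputable instance (p q : ℝ) (V H : Type*) [NormedAddCommGroup V] [NormedAddCommGroup H] :
    NormedAddCommGroup (PhaseSpace p q V H) :=
  inferInstanceAs (NormedAddCommGroup (WithLp 2 (WithLp 2 (L2Ioc p q V × L2Ioc p q H) × V)))

noncomputable instance (p q : ℝ) (V H : Type*) [NormedAddCommGroup V] [InnerProductSpace ℝ V]
    [NormedAddCommGroup H] [InnerProductSpace ℝ H] : InnerProductSpace ℝ (PhaseSpace p q V H) :=
  inferInstanceAs (InnerProductSpace ℝ (WithLp 2 (WithLp 2 (L2Ioc p q V × L2Ioc p q H) × V)))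

instance (p q : ℝ) (V H : Type*) [NormedAddCommGroup V] [NormedAddCommGroup H] [CompleteSpace V]
    [CompleteSpace H] : CompleteSpace (PhaseSpace p q V H) :=
  inferInstanceAs (CompleteSpace (WithLp 2 (WithLp 2 (L2Ioc p q V × L2Ioc p q H) × V)))

/-- The velocity component. -/
noncomputable def velocityCLM (p q : ℝ) (V H : Type*) [NormedAddCommGroup V]
    [InnerProductSpace ℝ V] [NormedAddCommGroup H] [InnerProductSpace ℝ H] :
    PhaseSpace p q V H →L[ℝ] L2Ioc p q V :=
  (WithLp.fstL 2 ℝ (L2Ioc p q V) (L2Ioc p q H)).comp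
    (WithLp.fstL 2 ℝ (WithLp 2 (L2Ioc p q V × L2Ioc p q H)) V)

/-- The acceleration component. -/
noncomputable def accelerationCLM (p q : ℝ) (V H : Type*) [NormedAddCommGroup V]
    [InnerProductSpace ℝ V] [NormedAddCommGroup H] [InnerProductSpace ℝ H] :
    PhaseSpace p q V H →L[ℝ] L2Ioc p q H :=
  (WithLp.sndL 2 ℝ (L2Ioc p q V) (L2Ioc p q H)).comp
    (WithLp.fstL 2 ℝ (WithLp 2 (L2Ioc p q V × L2Ioc p q H)) V)

/-- The final velocity component. -/
noncomputable def finalCLM (p q : ℝ) (V H : Type*) [NormedAddCommGroup V]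
    [InnerProductSpace ℝ V] [NormedAddCommGroup H] [InnerProductSpace ℝ H] :
    PhaseSpace p q V H →L[ℝ] V :=
  WithLp.sndL 2 ℝ (WithLp 2 (L2Ioc p q V × L2Ioc p q H)) V

theorem exists_phase (v : L2Ioc p q V) (w : L2Ioc p q H) (z : V) :
    ∃ x : PhaseSpace p q V H, velocityCLM p q V H x = v ∧ accelerationCLM p q V H x = w ∧
      finalCLM p q V H x = z ∧ ‖x‖ ^ 2 = ‖v‖ ^ 2 + ‖w‖ ^ 2 + ‖z‖ ^ 2 := by
  refine ⟨(WithLp.toLp 2 (WithLp.toLp 2 (v, w), z) :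
    WithLp 2 (WithLp 2 (L2Ioc p q V × L2Ioc p q H) × V)), rfl, rfl, rfl, ?_⟩
  refine (WithLp.prod_norm_sq_eq_of_L2 _).trans ?_
  exact congrArg₂ (· + ·) (WithLp.prod_norm_sq_eq_of_L2 _) rfl

/-- The triples `(v, w, z)` with `ι v = ∫ w` and `ι z = ∫_p^q w`. -/
noncomputable def compatible (ι : V →L[ℝ] H) (hpq : p ≤ q) : Submodule ℝ (PhaseSpace p q V H) :=
  LinearMap.ker ((ι.compLpL 2 (volume.restrict (Ioc p q))).comp (velocityCLM p q V H) -
    (primitiveCLM H hpq).comp (accelerationCLM p q V H)).toLinearMap ⊓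
  LinearMap.ker (ι.comp (finalCLM p q V H) -
    (integralCLM H hpq).comp (accelerationCLM p q V H)).toLinearMap

variable {ι : V →L[ℝ] H}

theorem mem_compatible {hpq : p ≤ q} {x : PhaseSpace p q V H} :
    x ∈ compatible ι hpq ↔
      ι.compLp (velocityCLM p q V H x) = primitiveCLM H hpq (accelerationCLM p q V H x) ∧
      ι (finalCLM p q V H x) = ∫ s in p..q, accelerationCLM p q V H x s :=
  and_congr sub_eq_zero sub_eq_zero

theorem isClosed_compatible {hpq : p ≤ q} :
    IsClosed (compatible ι hpq : Set (PhaseSpace p q V H)) :=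
  (ContinuousLinearMap.isClosed_ker _).inter (ContinuousLinearMap.isClosed_ker _)

variable [SecondCountableTopology V] {a b : ℝ → V →L[ℝ] V →L[ℝ] ℝ} {M : ℝ}

/-- The left side of the weighted equation with zero initial data. It does not see the third
component of the phase space, which enters only through the norm and the subspace `compatible`. -/
theorem exists_linearMap_velocity_form (hpq : p ≤ q)
    (ha : ∀ u v, AEStronglyMeasurable (fun t => a t u v) (volume.restrict (Ioc p q)))
    (hb : ∀ u v, AEStronglyMeasurable (fun t => b t u v) (volume.restrict (Ioc p q)))
    (haM : ∀ t u v, |a t u v| ≤ M * ‖u‖ * ‖v‖) (hbM : ∀ t u v, |b t u v| ≤ M * ‖u‖ * ‖v‖)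
    {e : ℝ → ℝ} (he : Continuous e) :
    ∃ K : C(ℝ, V) →ₗ[ℝ] (PhaseSpace p q V H →L[ℝ] ℝ), ∀ ψ x,
      IntervalIntegrable (fun t => e t * (inner ℝ (ι (ψ t)) (accelerationCLM p q V H x t)
        + b t (velocityCLM p q V H x t) (ψ t) + a t (primitiveCLM V hpq (velocityCLM p q V H x) t) (ψ t))) volume p q ∧
      K ψ x = ∫ t in p..q, e t * (inner ℝ (ι (ψ t)) (accelerationCLM p q V H x t)
        + b t (velocityCLM p q V H x t) (ψ t) + a t (primitiveCLM V hpq (velocityCLM p q V H x) t) (ψ t)) := by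
  have key : ∀ ψ : C(ℝ, V), ∃ Λ : PhaseSpace p q V H →L[ℝ] ℝ, ∀ x,
      IntervalIntegrable (fun t => e t * (inner ℝ (ι (ψ t)) (accelerationCLM p q V H x t)
        + b t (velocityCLM p q V H x t) (ψ t) + a t (primitiveCLM V hpq (velocityCLM p q V H x) t) (ψ t))) volume p q ∧
      Λ x = ∫ t in p..q, e t * (inner ℝ (ι (ψ t)) (accelerationCLM p q V H x t)
        + b t (velocityCLM p q V H x t) (ψ t) + a t (primitiveCLM V hpq (velocityCLM p q V H x) t) (ψ t)) := by
    intro ψ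
    obtain ⟨Λ₁, h₁⟩ := exists_clm_eq_integral_inner (p := p) (q := q) hpq
      (χ := fun t => ι (ψ t)) (ι.continuous.comp ψ.continuous) he
    obtain ⟨Λ₂, h₂⟩ := exists_clm_eq_integral_form hpq hb hbM ψ.continuous he
    obtain ⟨Λ₃, h₃⟩ := exists_clm_eq_integral_form hpq ha haM ψ.continuous he
    refine ⟨Λ₁.comp (accelerationCLM p q V H) +
      (Λ₂ + Λ₃.comp (primitiveCLM V hpq)).comp (velocityCLM p q V H), fun x => ?_⟩
    have i1 := (h₁ (accelerationCLM p q V H x)).1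
    have i2 := (h₂ (velocityCLM p q V H x)).1
    have i3 := (h₃ (primitiveCLM V hpq (velocityCLM p q V H x))).1
    have hfun : (fun t => e t * (inner ℝ (ι (ψ t)) (accelerationCLM p q V H x t)
        + b t (velocityCLM p q V H x t) (ψ t) + a t (primitiveCLM V hpq (velocityCLM p q V H x) t) (ψ t)))
        = fun t => e t * inner ℝ (ι (ψ t)) (accelerationCLM p q V H x t) + e t * b t (velocityCLM p q V H x t) (ψ t)
          + e t * a t (primitiveCLM V hpq (velocityCLM p q V H x) t) (ψ t) := by
      ext t; ring
    rw [hfun]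
    refine ⟨(i1.add i2).add i3, ?_⟩
    rw [intervalIntegral.integral_add (i1.add i2) i3, intervalIntegral.integral_add i1 i2, add_assoc]
    exact congrArg₂ (· + ·) (h₁ (accelerationCLM p q V H x)).2
      (congrArg₂ (· + ·) (h₂ (velocityCLM p q V H x)).2 (h₃ (primitiveCLM V hpq (velocityCLM p q V H x))).2)
  choose Λ hΛ using key
  refine ⟨{ toFun := Λ, map_add' := fun ψ χ => ?_, map_smul' := fun c ψ => ?_ }, hΛ⟩
  · ext x
    rw [add_apply, (hΛ _ x).2, (hΛ ψ x).2, (hΛ χ x).2,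
      ← intervalIntegral.integral_add (hΛ ψ x).1 (hΛ χ x).1]
    refine intervalIntegral.integral_congr fun t _ => ?_
    simp only [ContinuousMap.add_apply, map_add, inner_add_left]
    ring
  · ext x
    rw [RingHom.id_apply, smul_apply, (hΛ _ x).2, (hΛ ψ x).2, ← intervalIntegral.integral_smul]
    refine intervalIntegral.integral_congr fun t _ => ?_
    simp only [ContinuousMap.smul_apply, map_smul, inner_smul_left, smul_eq_mul]
    simp only [conj_trivial]
    ring

/-- The right side after a reference motion with position `g` and velocity `h`, carrying the initial
data, has been subtracted. -/
theorem exists_linearMap_source (hpq : p ≤ q)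
    (ha : ∀ u v, AEStronglyMeasurable (fun t => a t u v) (volume.restrict (Ioc p q)))
    (hb : ∀ u v, AEStronglyMeasurable (fun t => b t u v) (volume.restrict (Ioc p q)))
    (haM : ∀ t u v, |a t u v| ≤ M * ‖u‖ * ‖v‖) (hbM : ∀ t u v, |b t u v| ≤ M * ‖u‖ * ‖v‖)
    {f : ℝ → H} (hf : MemLp f 2 (volume.restrict (Ioc p q))) {r : ℝ} (hr : 0 ≤ r)
    {g h : ℝ → V} (hg : Continuous g) (hh : Continuous h) :
    ∃ ℓ : C(ℝ, V) →ₗ[ℝ] ℝ, ∀ ψ,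
      IntervalIntegrable (fun t => expWeight r p t * (inner ℝ (ι (ψ t)) (f t)
        - b t (h t) (ψ t) - a t (g t) (ψ t))) volume p q ∧
      ℓ ψ = (∫ t in p..q, expWeight r p t * inner ℝ (ι (ψ t)) (f t))
        - (∫ t in p..q, expWeight r p t * b t (h t) (ψ t))
        - ∫ t in p..q, expWeight r p t * a t (g t) (ψ t) := by
  obtain ⟨C, -, hC⟩ := exists_abs_integral_inner_le (ι := ι) hpq hf hr
  have i1 : ∀ ψ : C(ℝ, V), _ := fun ψ => (hC ψ ψ.continuous).1
  have i2 : ∀ ψ : C(ℝ, V), _ := fun ψ => intervalIntegrable_form_apply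
    (ι := ContinuousLinearMap.id ℝ V) hpq hb hbM hh ψ.continuous (continuous_expWeight (r := r) (p := p))
  have i3 : ∀ ψ : C(ℝ, V), _ := fun ψ => intervalIntegrable_form_apply
    (ι := ContinuousLinearMap.id ℝ V) hpq ha haM hg ψ.continuous (continuous_expWeight (r := r) (p := p))
  refine ⟨{
    toFun := fun ψ => (∫ t in p..q, expWeight r p t * inner ℝ (ι (ψ t)) (f t))
      - (∫ t in p..q, expWeight r p t * b t (h t) (ψ t))
      - ∫ t in p..q, expWeight r p t * a t (g t) (ψ t)
    map_add' := fun ψ χ => ?_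
    map_smul' := fun c ψ => ?_ }, fun ψ => ⟨?_, rfl⟩⟩
  · simp only [ContinuousMap.add_apply, map_add, inner_add_left, mul_add]
    rw [intervalIntegral.integral_add (i1 ψ) (i1 χ), intervalIntegral.integral_add (i2 ψ) (i2 χ),
      intervalIntegral.integral_add (i3 ψ) (i3 χ)]
    ring
  · simp only [ContinuousMap.smul_apply, map_smul, inner_smul_left, smul_eq_mul, conj_trivial,
      mul_left_comm _ c, intervalIntegral.integral_const_mul, RingHom.id_apply]
    ring
  · refine (((i1 ψ).sub (i2 ψ)).sub (i3 ψ)).congr fun t _ => ?_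
    ring

end Existence

/-! ### Solution of the variational problem -/

section Existence

variable {V : Type*} [NormedAddCommGroup V] [InnerProductSpace ℝ V] [CompleteSpace V]
  {H : Type*} [NormedAddCommGroup H] [InnerProductSpace ℝ H] [CompleteSpace H] {p q : ℝ}
  {ι : V →L[ℝ] H}

theorem memLp_of_continuous {E : Type*} [NormedAddCommGroup E] (hpq : p ≤ q) {ψ : ℝ → E}
    (hψ : Continuous ψ) : MemLp ψ 2 (volume.restrict (Ioc p q)) := by
  obtain ⟨R, -, hR⟩ := exists_bound_of_continuous hpq hψ
  refine MemLp.of_bound hψ.aestronglyMeasurable R ?_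
  filter_upwards [ae_restrict_mem measurableSet_Ioc] with t ht using hR t (Ioc_subset_Icc_self ht)

/-- The primitive of `ψ` as an element of the phase space. -/
theorem exists_phase_of_continuous (hpq : p ≤ q) {ψ : ℝ → V} (hψ : Continuous ψ) :
    ∃ x ∈ compatible ι hpq,
      velocityCLM p q V H x =ᵐ[volume.restrict (Ioc p q)] (fun t => ∫ s in p..t, ψ s) ∧
      accelerationCLM p q V H x =ᵐ[volume.restrict (Ioc p q)] (fun t => ι (ψ t)) ∧
      ‖x‖ ^ 2 = (∫ t in p..q, ‖∫ s in p..t, ψ s‖ ^ 2) + (∫ t in p..q, ‖ι (ψ t)‖ ^ 2)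
        + ‖∫ s in p..q, ψ s‖ ^ 2 := by
  have h1 := memLp_primitive hpq (hψ.intervalIntegrable p q)
  have h2 := memLp_of_continuous hpq (ι.continuous.comp hψ)
  have e1 := h1.coeFn_toLp
  have e2 := h2.coeFn_toLp
  have hcomm : ∀ t, ∫ s in p..t, ι (ψ s) = ι (∫ s in p..t, ψ s) := fun t =>
    ι.intervalIntegral_comp_comm (hψ.intervalIntegrable p t)
  obtain ⟨x, x1, x2, x3, x4⟩ := exists_phase h1.toLp h2.toLp (∫ s in p..q, ψ s)
  refine ⟨x, mem_compatible.2 ⟨?_, ?_⟩, by rwa [x1], by rwa [x2], ?_⟩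
  · rw [x1, x2]
    refine Lp.ext ?_
    filter_upwards [ι.coeFn_compLp h1.toLp, e1, primitiveCLM_ae_eq hpq h2.toLp,
      ae_restrict_mem measurableSet_Ioc] with t t1 t2 t3 ht
    refine t1.trans (Eq.trans ?_ t3.symm)
    rw [t2, integral_congr_of_ae_eq e2 (Ioc_subset_Icc_self ht)]
    exact (hcomm t).symm
  · rw [x2, x3]
    refine Eq.trans ?_ (integral_congr_of_ae_eq e2 (right_mem_Icc.2 hpq)).symm
    exact (hcomm q).symm
  · rw [x4]
    refine congrArg₂ (· + ·) (congrArg₂ (· + ·) ?_ ?_) rfl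
    · refine (L2Ioc.norm_sq hpq h1.toLp).trans ?_
      refine integral_congr_of_ae_eq ?_ (right_mem_Icc.2 hpq)
      filter_upwards [e1] with t t1
      rw [t1]
    · refine (L2Ioc.norm_sq hpq h2.toLp).trans ?_
      refine integral_congr_of_ae_eq ?_ (right_mem_Icc.2 hpq)
      filter_upwards [e2] with t t1
      rw [t1]; rfl

variable [SecondCountableTopology V] {a₁ a₂ b₁ b₂ : ℝ → V →L[ℝ] V →L[ℝ] ℝ} {L : ℝ≥0} {M α : ℝ}

/-- Subtracting the uniform motion `u₀ + (t - p) • u₁` leaves zero initial data. Lions' theorem on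
`compatible` then applies: `√Q` bounds `ℓ` from above and, by coercivity, is bounded by the dual
norm of `K ψ` on that subspace. -/
theorem LipschitzSetting.exists_variational_solution
    (h : LipschitzSetting ι p q a₁ a₂ b₁ b₂ L M α) {f : ℝ → H}
    (hf : MemLp f 2 (volume.restrict (Ioc p q))) (u₀ u₁ : V) :
    ∃ e : ℝ → ℝ, Continuous e ∧ (∀ t, 0 < e t) ∧ ∃ x ∈ compatible ι h.le, ∀ ψ : ℝ → V, Continuous ψ →
      IntervalIntegrable (fun t => e t * (inner ℝ (ι (ψ t)) (accelerationCLM p q V H x t)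
        + (b₁ t + b₂ t) (velocityCLM p q V H x t + u₁) (ψ t)
        + (a₁ t + a₂ t) (primitiveCLM V h.le (velocityCLM p q V H x) t + (u₀ + (t - p) • u₁)) (ψ t)
        - inner ℝ (ι (ψ t)) (f t))) volume p q ∧
      ∫ t in p..q, e t * (inner ℝ (ι (ψ t)) (accelerationCLM p q V H x t)
        + (b₁ t + b₂ t) (velocityCLM p q V H x t + u₁) (ψ t)
        + (a₁ t + a₂ t) (primitiveCLM V h.le (velocityCLM p q V H x) t + (u₀ + (t - p) • u₁)) (ψ t)
        - inner ℝ (ι (ψ t)) (f t)) = 0 := by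
  have hpq := h.le
  obtain ⟨r, hr, hcoer⟩ := h.exists_coercive
  have ham := aestronglyMeasurable_add_form h.lipschitz_a h.measurable_a
  have hbm := aestronglyMeasurable_add_form h.lipschitz_b h.measurable_b
  have haM := fun t => abs_add_form_le (h.bound_a t) (h.bound_a₂ t)
  have hbM := fun t => abs_add_form_le (h.bound_b t) (h.bound_b₂ t)
  set e := expWeight r p with he
  have hec : Continuous e := continuous_expWeight
  have hepos : ∀ t, 0 < e t := fun t => expWeight_pos
  refine ⟨e, hec, hepos, ?_⟩
  have hG : ∀ t, HasDerivAt (fun t : ℝ => u₀ + (t - p) • u₁) u₁ t := fun t => by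
    simpa using (((hasDerivAt_id t).sub_const p).smul_const u₁).const_add u₀
  have hGc : Continuous fun t : ℝ => u₀ + (t - p) • u₁ := by fun_prop
  obtain ⟨K, hK⟩ := exists_linearMap_velocity_form (ι := ι) hpq ham hbm haM hbM hec
  obtain ⟨ℓ, hℓ⟩ := exists_linearMap_source (ι := ι) hpq ham hbm haM hbM hf hr.le hGc
    (continuous_const (y := u₁))
  obtain ⟨C₁, hC₁, hb₁⟩ := exists_abs_integral_inner_le (ι := ι) hpq hf hr.le
  obtain ⟨C₂, hC₂, hb₂⟩ := exists_abs_integral_add_form_le hpq h.lipschitz_b h.bound_b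
    h.measurable_b h.bound_b₂ hr.le (fun t => hasDerivAt_const t u₁) continuous_const
  obtain ⟨C₃, hC₃, hb₃⟩ := exists_abs_integral_add_form_le hpq h.lipschitz_a h.bound_a
    h.measurable_a h.bound_a₂ hr.le hG continuous_const
  rw [← he] at hb₁ hb₂ hb₃ hℓ
  have hφ : ∀ (ψ : C(ℝ, V)) t, HasDerivAt (fun t => ∫ s in p..t, ψ s) (ψ t) t := fun ψ t =>
    (ψ.continuous.integral_hasStrictDerivAt p t).hasDerivAt
  have hφc : ∀ (ψ : C(ℝ, V)), Continuous (fun t => ∫ s in p..t, ψ s) := fun ψ =>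
    continuous_iff_continuousAt.2 fun t => (hφ ψ t).continuousAt
  set X : C(ℝ, V) → ℝ := fun ψ => ∫ t in p..q, e t * ‖∫ s in p..t, ψ s‖ ^ 2 with hX
  set Y : C(ℝ, V) → ℝ := fun ψ => ∫ t in p..q, e t * ‖ι (ψ t)‖ ^ 2 with hY
  set Z : C(ℝ, V) → ℝ := fun ψ => e q * ‖∫ s in p..q, ψ s‖ ^ 2 with hZ
  have hX0 : ∀ ψ, 0 ≤ X ψ := fun ψ => intervalIntegral.integral_nonneg hpq fun t _ =>
    mul_nonneg (hepos t).le (sq_nonneg _)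
  have hY0 : ∀ ψ, 0 ≤ Y ψ := fun ψ => intervalIntegral.integral_nonneg hpq fun t _ =>
    mul_nonneg (hepos t).le (sq_nonneg _)
  have hZ0 : ∀ ψ, 0 ≤ Z ψ := fun ψ => mul_nonneg (hepos q).le (sq_nonneg _)
  -- The term `Z`, the final value of the primitive, is needed twice: it occurs in the bound for
  -- `ℓ`, and it controls the third component of the phase-space element built from `ψ`.
  set Q : C(ℝ, V) → ℝ := fun ψ => X ψ + Y ψ + Z ψ with hQ
  have hQ0 : ∀ ψ, 0 ≤ Q ψ := fun ψ => add_nonneg (add_nonneg (hX0 ψ) (hY0 ψ)) (hZ0 ψ)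
  have hQs : ∀ (s : ℝ) ψ, Q (s • ψ) = s ^ 2 * Q ψ := by
    intro s ψ
    have q1 : X (s • ψ) = s ^ 2 * X ψ := by
      simp only [hX]
      rw [← intervalIntegral.integral_const_mul]
      refine intervalIntegral.integral_congr fun t _ => ?_
      simp only [ContinuousMap.smul_apply, intervalIntegral.integral_smul, norm_smul, mul_pow,
        Real.norm_eq_abs, sq_abs]
      ring
    have q2 : Y (s • ψ) = s ^ 2 * Y ψ := by
      simp only [hY]
      rw [← intervalIntegral.integral_const_mul]
      refine intervalIntegral.integral_congr fun t _ => ?_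
      simp only [ContinuousMap.smul_apply, map_smul, norm_smul, mul_pow, Real.norm_eq_abs, sq_abs]
      ring
    have q3 : Z (s • ψ) = s ^ 2 * Z ψ := by
      simp only [hZ, ContinuousMap.smul_apply, intervalIntegral.integral_smul, norm_smul, mul_pow,
        Real.norm_eq_abs, sq_abs]
      ring
    simp only [hQ, q1, q2, q3]
    ring
  have hℓb : ∀ ψ, |ℓ ψ| ≤ 2 * (C₁ + C₂ + C₃ + 3) * √(Q ψ) := by
    refine abs_le_of_quadratic_bound ℓ Q hQ0 hQs _ fun ψ => ?_
    have k1 := (hb₁ ψ ψ.continuous).2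
    have k2 := hb₂ _ ψ ψ.continuous (hφ ψ) (by simp)
    have k3 := hb₃ _ ψ ψ.continuous (hφ ψ) (by simp)
    rw [(hℓ ψ).2]
    have k4 := mul_nonneg (add_nonneg (add_nonneg hC₁ hC₂) hC₃) (hQ0 ψ)
    refine (abs_sub _ _).trans ((add_le_add (abs_sub _ _) le_rfl).trans ?_)
    change _ ≤ C₁ + Y ψ at k1
    change _ ≤ C₂ + Z ψ + X ψ + Y ψ at k2
    change _ ≤ C₃ + Z ψ + X ψ + Y ψ at k3
    have k5 : Q ψ = X ψ + Y ψ + Z ψ := rfl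
    linarith [hX0 ψ, hY0 ψ, hZ0 ψ]
  set κ : ℝ := min (1 / 2) (α / 4) with hκ
  have hκ0 : 0 < κ := lt_min (by norm_num) (by linarith [h.pos])
  -- Evaluate `K ψ` at the triple `x` built from the primitive of `ψ`: coercivity gives `κ * Q ψ ≤ K
  -- ψ x ≤ D * ‖x‖`, and `‖x‖` is at most `√((e q)⁻¹) * √(Q ψ)` because the decreasing weight is at
  -- least `e q`.
  have hKS : ∀ ψ D, 0 ≤ D → (∀ y ∈ compatible ι hpq, |K ψ y| ≤ D * ‖y‖) →
      κ * √(Q ψ) ≤ √((e q)⁻¹) * D := by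
    intro ψ D hD0 hD
    obtain ⟨x, hx, x1, x2, x3⟩ := exists_phase_of_continuous (ι := ι) hpq ψ.continuous
    have c1 := hcoer (fun t => ∫ s in p..t, ∫ s' in p..s, ψ s') _ ψ ψ.continuous (hφ ψ)
      (fun t => ((hφc ψ).integral_hasStrictDerivAt p t).hasDerivAt) (by simp) (by simp)
    have c2 : K ψ x = ∫ t in p..q, e t * (inner ℝ (ι (ψ t)) (ι (ψ t))
        + (b₁ t + b₂ t) (∫ s in p..t, ψ s) (ψ t)
        + (a₁ t + a₂ t) (∫ s in p..t, ∫ s' in p..s, ψ s') (ψ t)) := by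
      rw [(hK ψ x).2]
      refine integral_congr_of_ae_eq ?_ (right_mem_Icc.2 hpq)
      filter_upwards [x1, x2, primitiveCLM_ae_eq hpq (velocityCLM p q V H x),
        ae_restrict_mem measurableSet_Ioc] with t t1 t2 t3 ht
      rw [t1, t2, t3, integral_congr_of_ae_eq x1 (Ioc_subset_Icc_self ht)]
    rw [← c2] at c1
    have c3 : κ * Q ψ ≤ K ψ x := by
      refine le_trans ?_ c1
      change _ ≤ 1 / 2 * Y ψ + α / 4 * Z ψ + X ψ
      have c4 : κ ≤ 1 / 2 := min_le_left _ _
      have c5 : κ ≤ α / 4 := min_le_right _ _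
      have := mul_le_mul_of_nonneg_right c4 (hX0 ψ)
      have := mul_le_mul_of_nonneg_right c4 (hY0 ψ)
      have := mul_le_mul_of_nonneg_right c5 (hZ0 ψ)
      have := hX0 ψ
      simp only [hQ]
      linarith
    have c6 : K ψ x ≤ D * ‖x‖ := (le_abs_self _).trans (hD x hx)
    have c7 : ‖x‖ ≤ √((e q)⁻¹) * √(Q ψ) := by
      rw [← Real.sqrt_mul (inv_nonneg.2 (hepos q).le)]
      refine Real.le_sqrt_of_sq_le ?_
      rw [x3, inv_mul_eq_div, le_div_iff₀ (hepos q)]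
      have c8 : (∫ t in p..q, ‖∫ s in p..t, ψ s‖ ^ 2) * e q ≤ X ψ := by
        rw [← intervalIntegral.integral_mul_const]
        refine intervalIntegral.integral_mono_on hpq
          (Continuous.intervalIntegrable (by have := hφc ψ; fun_prop) _ _)
          (Continuous.intervalIntegrable (by have := hφc ψ; fun_prop) _ _) fun t ht => ?_
        rw [mul_comm]
        gcongr
        exact expWeight_antitone hr.le ht.2
      have c9 : (∫ t in p..q, ‖ι (ψ t)‖ ^ 2) * e q ≤ Y ψ := by
        rw [← intervalIntegral.integral_mul_const]
        refine intervalIntegral.integral_mono_on hpq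
          (Continuous.intervalIntegrable (by fun_prop) _ _)
          (Continuous.intervalIntegrable (by fun_prop) _ _) fun t ht => ?_
        rw [mul_comm]
        gcongr
        exact expWeight_antitone hr.le ht.2
      have c10 : Z ψ = e q * ‖∫ s in p..q, ψ s‖ ^ 2 := rfl
      simp only [hQ]
      linarith
    rcases (Real.sqrt_nonneg (Q ψ)).eq_or_lt with h0 | h0
    · rw [← h0, mul_zero]; positivity
    · have c11 : κ * (√(Q ψ) * √(Q ψ)) ≤ D * (√((e q)⁻¹) * √(Q ψ)) := by
        rw [Real.mul_self_sqrt (hQ0 ψ)]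
        exact c3.trans (c6.trans (by gcongr))
      refine le_of_mul_le_mul_right ?_ h0
      linarith
  have hdom : ∀ ψ D, 0 ≤ D → (∀ y ∈ compatible ι hpq, |K ψ y| ≤ D * ‖y‖) →
      |ℓ ψ| ≤ 2 * (C₁ + C₂ + C₃ + 3) * (κ⁻¹ * √((e q)⁻¹)) * D := by
    intro ψ D hD0 hD
    refine (hℓb ψ).trans ?_
    rw [mul_assoc _ (κ⁻¹ * _)]
    gcongr
    rw [mul_assoc, inv_mul_eq_div, le_div_iff₀ hκ0, mul_comm]
    exact hKS ψ D hD0 hD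
  obtain ⟨x, hxS, hx⟩ := exists_mem_forall_apply_eq_of_abs_le isClosed_compatible K ℓ _ hdom
  refine ⟨x, hxS, fun ψ hψ => ?_⟩
  have i1 := (hK ⟨ψ, hψ⟩ x).1
  have i2 := (hℓ ⟨ψ, hψ⟩).1
  have hfun : (fun t => e t * (inner ℝ (ι (ψ t)) (accelerationCLM p q V H x t)
        + (b₁ t + b₂ t) (velocityCLM p q V H x t + u₁) (ψ t)
        + (a₁ t + a₂ t) (primitiveCLM V h.le (velocityCLM p q V H x) t + (u₀ + (t - p) • u₁)) (ψ t)
        - inner ℝ (ι (ψ t)) (f t))) = fun t =>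
        e t * (inner ℝ (ι (ψ t)) (accelerationCLM p q V H x t) + (b₁ t + b₂ t) (velocityCLM p q V H x t) (ψ t)
          + (a₁ t + a₂ t) (primitiveCLM V hpq (velocityCLM p q V H x) t) (ψ t))
        - e t * (inner ℝ (ι (ψ t)) (f t) - (b₁ t + b₂ t) u₁ (ψ t)
          - (a₁ t + a₂ t) (u₀ + (t - p) • u₁) (ψ t)) := by
    ext t
    rw [map_add (b₁ t + b₂ t), map_add (a₁ t + a₂ t)]
    simp only [add_apply (F := V →L[ℝ] ℝ)]
    ring
  rw [hfun]
  refine ⟨i1.sub i2, ?_⟩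
  simp only [ContinuousMap.coe_mk] at i1 i2
  rw [intervalIntegral.integral_sub i1 i2, sub_eq_zero]
  have h1 := hx ⟨ψ, hψ⟩
  have h2 : K ⟨ψ, hψ⟩ x = ℓ ⟨ψ, hψ⟩ := h1
  have h3 : ∫ t in p..q, e t * (inner ℝ (ι (ψ t)) (f t) - (b₁ t + b₂ t) u₁ (ψ t)
          - (a₁ t + a₂ t) (u₀ + (t - p) • u₁) (ψ t)) = ℓ ⟨ψ, hψ⟩ := by
    have j1 := (hb₁ ψ hψ).1
    have j2 := intervalIntegrable_form_apply (ι := ContinuousLinearMap.id ℝ V) hpq hbm hbM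
      (continuous_const (y := u₁)) hψ hec
    have j3 := intervalIntegrable_form_apply (ι := ContinuousLinearMap.id ℝ V) hpq ham haM hGc hψ hec
    rw [(hℓ ⟨ψ, hψ⟩).2]
    simp only [mul_sub, ContinuousMap.coe_mk]
    rw [intervalIntegral.integral_sub (j1.sub j2) j3, intervalIntegral.integral_sub j1 j2]
  rw [h3, ← h2, (hK ⟨ψ, hψ⟩ x).2]
  rfl

end Existence

/-! ### From the variational problem to the pointwise equation -/

section Existence

variable {V : Type*} [NormedAddCommGroup V] [InnerProductSpace ℝ V] [CompleteSpace V]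
  [SecondCountableTopology V]
  {H : Type*} [NormedAddCommGroup H] [InnerProductSpace ℝ H] [CompleteSpace H] {p q : ℝ}
  {ι : V →L[ℝ] H}

theorem ae_eq_zero_of_integral_continuous_mul_eq_zero (hpq : p ≤ q) {k : ℝ → ℝ}
    (hk : IntervalIntegrable k volume p q)
    (h : ∀ g : ℝ → ℝ, Continuous g → ∫ t in p..q, g t * k t = 0) :
    ∀ᵐ t ∂(volume.restrict (Ioc p q)), k t = 0 := by
  have h1 := (intervalIntegrable_iff_integrableOn_Ioc_of_le hpq).1 hk
  refine ae_eq_zero_of_integral_contDiff_smul_eq_zero (Integrable.locallyIntegrable h1)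
    fun g hg _ => ?_
  have := h g hg.continuous
  rwa [intervalIntegral.integral_of_le hpq] at this

/-- Adding `u₁` back restores the initial velocity, and the third component plus `u₁` is the final
velocity in `V`. The equation is localised in time by test functions `g • y` with `g` scalar and `y`
fixed. -/
theorem LipschitzSetting.exists_solution {a₁ a₂ b₁ b₂ : ℝ → V →L[ℝ] V →L[ℝ] ℝ} {L : ℝ≥0} {M α : ℝ}
    (h : LipschitzSetting ι p q a₁ a₂ b₁ b₂ L M α) {f : ℝ → H}
    (hf : MemLp f 2 (volume.restrict (Ioc p q))) (u₀ u₁ : V) :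
    ∃ v w, IsVelocitySolution ι p q (fun t => a₁ t + a₂ t) (fun t => b₁ t + b₂ t) f u₀ u₁ v w ∧
      ∃ z, ι z = ι u₁ + ∫ s in p..q, w s := by
  have hpq := h.le
  obtain ⟨e, hec, hepos, x, hxS, hx⟩ := h.exists_variational_solution hf u₀ u₁
  obtain ⟨hx1, hx2⟩ := mem_compatible.1 hxS
  set v := velocityCLM p q V H x
  set w := accelerationCLM p q V H x
  refine ⟨fun t => v t + u₁, w, ⟨(Lp.memLp v).add (memLp_const u₁), Lp.memLp w, ?_, ?_⟩,
    u₁ + finalCLM p q V H x, by rw [map_add, hx2]⟩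
  · filter_upwards [ι.coeFn_compLp v, primitiveCLM_ae_eq hpq w] with t t1 t2
    rw [map_add, ← t1, hx1, t2, add_comm]
  · set k : V → ℝ → ℝ := fun y t => inner ℝ (ι y) (w t) + (b₁ t + b₂ t) (v t + u₁) y
        + (a₁ t + a₂ t) (primitiveCLM V hpq v t + (u₀ + (t - p) • u₁)) y
        - inner ℝ (ι y) (f t) with hk
    have hzero : ∀ y, ∀ᵐ t ∂(volume.restrict (Ioc p q)), k y t = 0 := by
      intro y
      have h1 := ae_eq_zero_of_integral_continuous_mul_eq_zero hpq (k := fun t => e t * k y t)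
        (hx (fun _ => y) continuous_const).1 (fun g hg => by
          rw [← (hx (fun t => g t • y) (by fun_prop)).2]
          refine intervalIntegral.integral_congr fun t _ => ?_
          simp only [hk, map_smul, inner_smul_left, conj_trivial, smul_eq_mul]
          ring)
      filter_upwards [h1] with t ht
      exact (mul_eq_zero.1 ht).resolve_left (hepos t).ne'
    -- A countable dense set of test vectors gives one exceptional null set; continuity in `y` then
    -- yields all test vectors at once.
    have hall : ∀ᵐ t ∂(volume.restrict (Ioc p q)), ∀ n, k (TopologicalSpace.denseSeq V n) t = 0 :=
      ae_all_iff.2 fun n => hzero _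
    filter_upwards [hall, primitiveCLM_ae_eq hpq v, ae_restrict_mem measurableSet_Ioc] with t t1 t2 ht
    have hcont : Continuous fun y => k y t := by
      simp only [hk]
      fun_prop
    have h2 : (fun y => k y t) = fun _ => 0 :=
      hcont.ext_on (TopologicalSpace.denseRange_denseSeq V) continuous_const (by
        rintro _ ⟨n, rfl⟩; exact t1 n)
    intro y
    have h3 : k y t = 0 := congrFun h2 y
    have hsub : uIcc p t ⊆ uIcc p q := uIcc_subset_uIcc left_mem_uIcc
      (by rw [uIcc_of_le hpq]; exact Ioc_subset_Icc_self ht)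
    have h4 : ∫ s in p..t, (v s + u₁) = (∫ s in p..t, v s) + (t - p) • u₁ := by
      rw [intervalIntegral.integral_add ((L2Ioc.intervalIntegrable hpq v).mono_set hsub) (by simp),
        intervalIntegral.integral_const]
    simp only [hk, t2] at h3
    rw [h4]
    rw [← sub_eq_zero, ← h3]
    congr 4
    abel

end Existence

/-! ### Gronwall's inequality and Lipschitz extension -/

/-- The primitive of `y` vanishes at `p` and its derivative is at most `C` times itself, so it is
zero. -/
theorem eq_zero_of_le_mul_integral {y : ℝ → ℝ} {p q C : ℝ} (hpq : p ≤ q)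
    (hy : ContinuousOn y (Icc p q)) (h0 : ∀ t ∈ Icc p q, 0 ≤ y t)
    (h : ∀ t ∈ Icc p q, y t ≤ C * ∫ s in p..t, y s) : ∀ t ∈ Icc p q, y t = 0 := by
  -- A continuous extension to the line makes the primitive differentiable at the endpoints too.
  set y' : ℝ → ℝ := IccExtend hpq ((Icc p q).domRestrict y) with hy'
  have hyc : Continuous y' := (continuousOn_iff_continuous_domRestrict.1 hy).Icc_extend'
  have heq : ∀ t ∈ Icc p q, y' t = y t := fun t ht => by
    rw [hy', IccExtend_of_mem _ _ ht]; rfl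
  have hint : ∀ t ∈ Icc p q, ∫ s in p..t, y' s = ∫ s in p..t, y s := fun t ht =>
    intervalIntegral.integral_congr fun s hs => heq s (by
      rw [uIcc_of_le ht.1] at hs; exact ⟨hs.1, hs.2.trans ht.2⟩)
  have hY : ∀ t ∈ Icc p q, ∫ s in p..t, y' s = 0 := by
    refine eq_zero_of_abs_deriv_le_mul_abs_self_of_eq_zero_right (f' := y') (K := C)
      (f := fun t => ∫ s in p..t, y' s) ?_ ?_ (by simp) ?_
    · exact Continuous.continuousOn (continuous_iff_continuousAt.2 fun t =>
        (hyc.integral_hasStrictDerivAt p t).hasDerivAt.continuousAt)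
    · exact fun x _ => (hyc.integral_hasStrictDerivAt p x).hasDerivAt.hasDerivWithinAt
    · intro x hx
      have hx' := Ico_subset_Icc_self hx
      rw [heq x hx', Real.norm_of_nonneg (h0 x hx'), hint x hx', Real.norm_of_nonneg]
      · exact h x hx'
      · exact intervalIntegral.integral_nonneg hx'.1 fun s hs => h0 s ⟨hs.1, hs.2.trans hx'.2⟩
  intro t ht
  refine le_antisymm ((h t ht).trans ?_) (h0 t ht)
  rw [← hint t ht, hY t ht, mul_zero]

/-- Completeness provides limits at the endpoints, and clamping time to `[p,q]` keeps the constant.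
Values stay in the closure of the original ones, so every closed condition on the form (bound,
coercivity, symmetry) survives. -/
theorem exists_lipschitz_extension {X : Type*} [NormedAddCommGroup X] [CompleteSpace X]
    {c : ℝ → X} {p q : ℝ} (hpq : p < q) {L : ℝ≥0} (hc : LipschitzOnWith L c (Ioo p q)) :
    ∃ c' : ℝ → X, LipschitzWith L c' ∧ EqOn c' c (Ioo p q) ∧
      ∀ t, c' t ∈ closure (c '' Ioo p q) := by
  have hlim : ∀ x ∈ Icc p q, ∃ y, Tendsto c (𝓝[Ioo p q] x) (𝓝 y) := by
    intro x hx
    have hne : (𝓝[Ioo p q] x).NeBot := by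
      rw [← mem_closure_iff_nhdsWithin_neBot, closure_Ioo hpq.ne]; exact hx
    exact CompleteSpace.complete ((cauchy_nhds.mono nhdsWithin_le_nhds).map_of_le
      hc.uniformContinuousOn inf_le_right)
  have hcont : ContinuousOn (extendFrom (Ioo p q) c) (Icc p q) :=
    continuousOn_extendFrom (closure_Ioo hpq.ne).ge hlim
  have heq : EqOn (extendFrom (Ioo p q) c) c (Ioo p q) := fun x hx =>
    extendFrom_extends hc.continuousOn x hx
  have hLip : LipschitzOnWith L (extendFrom (Ioo p q) c) (Icc p q) := by
    rw [← closure_Ioo hpq.ne] at hcont ⊢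
    rw [lipschitzOnWith_closure_iff hcont]
    intro x hx y hy
    rw [heq hx, heq hy]
    exact hc hx hy
  refine ⟨fun t => extendFrom (Ioo p q) c (projIcc p q hpq.le t), ?_, ?_, ?_⟩
  · have := hLip.to_restrict.comp (LipschitzWith.projIcc hpq.le)
    rwa [mul_one] at this
  · intro t ht
    change extendFrom (Ioo p q) c (projIcc p q hpq.le t) = c t
    rw [projIcc_of_mem hpq.le (Ioo_subset_Icc_self ht)]
    exact heq ht
  · intro t
    rw [← heq.image_eq]
    rw [← closure_Ioo hpq.ne] at hcont
    refine hcont.image_closure ⟨_, ?_, rfl⟩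
    rw [closure_Ioo hpq.ne]
    exact (projIcc p q hpq.le t).2

/-! ### Uniqueness and gluing of velocity solutions -/

section Solutions

variable {V : Type*} [NormedAddCommGroup V] [InnerProductSpace ℝ V]
  {H : Type*} [NormedAddCommGroup H] [InnerProductSpace ℝ H]
  {ι : V →L[ℝ] H} {p q : ℝ} {a b : ℝ → V →L[ℝ] V →L[ℝ] ℝ} {f : ℝ → H} {u₀ u₁ : V}
  {v v' : ℝ → V} {w w' : ℝ → H}

theorem MemLp.intervalIntegrable_of_mem {E : Type*} [NormedAddCommGroup E] {g : ℝ → E}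
    (hg : MemLp g 2 (volume.restrict (Ioc p q))) {t : ℝ} (ht : t ∈ Icc p q) :
    IntervalIntegrable g volume p t :=
  ((intervalIntegrable_iff_integrableOn_Ioc_of_le (ht.1.trans ht.2)).2
    (hg.integrable (by norm_num))).mono_set (uIcc_subset_uIcc left_mem_uIcc
      (by rwa [uIcc_of_le (ht.1.trans ht.2)]))

theorem IsVelocitySolution.mono (h : IsVelocitySolution ι p q a b f u₀ u₁ v w) {r : ℝ}
    (hr : r ≤ q) : IsVelocitySolution ι p r a b f u₀ u₁ v w := by
  have hsub : Ioc p r ⊆ Ioc p q := Ioc_subset_Ioc_right hr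
  have hμ := Measure.restrict_mono hsub (le_refl (volume : Measure ℝ))
  exact ⟨h.1.mono_measure hμ, h.2.mono_measure hμ, ae_restrict_of_ae_restrict_of_subset hsub h.3,
    ae_restrict_of_ae_restrict_of_subset hsub h.4⟩

theorem IsVelocitySolution.sub (h : IsVelocitySolution ι p q a b f u₀ u₁ v w)
    (h' : IsVelocitySolution ι p q a b f u₀ u₁ v' w') :
    IsVelocitySolution ι p q a b 0 0 0 (v - v') (w - w') where
  memLp_velocity := h.1.sub h'.1
  memLp_acceleration := h.2.sub h'.2
  velocity_eq := by
    filter_upwards [h.3, h'.3, ae_restrict_mem measurableSet_Ioc] with t h1 h2 ht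
    have ht' := Ioc_subset_Icc_self ht
    simp only [Pi.sub_apply, map_sub, h1, h2, map_zero, zero_add]
    rw [intervalIntegral.integral_sub (MemLp.intervalIntegrable_of_mem h.2 ht')
      (MemLp.intervalIntegrable_of_mem h'.2 ht')]
    abel
  equation := by
    filter_upwards [h.4, h'.4, ae_restrict_mem measurableSet_Ioc] with t h1 h2 ht x
    have ht' := Ioc_subset_Icc_self ht
    simp only [Pi.sub_apply, inner_sub_right, zero_add, Pi.zero_apply, inner_zero_right]
    rw [intervalIntegral.integral_sub (MemLp.intervalIntegrable_of_mem h.1 ht')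
      (MemLp.intervalIntegrable_of_mem h'.1 ht')]
    have e : (∫ s in p..t, v s) - ∫ s in p..t, v' s
        = (u₀ + ∫ s in p..t, v s) - (u₀ + ∫ s in p..t, v' s) := by abel
    rw [e, map_sub, map_sub, sub_apply, sub_apply]
    linarith [h1 x, h2 x]

/-- Testing with the velocity itself gives the derivative of `‖ι v‖² / 2` plus a coercive term. The
error terms are controlled by the energy `y`, since the displacement is a primitive of `v`. -/
theorem IsVelocitySolution.eq_zero [CompleteSpace V] [CompleteSpace H] (hpq : p ≤ q)
    {M α : ℝ} (hα : 0 < α)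
    (ha : ∀ t ∈ Ioc p q, ∀ u v, |a t u v| ≤ M * ‖u‖ * ‖v‖)
    (hb : ∀ t ∈ Ioc p q, ∀ u, α * ‖u‖ ^ 2 - M * ‖u‖ * ‖ι u‖ ≤ b t u u)
    (h : IsVelocitySolution ι p q a b 0 0 0 v w) :
    v =ᵐ[volume.restrict (Ioc p q)] 0 ∧ ∀ t ∈ Icc p q, ∫ s in p..t, w s = 0 := by
  have hwint := (intervalIntegrable_iff_integrableOn_Ioc_of_le hpq).2 (h.2.integrable (by norm_num))
  have hv2 : IntervalIntegrable (fun s => ‖v s‖ ^ 2) volume p q :=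
    (intervalIntegrable_iff_integrableOn_Ioc_of_le hpq).2 h.1.integrable_norm_pow'
  have hWc := (absolutelyContinuousOnInterval_integral hwint).continuousOn
  have hNc := (absolutelyContinuousOnInterval_integral hv2).continuousOn
  rw [uIcc_of_le hpq] at hWc hNc
  set W := fun t => ∫ s in p..t, w s with hW
  set N := fun t => ∫ s in p..t, ‖v s‖ ^ 2 with hN
  set y : ℝ → ℝ := fun t => 1 / 2 * ‖W t‖ ^ 2 + α / 2 * N t with hy
  have hN0 : ∀ t ∈ Icc p q, 0 ≤ N t := fun t ht =>
    intervalIntegral.integral_nonneg ht.1 fun _ _ => sq_nonneg _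
  have hyc : ContinuousOn y (Icc p q) :=
    (continuousOn_const.mul (hWc.norm.pow 2)).add (continuousOn_const.mul hNc)
  set C : ℝ := M ^ 2 / α * (2 + (q - p) * (2 / α)) with hC
  have hzero := eq_zero_of_le_mul_integral hpq hyc (C := C)
    (fun t ht => by have := hN0 t ht; positivity) (fun t ht => by
      have hsub : uIcc p t ⊆ uIcc p q := uIcc_subset_uIcc left_mem_uIcc (by rwa [uIcc_of_le hpq])
      have hst : Icc p t ⊆ Icc p q := Icc_subset_Icc_right ht.2
      obtain ⟨hi, he⟩ := integral_inner_primitive (hwint.mono_set hsub)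
      have hy1 : y t = ∫ s in p..t, (inner ℝ (W s) (w s) + α / 2 * ‖v s‖ ^ 2) := by
        rw [intervalIntegral.integral_add hi ((hv2.mono_set hsub).const_mul _),
          intervalIntegral.integral_const_mul]
        change 1 / 2 * ‖W t‖ ^ 2 + α / 2 * N t = _
        rw [← he]; ring
      rw [hy1, ← intervalIntegral.integral_const_mul, intervalIntegral.integral_of_le ht.1,
        intervalIntegral.integral_of_le ht.1]
      refine integral_mono_ae
        ((intervalIntegrable_iff_integrableOn_Ioc_of_le ht.1).1
          (hi.add ((hv2.mono_set hsub).const_mul _)))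
        ((intervalIntegrable_iff_integrableOn_Ioc_of_le ht.1).1
          (ContinuousOn.intervalIntegrable (by
            rw [uIcc_of_le ht.1]; exact (continuousOn_const.mul (hyc.mono hst))))) ?_
      have hst' : Ioc p t ⊆ Ioc p q := Ioc_subset_Ioc_right ht.2
      filter_upwards [ae_restrict_of_ae_restrict_of_subset hst' h.3,
        ae_restrict_of_ae_restrict_of_subset hst' h.4,
        ae_restrict_mem measurableSet_Ioc] with s h1 h2 hs
      have hs' := hst' hs
      have hs'' := Ioc_subset_Icc_self hs'
      have h3 : ι (v s) = W s := by simpa using h1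
      -- Legitimate because the exceptional null set in the equation does not depend on the test
      -- vector.
      have h4 := h2 (v s)
      simp only [zero_add, Pi.zero_apply, inner_zero_right, h3] at h4
      set U := ∫ s' in p..s, v s'
      have hU : ‖U‖ ^ 2 ≤ (q - p) * N s := by
        refine (norm_integral_sq_le hs''.1 (h.mono hs'.2).1).trans ?_
        have := hN0 s hs''
        gcongr
        exact hs''.2
      have h5 := hb s hs' (v s)
      have h6 := (abs_le.1 (ha s hs' U (v s))).1
      rw [h3] at h5
      have h7 : M * ‖v s‖ * ‖W s‖ ≤ α / 4 * ‖v s‖ ^ 2 + M ^ 2 / α * ‖W s‖ ^ 2 := by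
        have : α / 4 * ‖v s‖ ^ 2 + M ^ 2 / α * ‖W s‖ ^ 2 - M * ‖v s‖ * ‖W s‖
            = (4 * α)⁻¹ * (α * ‖v s‖ - 2 * M * ‖W s‖) ^ 2 := by field_simp; ring
        have : 0 ≤ (4 * α)⁻¹ * (α * ‖v s‖ - 2 * M * ‖W s‖) ^ 2 := by positivity
        linarith
      have h8 : M * ‖U‖ * ‖v s‖ ≤ α / 4 * ‖v s‖ ^ 2 + M ^ 2 / α * ‖U‖ ^ 2 := by
        have : α / 4 * ‖v s‖ ^ 2 + M ^ 2 / α * ‖U‖ ^ 2 - M * ‖U‖ * ‖v s‖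
            = (4 * α)⁻¹ * (α * ‖v s‖ - 2 * M * ‖U‖) ^ 2 := by field_simp; ring
        have : 0 ≤ (4 * α)⁻¹ * (α * ‖v s‖ - 2 * M * ‖U‖) ^ 2 := by positivity
        linarith
      have h9 : M ^ 2 / α * (‖W s‖ ^ 2 + ‖U‖ ^ 2) ≤ C * y s := by
        rw [hC, mul_assoc]
        refine mul_le_mul_of_nonneg_left ?_ (by positivity)
        have h10 : (2 + (q - p) * (2 / α)) * y s = ‖W s‖ ^ 2 + (q - p) * N s
            + (α * N s + (q - p) * (1 / α) * ‖W s‖ ^ 2) := by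
          simp only [hy]; field_simp; ring
        have := hN0 s hs''
        have := sub_nonneg.2 hpq
        have : 0 ≤ α * N s + (q - p) * (1 / α) * ‖W s‖ ^ 2 := by positivity
        linarith
      change inner ℝ (W s) (w s) + α / 2 * ‖v s‖ ^ 2 ≤ C * y s
      linarith)
  have hsplit : ∀ t ∈ Icc p q, ‖W t‖ ^ 2 = 0 ∧ N t = 0 := fun t ht => by
    have h1 : 1 / 2 * ‖W t‖ ^ 2 + α / 2 * N t = 0 := hzero t ht
    have h2 := mul_nonneg (half_pos hα).le (hN0 t ht)
    have h3 := sq_nonneg ‖W t‖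
    have h4 : α / 2 * N t = 0 := by linarith
    exact ⟨by linarith, (mul_eq_zero.1 h4).resolve_left (half_pos hα).ne'⟩
  refine ⟨?_, fun t ht => by simpa using (hsplit t ht).1⟩
  have h1 := (hsplit q (right_mem_Icc.2 hpq)).2
  simp only [hN] at h1
  rw [intervalIntegral.integral_of_le hpq, integral_eq_zero_iff_of_nonneg
    (fun _ => sq_nonneg _) h.1.integrable_norm_pow'] at h1
  filter_upwards [h1] with t ht
  simpa using ht

theorem piecewise_eq_left {E : Type*} {g g' : ℝ → E} {r t : ℝ} (ht : t ≤ r) :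
    (Iic r).piecewise g g' t = g t := piecewise_eq_of_mem _ _ _ ht

theorem piecewise_eq_right {E : Type*} {g g' : ℝ → E} {r t : ℝ} (ht : r < t) :
    (Iic r).piecewise g g' t = g' t := piecewise_eq_of_notMem _ _ _ (not_le.2 ht)

theorem memLp_piecewise {E : Type*} [NormedAddCommGroup E] {g g' : ℝ → E} {r : ℝ}
    (hpr : p ≤ r) (hrq : r ≤ q) (hg : MemLp g 2 (volume.restrict (Ioc p r)))
    (hg' : MemLp g' 2 (volume.restrict (Ioc r q))) :
    MemLp ((Iic r).piecewise g g') 2 (volume.restrict (Ioc p q)) := by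
  refine MemLp.piecewise measurableSet_Iic ?_ ?_
  · rwa [Measure.restrict_restrict measurableSet_Iic, inter_comm, Ioc_inter_Iic, min_eq_right hrq]
  · rwa [Measure.restrict_restrict measurableSet_Iic.compl, compl_Iic, inter_comm, Ioc_inter_Ioi,
      max_eq_right hpr]

theorem integral_piecewise_left {E : Type*} [NormedAddCommGroup E] [NormedSpace ℝ E]
    {g g' : ℝ → E} {r t : ℝ} (hpt : p ≤ t) (htr : t ≤ r) :
    ∫ s in p..t, (Iic r).piecewise g g' s = ∫ s in p..t, g s :=
  intervalIntegral.integral_congr fun s hs => piecewise_eq_left (by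
    rw [uIcc_of_le hpt] at hs; exact hs.2.trans htr)

theorem integral_piecewise_right {E : Type*} [NormedAddCommGroup E] [NormedSpace ℝ E]
    {g g' : ℝ → E} {r t : ℝ} (hpr : p ≤ r) (hrt : r ≤ t)
    (hg : IntervalIntegrable g volume p r) (hg' : IntervalIntegrable g' volume r t) :
    ∫ s in p..t, (Iic r).piecewise g g' s = (∫ s in p..r, g s) + ∫ s in r..t, g' s := by
  have e1 : EqOn ((Iic r).piecewise g g') g (uIoc p r) := fun s hs => piecewise_eq_left (by
    rw [uIoc_of_le hpr] at hs; exact hs.2)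
  have e2 : EqOn ((Iic r).piecewise g g') g' (uIoc r t) := fun s hs => piecewise_eq_right (by
    rw [uIoc_of_le hrt] at hs; exact hs.1)
  rw [← intervalIntegral.integral_add_adjacent_intervals (hg.congr e1.symm) (hg'.congr e2.symm)]
  congr 1
  · exact integral_piecewise_left hpr le_rfl
  · exact intervalIntegral.integral_congr_ae (Eventually.of_forall fun s hs => e2 hs)

theorem ae_restrict_Ioc_of_ae {r : ℝ} {P : ℝ → Prop}
    (h₁ : ∀ᵐ t ∂(volume.restrict (Ioc p r)), P t) (h₂ : ∀ᵐ t ∂(volume.restrict (Ioc r q)), P t) :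
    ∀ᵐ t ∂(volume.restrict (Ioc p q)), P t := by
  rw [ae_restrict_iff' measurableSet_Ioc] at *
  filter_upwards [h₁, h₂] with t t1 t2 ht
  rcases le_or_gt t r with h | h
  · exact t1 ⟨ht.1, h⟩
  · exact t2 ⟨h, ht.2⟩

/-- The hypothesis `hz` is what makes restarting possible: the velocity reached at `r` lies in `V`,
as an initial velocity must. -/
theorem IsVelocitySolution.glue {r : ℝ} (hpr : p ≤ r) (hrq : r ≤ q)
    (h : IsVelocitySolution ι p r a b f u₀ u₁ v w) {z : V} (hz : ι z = ι u₁ + ∫ s in p..r, w s)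
    (h' : IsVelocitySolution ι r q a b f (u₀ + ∫ s in p..r, v s) z v' w') :
    IsVelocitySolution ι p q a b f u₀ u₁ ((Iic r).piecewise v v') ((Iic r).piecewise w w') := by
  have hr : r ∈ Icc p r := right_mem_Icc.2 hpr
  refine ⟨memLp_piecewise hpr hrq h.1 h'.1, memLp_piecewise hpr hrq h.2 h'.2,
    ae_restrict_Ioc_of_ae (r := r) ?_ ?_, ae_restrict_Ioc_of_ae (r := r) ?_ ?_⟩
  · filter_upwards [h.3, ae_restrict_mem measurableSet_Ioc] with t h1 ht
    rw [piecewise_eq_left ht.2, integral_piecewise_left ht.1.le ht.2, h1]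
  · filter_upwards [h'.3, ae_restrict_mem measurableSet_Ioc] with t h1 ht
    rw [piecewise_eq_right ht.1, integral_piecewise_right hpr ht.1.le
      (MemLp.intervalIntegrable_of_mem h.2 hr)
      (MemLp.intervalIntegrable_of_mem h'.2 (Ioc_subset_Icc_self ht)), h1, hz, add_assoc]
  · filter_upwards [h.4, ae_restrict_mem measurableSet_Ioc] with t h1 ht
    rw [piecewise_eq_left ht.2, piecewise_eq_left ht.2, integral_piecewise_left ht.1.le ht.2]
    exact h1
  · filter_upwards [h'.4, ae_restrict_mem measurableSet_Ioc] with t h1 ht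
    rw [piecewise_eq_right ht.1, piecewise_eq_right ht.1, integral_piecewise_right hpr ht.1.le
      (MemLp.intervalIntegrable_of_mem h.1 hr)
      (MemLp.intervalIntegrable_of_mem h'.1 (Ioc_subset_Icc_self ht)), ← add_assoc]
    exact h1

end Solutions

/-! ### Solvability and uniqueness across jumps -/

section Solvability

variable {V : Type*} [NormedAddCommGroup V] [InnerProductSpace ℝ V] [CompleteSpace V]
  [SecondCountableTopology V]
  {H : Type*} [NormedAddCommGroup H] [InnerProductSpace ℝ H] [CompleteSpace H]

/-- Standing assumptions on the real forms on `[0,T]`; the principal parts `a₁`, `b₁` are Lipschitz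
continuous on each open interval which avoids the finite set `D`. -/
structure PiecewiseSetting (ι : V →L[ℝ] H) (T : ℝ) (a₁ a₂ b₁ b₂ : ℝ → V →L[ℝ] V →L[ℝ] ℝ)
    (D : Finset ℝ) (L : ℝ≥0) (M α : ℝ) : Prop where
  nonneg : 0 ≤ M
  pos : 0 < α
  lipschitz_a : ∀ p q, 0 ≤ p → p < q → q ≤ T → (∀ d ∈ D, d ∉ Ioo p q) →
    LipschitzOnWith L a₁ (Ioo p q)
  lipschitz_b : ∀ p q, 0 ≤ p → p < q → q ≤ T → (∀ d ∈ D, d ∉ Ioo p q) →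
    LipschitzOnWith L b₁ (Ioo p q)
  bound_a : ∀ t ∈ Icc 0 T, ‖a₁ t‖ ≤ M
  bound_b : ∀ t ∈ Icc 0 T, ‖b₁ t‖ ≤ M
  coercive : ∀ t ∈ Icc 0 T, ∀ u, α * ‖u‖ ^ 2 ≤ b₁ t u u
  symm : ∀ t ∈ Icc 0 T, ∀ u v, b₁ t u v = b₁ t v u
  measurable_a : ∀ u v, AEStronglyMeasurable (fun t => a₂ t u v) (volume.restrict (Icc 0 T))
  measurable_b : ∀ u v, AEStronglyMeasurable (fun t => b₂ t u v) (volume.restrict (Icc 0 T))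
  bound_a₂ : ∀ t u v, |a₂ t u v| ≤ M * ‖u‖ * ‖ι v‖
  bound_b₂ : ∀ t u v, |b₂ t u v| ≤ M * ‖u‖ * ‖ι v‖

variable {ι : V →L[ℝ] H} {T : ℝ} {a₁ a₂ b₁ b₂ : ℝ → V →L[ℝ] V →L[ℝ] ℝ}
    {D : Finset ℝ} {L : ℝ≥0} {M α : ℝ}

/-- Solvability on `[p,q]` for all initial values, with final velocity in `V`. -/
def Solvable (ι : V →L[ℝ] H) (a b : ℝ → V →L[ℝ] V →L[ℝ] ℝ) (f : ℝ → H) (p q : ℝ) : Prop :=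
  ∀ u₀ u₁, ∃ v w, IsVelocitySolution ι p q a b f u₀ u₁ v w ∧
    ∃ z, ι z = ι u₁ + ∫ s in p..q, w s

omit [CompleteSpace V] [SecondCountableTopology V] [CompleteSpace H] in
theorem Solvable.trans {a b : ℝ → V →L[ℝ] V →L[ℝ] ℝ} {f : ℝ → H} {p r q : ℝ} (hpr : p ≤ r)
    (hrq : r ≤ q) (h : Solvable ι a b f p r) (h' : Solvable ι a b f r q) :
    Solvable ι a b f p q := by
  intro u₀ u₁
  obtain ⟨v, w, hs, z, hz⟩ := h u₀ u₁
  obtain ⟨v', w', hs', z', hz'⟩ := h' (u₀ + ∫ s in p..r, v s) z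
  refine ⟨_, _, hs.glue hpr hrq hz hs', z', ?_⟩
  rw [integral_piecewise_right hpr hrq
    (MemLp.intervalIntegrable_of_mem hs.2 (right_mem_Icc.2 hpr))
    (MemLp.intervalIntegrable_of_mem hs'.2 (right_mem_Icc.2 hrq)), hz', hz, add_assoc]

omit [CompleteSpace V] [SecondCountableTopology V] [CompleteSpace H] in
theorem Solvable.refl {a b : ℝ → V →L[ℝ] V →L[ℝ] ℝ} {f : ℝ → H} {p : ℝ} :
    Solvable ι a b f p p := fun u₀ u₁ =>
  ⟨0, 0, ⟨by simp, by simp, by simp, by simp⟩, u₁, by simp⟩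

/-- The principal parts are replaced by Lipschitz extensions from `(p,q)` to the line, which inherit
all closed conditions. -/
theorem PiecewiseSetting.solvable_of_avoids (h : PiecewiseSetting ι T a₁ a₂ b₁ b₂ D L M α)
    {f : ℝ → H} (hf : MemLp f 2 (volume.restrict (Ioc 0 T))) {p q : ℝ} (hp : 0 ≤ p) (hpq : p < q)
    (hq : q ≤ T) (hD : ∀ d ∈ D, d ∉ Ioo p q) :
    Solvable ι (fun t => a₁ t + a₂ t) (fun t => b₁ t + b₂ t) f p q := by
  intro u₀ u₁
  have hsub : Ioo p q ⊆ Icc 0 T := fun t ht => ⟨hp.trans ht.1.le, ht.2.le.trans hq⟩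
  have hsub' : Ioc p q ⊆ Icc 0 T := fun t ht => ⟨hp.trans ht.1.le, ht.2.trans hq⟩
  obtain ⟨a', ha1, ha2, ha3⟩ := exists_lipschitz_extension hpq (h.lipschitz_a p q hp hpq hq hD)
  obtain ⟨b', hb1, hb2, hb3⟩ := exists_lipschitz_extension hpq (h.lipschitz_b p q hp hpq hq hD)
  have key : ∀ {c c' : ℝ → V →L[ℝ] V →L[ℝ] ℝ} {F : Set (V →L[ℝ] V →L[ℝ] ℝ)}, IsClosed F →
      (∀ t ∈ Icc 0 T, c t ∈ F) → (∀ t, c' t ∈ closure (c '' Ioo p q)) → ∀ t, c' t ∈ F := by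
    intro c c' F hF hc hc' t
    refine closure_minimal ?_ hF (hc' t)
    rintro _ ⟨s, hs, rfl⟩
    exact hc s (hsub hs)
  have hcl : IsClosed {c : V →L[ℝ] V →L[ℝ] ℝ | ∀ u v, |c u v| ≤ M * ‖u‖ * ‖v‖} := by
    simp only [ofPred_forall]
    exact isClosed_iInter fun u => isClosed_iInter fun v =>
      isClosed_le (by fun_prop) continuous_const
  have hle : ∀ c : V →L[ℝ] V →L[ℝ] ℝ, ‖c‖ ≤ M → ∀ u v, |c u v| ≤ M * ‖u‖ * ‖v‖ :=
    fun c hc u v => (c.le_opNorm₂ u v).trans (by gcongr)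
  have hge : ∀ c : V →L[ℝ] V →L[ℝ] ℝ, (∀ u v, |c u v| ≤ M * ‖u‖ * ‖v‖) → ‖c‖ ≤ M :=
    fun c hc => c.opNorm_le_bound₂ h.nonneg hc
  have hs : LipschitzSetting ι p q a' a₂ b' b₂ L M α :=
    { le := hpq.le
      nonneg := h.nonneg
      pos := h.pos
      lipschitz_a := ha1
      lipschitz_b := hb1
      bound_a := fun t => hge _ (key hcl (fun s hs => hle _ (h.bound_a s hs)) ha3 t)
      bound_b := fun t => hge _ (key hcl (fun s hs => hle _ (h.bound_b s hs)) hb3 t)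
      coercive := key (F := {c | ∀ u, α * ‖u‖ ^ 2 ≤ c u u}) (by
        simp only [ofPred_forall]
        exact isClosed_iInter fun u => isClosed_le continuous_const (by fun_prop)) h.coercive hb3
      symm := key (F := {c | ∀ u v, c u v = c v u}) (by
        simp only [ofPred_forall]
        exact isClosed_iInter fun u => isClosed_iInter fun v =>
          isClosed_eq (by fun_prop) (by fun_prop)) h.symm hb3
      measurable_a := fun u v => (h.measurable_a u v).mono_measure
        (Measure.restrict_mono hsub' le_rfl)
      measurable_b := fun u v => (h.measurable_b u v).mono_measure
        (Measure.restrict_mono hsub' le_rfl)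
      bound_a₂ := h.bound_a₂
      bound_b₂ := h.bound_b₂ }
  obtain ⟨v, w, hvw, hz⟩ := hs.exists_solution (hf.mono_measure
    (Measure.restrict_mono (Ioc_subset_Ioc hp hq) le_rfl)) u₀ u₁
  refine ⟨v, w, ⟨hvw.1, hvw.2, hvw.3, ?_⟩, hz⟩
  have h4 := hvw.4
  -- The extensions agree with the original forms on the open interval only; the endpoint is a null
  -- set.
  rw [← restrict_Ioo_eq_restrict_Ioc] at h4 ⊢
  filter_upwards [h4, ae_restrict_mem measurableSet_Ioo] with t h5 ht x
  rw [← ha2 ht, ← hb2 ht]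
  exact h5 x

/-- Strong induction on the number of points of `D` inside `(p,q)`: splitting at such a point `d`
removes it from both halves. -/
theorem PiecewiseSetting.solvable (h : PiecewiseSetting ι T a₁ a₂ b₁ b₂ D L M α)
    {f : ℝ → H} (hf : MemLp f 2 (volume.restrict (Ioc 0 T))) {p q : ℝ} (hp : 0 ≤ p) (hpq : p ≤ q)
    (hq : q ≤ T) : Solvable ι (fun t => a₁ t + a₂ t) (fun t => b₁ t + b₂ t) f p q := by
  classical
  induction hn : (D.filter (· ∈ Ioo p q)).card using Nat.strong_induction_on generalizing p q with
  | _ n ih =>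
    rcases hpq.eq_or_lt with rfl | hlt
    · exact Solvable.refl
    by_cases hD : ∀ d ∈ D, d ∉ Ioo p q
    · exact h.solvable_of_avoids hf hp hlt hq hD
    push Not at hD
    obtain ⟨d, hdD, hd⟩ := hD
    refine Solvable.trans hd.1.le hd.2.le (ih _ ?_ hp hd.1.le (hd.2.le.trans hq) rfl)
      (ih _ ?_ (hp.trans hd.1.le) hd.2.le hq rfl)
    · rw [← hn]
      refine Finset.card_lt_card ⟨fun x hx => ?_, fun hx => ?_⟩
      · rw [Finset.mem_filter] at hx ⊢
        exact ⟨hx.1, hx.2.1, hx.2.2.trans hd.2⟩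
      · exact lt_irrefl d (Finset.mem_filter.1 (hx (Finset.mem_filter.2 ⟨hdD, hd⟩))).2.2
    · rw [← hn]
      refine Finset.card_lt_card ⟨fun x hx => ?_, fun hx => ?_⟩
      · rw [Finset.mem_filter] at hx ⊢
        exact ⟨hx.1, hd.1.trans hx.2.1, hx.2.2⟩
      · exact lt_irrefl d (Finset.mem_filter.1 (hx (Finset.mem_filter.2 ⟨hdD, hd⟩))).2.1

omit [SecondCountableTopology V] in
-- The difference solves the homogeneous problem. The `V × H` bound of `b₂` is precisely the loss `M
-- ‖u‖ ‖ι u‖` allowed in `IsVelocitySolution.eq_zero`.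
theorem PiecewiseSetting.eq_of_isVelocitySolution (h : PiecewiseSetting ι T a₁ a₂ b₁ b₂ D L M α)
    {f : ℝ → H} {S : ℝ} (hS : 0 ≤ S) (hST : S ≤ T) {u₀ u₁ : V} {v v' : ℝ → V} {w w' : ℝ → H}
    (hs : IsVelocitySolution ι 0 S (fun t => a₁ t + a₂ t) (fun t => b₁ t + b₂ t) f u₀ u₁ v w)
    (hs' : IsVelocitySolution ι 0 S (fun t => a₁ t + a₂ t) (fun t => b₁ t + b₂ t) f u₀ u₁ v' w') :
    v =ᵐ[volume.restrict (Ioc 0 S)] v' ∧ ∫ s in 0..S, w s = ∫ s in 0..S, w' s := by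
  have hM := h.nonneg
  have hsub : Ioc 0 S ⊆ Icc 0 T := fun t ht => ⟨ht.1.le, ht.2.trans hST⟩
  obtain ⟨h1, h2⟩ := (hs.sub hs').eq_zero (M := M + M * ‖ι‖) hS h.pos
    (fun t ht u v => abs_add_form_le (h.bound_a t (hsub ht)) (h.bound_a₂ t) u v)
    (fun t ht u => by
      have k1 := h.coercive t (hsub ht) u
      have k2 := (abs_le.1 (h.bound_b₂ t u u)).1
      have k3 : 0 ≤ M * ‖ι‖ * ‖u‖ * ‖ι u‖ := by positivity
      rw [add_apply, add_apply]
      linarith)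
  refine ⟨?_, ?_⟩
  · filter_upwards [h1] with t ht
    exact sub_eq_zero.1 ht
  · have h3 := h2 S (right_mem_Icc.2 hS)
    simp only [Pi.sub_apply] at h3
    rw [intervalIntegral.integral_sub (MemLp.intervalIntegrable_of_mem hs.2 (right_mem_Icc.2 hS))
      (MemLp.intervalIntegrable_of_mem hs'.2 (right_mem_Icc.2 hS))] at h3
    exact sub_eq_zero.1 h3

end Solvability

/-- Otherwise induction along the partition keeps every `τ i` at or below `p`, contradicting `q ≤ τ
(Fin.last n)`. -/
theorem exists_subset_of_avoids_range {n : ℕ} {τ : Fin (n + 1) → ℝ} {p q : ℝ} (h0 : τ 0 ≤ p)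
    (hpq : p < q) (hq : q ≤ τ (Fin.last n)) (h : ∀ i, τ i ∉ Ioo p q) :
    ∃ i : Fin n, Ioo p q ⊆ Ioo (τ i.castSucc) (τ i.succ) := by
  by_contra! hcon
  have key : ∀ i, τ i ≤ p := by
    intro i
    induction i using Fin.induction with
    | zero => exact h0
    | succ i ih =>
      by_contra! hlt
      refine hcon i (Ioo_subset_Ioo ih ?_)
      by_contra! hlt'
      exact h i.succ ⟨hlt, hlt'⟩
  exact absurd (key (Fin.last n)) (not_le.2 (hpq.trans_le hq))

/-! ### Weak derivatives and primitives -/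

section WeakDerivative

variable {E : Type*} [NormedAddCommGroup E] [NormedSpace ℝ E] {T : ℝ}

/-- `v` is the weak derivative of `u` on `(0,T)`, for functions with values in a real space. -/
def IsWeakDeriv (T : ℝ) (u v : ℝ → E) : Prop :=
  ∀ φ : ℝ → ℝ, ContDiff ℝ ∞ φ → HasCompactSupport φ → tsupport φ ⊆ Ioo (0 : ℝ) T →
    ∫ t in Ioo (0 : ℝ) T, deriv φ t • u t = - ∫ t in Ioo (0 : ℝ) T, φ t • v t

theorem integrableOn_smul_of_continuous {φ : ℝ → ℝ} (hφ : Continuous φ) {u : ℝ → E}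
    (hu : IntegrableOn u (Ioo 0 T)) : IntegrableOn (fun t => φ t • u t) (Ioo 0 T) := by
  rw [← integrableOn_Icc_iff_integrableOn_Ioo] at hu ⊢
  exact hu.continuousOn_smul hφ.continuousOn isCompact_Icc

theorem isWeakDeriv_of_ae_eq [CompleteSpace E] (hT : 0 ≤ T) {u v : ℝ → E}
    (hv : IntegrableOn v (Ioo 0 T)) {c : E}
    (hu : ∀ᵐ t ∂(volume.restrict (Ioo 0 T)), u t = c + ∫ s in 0..t, v s) :
    IsWeakDeriv T u v := by
  intro φ hφ hφc hφs
  have hvi : IntervalIntegrable v volume 0 T :=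
    (intervalIntegrable_iff_integrableOn_Ioo_of_le hT).2 hv
  have h0 : φ 0 = 0 := image_eq_zero_of_notMem_tsupport fun h => lt_irrefl _ (hφs h).1
  have h1 : φ T = 0 := image_eq_zero_of_notMem_tsupport fun h => lt_irrefl _ (hφs h).2
  have hd : ∀ t, HasDerivAt φ (deriv φ t) t := fun t =>
    (hφ.differentiable (by simp) t).hasDerivAt
  have hdc : Continuous (deriv φ) := hφ.continuous_deriv (by simp)
  have hVc := (absolutelyContinuousOnInterval_integral hvi).continuousOn
  have key := integral_smul_primitive hd hdc hvi
  have hi1 : IntervalIntegrable (fun t => deriv φ t • ∫ s in 0..t, v s) volume 0 T :=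
    (hdc.continuousOn.smul hVc).intervalIntegrable
  rw [h1, zero_smul, intervalIntegral.integral_add hi1
    (hvi.continuousOn_smul hφ.continuous.continuousOn)] at key
  have hconst : ∫ t in 0..T, deriv φ t • c = 0 := by
    rw [intervalIntegral.integral_smul_const, intervalIntegral.integral_eq_sub_of_hasDerivAt
      (fun t _ => hd t) (hdc.intervalIntegrable _ _), h0, h1, sub_zero, zero_smul]
  have e1 : ∫ t in Ioo (0 : ℝ) T, deriv φ t • u t
      = ∫ t in Ioo (0 : ℝ) T, deriv φ t • (c + ∫ s in 0..t, v s) := by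
    refine integral_congr_ae ?_
    filter_upwards [hu] with t ht
    rw [ht]
  rw [e1, ← integral_Ioc_eq_integral_Ioo, ← integral_Ioc_eq_integral_Ioo,
    ← intervalIntegral.integral_of_le hT, ← intervalIntegral.integral_of_le hT]
  simp_rw [smul_add]
  rw [intervalIntegral.integral_add (Continuous.intervalIntegrable (by fun_prop) _ _) hi1, hconst, zero_add]
  exact eq_neg_of_add_eq_zero_left key

/-- The du Bois-Reymond lemma: a test function of mean zero is the derivative of a test function.
Subtracting a multiple of a fixed bump `χ` of mass one reduces every `ζ` to this case, and the
constant is the `χ`-average of `g`. -/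
theorem ae_eq_const_of_isWeakDeriv_zero [CompleteSpace E] (hT : 0 < T) {g : ℝ → E}
    (hg : IntegrableOn g (Ioo 0 T)) (h : IsWeakDeriv T g 0) :
    ∃ c, ∀ᵐ t ∂(volume.restrict (Ioo 0 T)), g t = c := by
  let B : ContDiffBump (T / 2) := ⟨T / 8, T / 4, by linarith, by linarith⟩
  set χ := B.normed volume with hχ
  have hχd : ContDiff ℝ ∞ χ := B.contDiff_normed
  have hχc : HasCompactSupport χ := B.hasCompactSupport_normed
  have hχs : tsupport χ ⊆ Ioo 0 T := by
    rw [hχ, B.tsupport_normed_eq, Real.closedBall_eq_Icc]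
    intro t ht
    have h1 : T / 2 - T / 4 ≤ t := ht.1
    have h2 : t ≤ T / 2 + T / 4 := ht.2
    exact ⟨by linarith, by linarith⟩
  have hχne : (tsupport χ).Nonempty := by
    rw [hχ, B.tsupport_normed_eq]
    exact Metric.nonempty_closedBall.2 B.rOut_pos.le
  have hχ1 : ∫ t, χ t = 1 := B.integral_normed
  set c := ∫ t in Ioo (0 : ℝ) T, χ t • g t with hc
  refine ⟨c, ?_⟩
  have hfull : ∀ {F : Type _} [NormedAddCommGroup F] [NormedSpace ℝ F] {ζ : ℝ → ℝ} (k : ℝ → F),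
      tsupport ζ ⊆ Ioo 0 T → ∫ t in Ioo (0 : ℝ) T, ζ t • k t = ∫ t, ζ t • k t := by
    intro F _ _ ζ k hζ
    refine setIntegral_eq_integral_of_forall_compl_eq_zero fun t ht => ?_
    rw [image_eq_zero_of_notMem_tsupport fun h => ht (hζ h), zero_smul]
  have main := isOpen_Ioo.ae_eq_zero_of_integral_contDiff_smul_eq_zero (μ := volume)
    (f := fun t => g t - c) (U := Ioo 0 T) (IntegrableOn.locallyIntegrableOn (hg.sub (by simp)))
    (fun ζ hζd hζc hζs => by
      -- The convex hull of the two supports is a compact subinterval of `(0,T)` that also supports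
      -- the primitive `φ`, because `k` has integral zero.
      set m := ∫ t, ζ t with hm
      set K := tsupport ζ ∪ tsupport χ with hK
      have hKc : IsCompact K := hζc.isCompact.union hχc.isCompact
      have hKne : K.Nonempty := hχne.mono subset_union_right
      have hKs : K ⊆ Ioo 0 T := union_subset hζs hχs
      have hKI : K ⊆ Icc (sInf K) (sSup K) := fun t ht =>
        ⟨csInf_le hKc.bddBelow ht, le_csSup hKc.bddAbove ht⟩
      have hα := hKs (hKc.sInf_mem hKne)
      have hβ := hKs (hKc.sSup_mem hKne)
      set k : ℝ → ℝ := fun t => ζ t - m * χ t with hk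
      have hkd : ContDiff ℝ ∞ k := hζd.sub (contDiff_const.mul hχd)
      have hk0 : ∀ t, t ∉ Icc (sInf K) (sSup K) → k t = 0 := fun t ht => by
        have h1 : ζ t = 0 := image_eq_zero_of_notMem_tsupport fun h => ht (hKI (Or.inl h))
        have h2 : χ t = 0 := image_eq_zero_of_notMem_tsupport fun h => ht (hKI (Or.inr h))
        simp [hk, h1, h2]
      have hζi : Integrable ζ := hζd.continuous.integrable_of_hasCompactSupport hζc
      have hχi : Integrable χ := hχd.continuous.integrable_of_hasCompactSupport hχc
      have hk1 : ∫ t, k t = 0 := by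
        rw [integral_sub hζi (hχi.const_mul m), integral_const_mul, hχ1, mul_one, sub_self]
      set φ : ℝ → ℝ := fun t => ∫ s in (0 : ℝ)..t, k s with hφ
      have hφd : ∀ t, HasDerivAt φ (k t) t := fun t =>
        (hkd.continuous.integral_hasStrictDerivAt 0 t).hasDerivAt
      have hφd' : deriv φ = k := funext fun t => (hφd t).deriv
      have hφs : ∀ t, t ∉ Icc (sInf K) (sSup K) → φ t = 0 := by
        intro t ht
        rcases lt_or_ge t (sInf K) with h1 | h1
        · refine (intervalIntegral.integral_congr (g := fun _ => 0) fun s hs => hk0 s fun h2 => ?_).trans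
            (by simp)
          have := hs.2
          exact absurd (h2.1.trans this) (not_le.2 (max_lt hα.1 h1))
        · have h2 : sSup K < t := by
            by_contra! h3
            exact ht ⟨h1, h3⟩
          have h3 : Function.support k ⊆ Ioc 0 t := fun s hs => by
            by_contra h4
            refine hs (hk0 s fun h5 => h4 ⟨hα.1.trans_le h5.1, h5.2.trans h2.le⟩)
          exact (intervalIntegral.integral_eq_integral_of_support_subset h3).trans hk1
      have hφt : tsupport φ ⊆ Icc (sInf K) (sSup K) := by
        refine closure_minimal (fun t ht => ?_) isClosed_Icc
        by_contra h1
        exact ht (hφs t h1)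
      have hφ0 := h φ (contDiff_infty_iff_deriv.2
        ⟨fun t => (hφd t).differentiableAt, by rwa [hφd']⟩)
        (HasCompactSupport.intro isCompact_Icc hφs)
        (hφt.trans fun t ht => ⟨hα.1.trans_le ht.1, ht.2.trans_lt hβ.2⟩)
      rw [hφd'] at hφ0
      simp only [Pi.zero_apply, smul_zero, integral_zero, neg_zero] at hφ0
      have i1 := integrableOn_smul_of_continuous hζd.continuous hg
      have i2 := integrableOn_smul_of_continuous hχd.continuous hg
      have i3 : IntegrableOn (fun t => m • χ t • g t) (Ioo 0 T) := i2.smul m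
      have h5 : ∫ t in Ioo (0 : ℝ) T, ζ t • g t = m • c := by
        simp only [hk, sub_smul, mul_smul] at hφ0
        rw [integral_sub i1 i3, integral_smul, sub_eq_zero] at hφ0
        exact hφ0
      rw [← hfull _ hζs]
      simp only [smul_sub]
      rw [integral_sub i1 (integrableOn_smul_of_continuous hζd.continuous (by simp)), h5,
        hfull _ hζs, integral_smul_const, sub_self])
  rw [ae_restrict_iff' measurableSet_Ioo]
  filter_upwards [main] with t ht hts
  exact sub_eq_zero.1 (ht hts)

theorem IsWeakDeriv.exists_ae_eq [CompleteSpace E] (hT : 0 < T) {u v : ℝ → E}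
    (hu : IntegrableOn u (Ioo 0 T)) (hv : IntegrableOn v (Ioo 0 T)) (h : IsWeakDeriv T u v) :
    ∃ c, ∀ᵐ t ∂(volume.restrict (Ioo 0 T)), u t = c + ∫ s in 0..t, v s := by
  have hvi : IntervalIntegrable v volume 0 T :=
    (intervalIntegrable_iff_integrableOn_Ioo_of_le hT.le).2 hv
  have hVc := (absolutelyContinuousOnInterval_integral hvi).continuousOn
  rw [uIcc_of_le hT.le] at hVc
  have hVi : IntegrableOn (fun t => ∫ s in 0..t, v s) (Ioo 0 T) :=
    hVc.integrableOn_Icc.mono_set Ioo_subset_Icc_self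
  have h1 := isWeakDeriv_of_ae_eq (u := fun t => ∫ s in 0..t, v s) hT.le hv (c := 0)
    (Eventually.of_forall fun t => (zero_add _).symm)
  obtain ⟨c, hc⟩ := ae_eq_const_of_isWeakDeriv_zero hT (g := fun t => u t - ∫ s in 0..t, v s)
    (hu.sub hVi) (by
      intro φ hφ hφc hφs
      have hdc : Continuous (deriv φ) := hφ.continuous_deriv (by simp)
      simp only [smul_sub, Pi.zero_apply, smul_zero, integral_zero, neg_zero]
      rw [integral_sub (integrableOn_smul_of_continuous hdc hu)
        (integrableOn_smul_of_continuous hdc hVi), h φ hφ hφc hφs, h1 φ hφ hφc hφs, sub_self])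
  refine ⟨c, ?_⟩
  filter_upwards [hc] with t ht
  rw [← ht, sub_add_cancel]

end WeakDerivative

/-- A real normed structure compatible with the scalar tower is equal to the one obtained by
restricting scalars. -/
theorem hasWeakDeriv_iff {𝕜 : Type*} [RCLike 𝕜] {E : Type*} [NormedAddCommGroup E]
    [NormedSpace 𝕜 E] [inst : NormedSpace ℝ E] [IsScalarTower ℝ 𝕜 E] {T : ℝ} (u v : L2 T E) :
    HasWeakDeriv 𝕜 u v ↔ IsWeakDeriv T u v := by
  have h : inst.toModule = (NormedSpace.restrictScalars ℝ 𝕜 E).toModule :=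
    Module.ext' _ _ fun r x => (algebraMap_smul 𝕜 r x).symm
  have h' : inst = NormedSpace.restrictScalars ℝ 𝕜 E := by
    cases inst
    congr
  subst h'
  rfl

/-! ### Passage to real forms -/

section RealForms

variable {𝕜 : Type*} [RCLike 𝕜]
  {V : Type*} [NormedAddCommGroup V] [InnerProductSpace 𝕜 V] [InnerProductSpace ℝ V]
  [IsScalarTower ℝ 𝕜 V]
  {H : Type*} [NormedAddCommGroup H] [InnerProductSpace 𝕜 H] [InnerProductSpace ℝ H]
  [IsScalarTower ℝ 𝕜 H] {T : ℝ} {c : ℝ → V →ₗ[𝕜] V →ₗ⋆[𝕜] 𝕜}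

/-- The real part of a bounded non-autonomous sesquilinear form, extended by zero. -/
theorem exists_re_form {M : ℝ}
    (hc : ∀ t ∈ Icc 0 T, ∀ u v, ‖c t u v‖ ≤ M * ‖u‖ * ‖v‖) :
    ∃ C : ℝ → V →L[ℝ] V →L[ℝ] ℝ, (∀ t ∈ Icc 0 T, ∀ u v, C t u v = RCLike.re (c t u v)) ∧
      ∀ t, t ∉ Icc 0 T → C t = 0 := by
  classical
  have hs : ∀ (r : ℝ) (x : V), r • x = (r : 𝕜) • x := fun r x => (algebraMap_smul 𝕜 r x).symm
  refine ⟨fun t => if h : t ∈ Icc 0 T then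
    LinearMap.mkContinuous₂ (LinearMap.mk₂ ℝ (fun u v => RCLike.re (c t u v))
      (by intros; simp)
      (fun r u v => by rw [hs r, map_smul, LinearMap.smul_apply, smul_eq_mul,
        RCLike.re_ofReal_mul, smul_eq_mul]) (by intros; simp)
      (fun r u v => by rw [hs r, map_smulₛₗ, RCLike.conj_ofReal, smul_eq_mul,
        RCLike.re_ofReal_mul, smul_eq_mul])) M
      (fun u v => (RCLike.norm_re_le_norm _).trans (hc t h u v)) else 0, ?_, ?_⟩
  · intro t ht u v
    simp only [dif_pos ht]
    rfl
  · intro t ht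
    simp only [dif_neg ht]

omit [IsScalarTower ℝ 𝕜 V] in
theorem IsPiecewiseLipschitz.exists_lipschitzOnWith (h : IsPiecewiseLipschitz T c)
    {C : ℝ → V →L[ℝ] V →L[ℝ] ℝ} (hC : ∀ t ∈ Icc 0 T, ∀ u v, C t u v = RCLike.re (c t u v)) :
    ∃ (D : Finset ℝ) (L : ℝ≥0), ∀ p q, 0 ≤ p → p < q → q ≤ T → (∀ d ∈ D, d ∉ Ioo p q) →
      LipschitzOnWith L C (Ioo p q) := by
  classical
  obtain ⟨n, τ, L, -, h0, hT, hL⟩ := h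
  refine ⟨Finset.univ.image τ, L.toNNReal, fun p q hp hpq hq hD => ?_⟩
  obtain ⟨i, hi⟩ := exists_subset_of_avoids_range (h0.trans_le hp) hpq (hq.trans_eq hT.symm)
    fun i => hD _ (Finset.mem_image_of_mem _ (Finset.mem_univ i))
  have hsub : Ioo p q ⊆ Icc 0 T := fun t ht => ⟨hp.trans ht.1.le, ht.2.le.trans hq⟩
  refine LipschitzOnWith.of_dist_le_mul fun t ht s hs => ?_
  rw [dist_eq_norm, Real.dist_eq]
  refine ContinuousLinearMap.opNorm_le_bound₂ _ (by positivity) fun u v => ?_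
  have e : (C t - C s) u v = RCLike.re (c t u v - c s u v) := by
    rw [sub_apply, sub_apply, hC t (hsub ht),
      hC s (hsub hs), map_sub]
  rw [e]
  refine (RCLike.norm_re_le_norm _).trans ((hL i s (hi hs) t (hi ht) u v).trans ?_)
  gcongr
  exact Real.le_coe_toNNReal L

/-- The real parts inherit all assumptions. One set `D` and common constants serve all forms; the
breakpoints of `a₁` and `b₁` are merged. -/
theorem exists_piecewiseSetting (ι : V →L[𝕜] H) {a₁ a₂ b₁ b₂ : ℝ → V →ₗ[𝕜] V →ₗ⋆[𝕜] 𝕜}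
    (ha₁ : IsVBounded T a₁) (hb₁ : IsVBounded T b₁) (hb : IsCoerciveForm T b₁)
    (hs : IsSymmetricForm T b₁) (hla : IsPiecewiseLipschitz T a₁)
    (hlb : IsPiecewiseLipschitz T b₁) (hma : IsMeasurableForm T a₂) (hmb : IsMeasurableForm T b₂)
    (ha₂ : IsVHBounded ι T a₂) (hb₂ : IsVHBounded ι T b₂) :
    ∃ (A₁ A₂ B₁ B₂ : ℝ → V →L[ℝ] V →L[ℝ] ℝ) (D : Finset ℝ) (L : ℝ≥0) (M α : ℝ),
      PiecewiseSetting (ι.restrictScalars ℝ) T A₁ A₂ B₁ B₂ D L M α ∧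
      (∀ t ∈ Icc 0 T, ∀ u v, (A₁ t + A₂ t) u v = RCLike.re ((a₁ + a₂) t u v)) ∧
      (∀ t ∈ Icc 0 T, ∀ u v, (B₁ t + B₂ t) u v = RCLike.re ((b₁ + b₂) t u v)) := by
  classical
  obtain ⟨m1, h1⟩ := ha₁
  obtain ⟨m2, h2⟩ := hb₁
  obtain ⟨m3, h3⟩ := ha₂
  obtain ⟨m4, h4⟩ := hb₂
  obtain ⟨α, hα, hb⟩ := hb
  set M := max (max |m1| |m2|) (max |m3| |m4|) with hM
  have hM0 : 0 ≤ M := by positivity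
  have hm1 : m1 ≤ M := (le_abs_self _).trans ((le_max_left _ _).trans (le_max_left _ _))
  have hm2 : m2 ≤ M := (le_abs_self _).trans ((le_max_right _ _).trans (le_max_left _ _))
  have hm3 : m3 ≤ M := (le_abs_self _).trans ((le_max_left _ _).trans (le_max_right _ _))
  have hm4 : m4 ≤ M := (le_abs_self _).trans ((le_max_right _ _).trans (le_max_right _ _))
  replace h1 : ∀ t ∈ Icc 0 T, ∀ u v, ‖a₁ t u v‖ ≤ M * ‖u‖ * ‖v‖ :=
    fun t ht u v => (h1 t ht u v).trans (by gcongr)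
  replace h2 : ∀ t ∈ Icc 0 T, ∀ u v, ‖b₁ t u v‖ ≤ M * ‖u‖ * ‖v‖ :=
    fun t ht u v => (h2 t ht u v).trans (by gcongr)
  replace h3 : ∀ t ∈ Icc 0 T, ∀ u v, ‖a₂ t u v‖ ≤ M * ‖u‖ * ‖ι v‖ :=
    fun t ht u v => (h3 t ht u v).trans (by gcongr)
  replace h4 : ∀ t ∈ Icc 0 T, ∀ u v, ‖b₂ t u v‖ ≤ M * ‖u‖ * ‖ι v‖ :=
    fun t ht u v => (h4 t ht u v).trans (by gcongr)
  have hι : ∀ u v : V, M * ‖u‖ * ‖ι v‖ ≤ M * ‖ι‖ * ‖u‖ * ‖v‖ := fun u v => by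
    calc M * ‖u‖ * ‖ι v‖ ≤ M * ‖u‖ * (‖ι‖ * ‖v‖) := by gcongr; exact ι.le_opNorm v
      _ = _ := by ring
  obtain ⟨A₁, hA₁, -⟩ := exists_re_form h1
  obtain ⟨B₁, hB₁, -⟩ := exists_re_form h2
  obtain ⟨A₂, hA₂, hA₂'⟩ := exists_re_form fun t ht u v => (h3 t ht u v).trans (hι u v)
  obtain ⟨B₂, hB₂, hB₂'⟩ := exists_re_form fun t ht u v => (h4 t ht u v).trans (hι u v)
  obtain ⟨Da, La, hLa⟩ := hla.exists_lipschitzOnWith hA₁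
  obtain ⟨Db, Lb, hLb⟩ := hlb.exists_lipschitzOnWith hB₁
  have hbound : ∀ {c : ℝ → V →ₗ[𝕜] V →ₗ⋆[𝕜] 𝕜} {C : ℝ → V →L[ℝ] V →L[ℝ] ℝ},
      (∀ t ∈ Icc 0 T, ∀ u v, ‖c t u v‖ ≤ M * ‖u‖ * ‖v‖) →
      (∀ t ∈ Icc 0 T, ∀ u v, C t u v = RCLike.re (c t u v)) → ∀ t ∈ Icc 0 T, ‖C t‖ ≤ M := by
    intro c C hc hC t ht
    refine (C t).opNorm_le_bound₂ hM0 fun u v => ?_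
    rw [hC t ht]
    exact (RCLike.norm_re_le_norm _).trans (hc t ht u v)
  have hbound₂ : ∀ {c : ℝ → V →ₗ[𝕜] V →ₗ⋆[𝕜] 𝕜} {C : ℝ → V →L[ℝ] V →L[ℝ] ℝ},
      (∀ t ∈ Icc 0 T, ∀ u v, ‖c t u v‖ ≤ M * ‖u‖ * ‖ι v‖) →
      (∀ t ∈ Icc 0 T, ∀ u v, C t u v = RCLike.re (c t u v)) → (∀ t, t ∉ Icc 0 T → C t = 0) →
      ∀ t u v, |C t u v| ≤ M * ‖u‖ * ‖ι.restrictScalars ℝ v‖ := by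
    intro c C hc hC hC' t u v
    by_cases ht : t ∈ Icc 0 T
    · rw [hC t ht]
      exact (RCLike.norm_re_le_norm _).trans (hc t ht u v)
    · rw [hC' t ht]
      simpa using by positivity
  have hmeas : ∀ {c : ℝ → V →ₗ[𝕜] V →ₗ⋆[𝕜] 𝕜} {C : ℝ → V →L[ℝ] V →L[ℝ] ℝ},
      IsMeasurableForm T c → (∀ t ∈ Icc 0 T, ∀ u v, C t u v = RCLike.re (c t u v)) →
      ∀ u v, AEStronglyMeasurable (fun t => C t u v) (volume.restrict (Icc 0 T)) := by
    intro c C hc hC u v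
    refine (RCLike.continuous_re.comp_aestronglyMeasurable (hc u v)).congr ?_
    filter_upwards [ae_restrict_mem measurableSet_Icc] with t ht
    exact (hC t ht u v).symm
  refine ⟨A₁, A₂, B₁, B₂, Da ∪ Db, max La Lb, M, α, ⟨hM0, hα, ?_, ?_, hbound h1 hA₁,
    hbound h2 hB₁, ?_, ?_, hmeas hma hA₂, hmeas hmb hB₂, hbound₂ h3 hA₂ hA₂',
    hbound₂ h4 hB₂ hB₂'⟩, ?_, ?_⟩
  · exact fun p q hp hpq hq hD => (hLa p q hp hpq hq fun d hd =>
      hD d (Finset.mem_union_left _ hd)).weaken (le_max_left _ _)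
  · exact fun p q hp hpq hq hD => (hLb p q hp hpq hq fun d hd =>
      hD d (Finset.mem_union_right _ hd)).weaken (le_max_right _ _)
  · exact fun t ht u => (hb t ht u).trans_eq (hB₁ t ht u u).symm
  · intro t ht u v
    rw [hB₁ t ht, hB₁ t ht, hs t ht u v, RCLike.conj_re]
  · intro t ht u v
    simp [hA₁ t ht, hA₂ t ht]
  · intro t ht u v
    simp [hB₁ t ht, hB₂ t ht]

omit [InnerProductSpace ℝ V] [IsScalarTower ℝ 𝕜 V] [InnerProductSpace ℝ H]
  [IsScalarTower ℝ 𝕜 H] in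
theorem IsVBounded.add_of_isVHBounded {ι : V →L[𝕜] H} {c₁ c₂ : ℝ → V →ₗ[𝕜] V →ₗ⋆[𝕜] 𝕜}
    (h₁ : IsVBounded T c₁) (h₂ : IsVHBounded ι T c₂) : IsVBounded T (c₁ + c₂) := by
  obtain ⟨m1, h1⟩ := h₁
  obtain ⟨m2, h2⟩ := h₂
  refine ⟨m1 + |m2| * ‖ι‖, fun t ht u v => ?_⟩
  have h3 : m2 * ‖u‖ * ‖ι v‖ ≤ |m2| * ‖u‖ * (‖ι‖ * ‖v‖) := by
    gcongr
    exacts [le_abs_self _, ι.le_opNorm v]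
  calc ‖(c₁ + c₂) t u v‖ ≤ ‖c₁ t u v‖ + ‖c₂ t u v‖ := norm_add_le _ _
    _ ≤ m1 * ‖u‖ * ‖v‖ + |m2| * ‖u‖ * (‖ι‖ * ‖v‖) := add_le_add (h1 t ht u v)
        ((h2 t ht u v).trans h3)
    _ = _ := by ring

omit [InnerProductSpace ℝ V] [IsScalarTower ℝ 𝕜 V] in
-- Evaluating at `G x • x` gives `‖G x‖²`, by antilinearity.
theorem Antidual.eq_zero_of_re_eq_zero {G : Antidual 𝕜 V} (h : ∀ x, RCLike.re (G x) = 0) :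
    G = 0 := by
  ext x
  have h1 := h (G x • x)
  rw [ContinuousLinearMap.map_smulₛₗ, smul_eq_mul, RCLike.conj_mul] at h1
  norm_cast at h1
  simpa using h1

omit [InnerProductSpace ℝ V] [IsScalarTower ℝ 𝕜 V] [IsScalarTower ℝ 𝕜 H] in
theorem antidual_equation_iff {ι : V →L[𝕜] H}
    (hre : ∀ x y : H, inner ℝ x y = RCLike.re (inner 𝕜 x y))
    {b a : V →ₗ[𝕜] V →ₗ⋆[𝕜] 𝕜} (hb : ∃ M : ℝ, ∀ u v : V, ‖b u v‖ ≤ M * ‖u‖ * ‖v‖)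
    (ha : ∃ M : ℝ, ∀ u v : V, ‖a u v‖ ≤ M * ‖u‖ * ‖v‖) (w f : H) (v u : V) :
    toAntidual ι w + formOp b v + formOp a u = toAntidual ι f ↔
      ∀ x, inner ℝ (ι x) w + RCLike.re (b v x) + RCLike.re (a u x) = inner ℝ (ι x) f := by
  have key : ∀ x, RCLike.re ((toAntidual ι w + formOp b v + formOp a u - toAntidual ι f) x)
      = inner ℝ (ι x) w + RCLike.re (b v x) + RCLike.re (a u x) - inner ℝ (ι x) f := fun x => by
    simp only [sub_apply, add_apply, formOp_apply hb,
      formOp_apply ha, toAntidual_apply, map_add, map_sub, hre]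
  rw [← sub_eq_zero]
  constructor
  · intro h x
    rw [← sub_eq_zero, ← key, h]
    simp
  · intro h
    refine Antidual.eq_zero_of_re_eq_zero fun x => ?_
    rw [key, sub_eq_zero, h]

end RealForms

/-! ### Weak solutions versus velocity solutions -/

section Translation

theorem L2.integrableOn {E : Type*} [NormedAddCommGroup E] {T : ℝ} (u : L2 T E) :
    IntegrableOn u (Ioo 0 T) :=
  (Lp.memLp u).integrable (by norm_num)

theorem L2.continuousOn_primitive {E : Type*} [NormedAddCommGroup E] [NormedSpace ℝ E] {T : ℝ}
    (hT : 0 ≤ T) (u : L2 T E) : ContinuousOn (fun t => ∫ s in 0..t, u s) (Icc 0 T) := by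
  rw [← uIcc_of_le hT]
  exact (absolutelyContinuousOnInterval_integral
    ((intervalIntegrable_iff_integrableOn_Ioo_of_le hT).2 u.integrableOn)).continuousOn

theorem integral_congr_of_ae_eq_Ioo {E : Type*} [NormedAddCommGroup E] [NormedSpace ℝ E] {T : ℝ}
    {g g' : ℝ → E} (hg : g =ᵐ[volume.restrict (Ioo 0 T)] g') {t : ℝ} (ht : t ∈ Ioo 0 T) :
    ∫ s in 0..t, g s = ∫ s in 0..t, g' s := by
  rw [intervalIntegral.integral_of_le ht.1.le, intervalIntegral.integral_of_le ht.1.le]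
  have hsub : Ioc 0 t ⊆ Ioo 0 T := fun s hs => ⟨hs.1, hs.2.trans_lt ht.2⟩
  exact integral_congr_ae (ae_restrict_of_ae_restrict_of_subset hsub hg)

/-- Both sides are continuous and agree almost everywhere up to a constant, which is read off at
`0`. -/
theorem IsContRep.eq_add_integral {E : Type*} [NormedAddCommGroup E] [NormedSpace ℝ E]
    [CompleteSpace E] {T : ℝ} (hT : 0 < T) {u v : L2 T E} {w : ℝ → E} (hw : IsContRep u w)
    (h : IsWeakDeriv T u v) : ∀ t ∈ Icc 0 T, w t = w 0 + ∫ s in 0..t, v s := by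
  obtain ⟨c, hc⟩ := h.exists_ae_eq hT u.integrableOn v.integrableOn
  have h1 : EqOn w (fun t => c + ∫ s in 0..t, v s) (Icc 0 T) := by
    refine Measure.eqOn_Icc_of_ae_eq volume hT.ne ?_ hw.1
      (continuousOn_const.add (v.continuousOn_primitive hT.le))
    rw [← restrict_Ioo_eq_restrict_Icc]
    exact hw.2.trans hc
  have h0 : w 0 = c := by simpa using h1 (left_mem_Icc.2 hT.le)
  intro t ht
  rw [h0, h1 ht]

variable {𝕜 : Type*} [RCLike 𝕜]
  {V : Type*} [NormedAddCommGroup V] [InnerProductSpace 𝕜 V] [InnerProductSpace ℝ V]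
  [IsScalarTower ℝ 𝕜 V] [CompleteSpace V]
  {H : Type*} [NormedAddCommGroup H] [InnerProductSpace 𝕜 H] [InnerProductSpace ℝ H]
  [IsScalarTower ℝ 𝕜 H] [CompleteSpace H] {T : ℝ} {ι : V →L[𝕜] H}
  {a b : ℝ → V →ₗ[𝕜] V →ₗ⋆[𝕜] 𝕜} {A B : ℝ → V →L[ℝ] V →L[ℝ] ℝ} {f : L2 T H} {u₀ u₁ : V}

theorem isVelocitySolution_of_hasWeakDeriv (hT : 0 < T)
    (hre : ∀ x y : H, inner ℝ x y = RCLike.re (inner 𝕜 x y))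
    (ha : IsVBounded T a) (hb : IsVBounded T b)
    (hA : ∀ t ∈ Icc 0 T, ∀ u v, A t u v = RCLike.re (a t u v))
    (hB : ∀ t ∈ Icc 0 T, ∀ u v, B t u v = RCLike.re (b t u v))
    {u u' : L2 T V} {u'' : L2 T H} (h1 : HasWeakDeriv 𝕜 u u')
    (h2 : HasWeakDeriv 𝕜 (ι.compLp u') u'')
    (he : ∀ᵐ t ∂(volume.restrict (Ioo (0 : ℝ) T)),
      toAntidual ι (u'' t) + formOp (b t) (u' t) + formOp (a t) (u t) = toAntidual ι (f t))
    {w : ℝ → V} (hw : IsContRep u w) (hw0 : w 0 = u₀)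
    {z : ℝ → H} (hz : IsContRep (ι.compLp u') z) (hz0 : z 0 = ι u₁) :
    (∀ᵐ t ∂(volume.restrict (Ioo (0 : ℝ) T)), u t = u₀ + ∫ s in 0..t, u' s) ∧
    IsVelocitySolution (ι.restrictScalars ℝ) 0 T A B f u₀ u₁ u' u'' := by
  have hu : ∀ᵐ t ∂(volume.restrict (Ioo (0 : ℝ) T)), u t = u₀ + ∫ s in 0..t, u' s := by
    filter_upwards [hw.2, ae_restrict_mem measurableSet_Ioo] with t ht htm
    rw [← ht, hw.eq_add_integral hT ((hasWeakDeriv_iff u u').1 h1) t (Ioo_subset_Icc_self htm),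
      hw0]
  refine ⟨hu, ?_, ?_, ?_, ?_⟩
  · rw [← restrict_Ioo_eq_restrict_Ioc]
    exact Lp.memLp u'
  · rw [← restrict_Ioo_eq_restrict_Ioc]
    exact Lp.memLp u''
  · rw [← restrict_Ioo_eq_restrict_Ioc]
    filter_upwards [hz.2, ι.coeFn_compLp u', ae_restrict_mem measurableSet_Ioo] with t ht htι htm
    have := hz.eq_add_integral hT ((hasWeakDeriv_iff _ u'').1 h2) t (Ioo_subset_Icc_self htm)
    rw [hz0, ht, htι] at this
    exact this
  · rw [← restrict_Ioo_eq_restrict_Ioc]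
    filter_upwards [he, hu, ae_restrict_mem measurableSet_Ioo] with t h3 h4 htm x
    have htm' := Ioo_subset_Icc_self htm
    obtain ⟨Ma, hMa⟩ := ha
    obtain ⟨Mb, hMb⟩ := hb
    have h5 := (antidual_equation_iff hre ⟨Mb, hMb t htm'⟩ ⟨Ma, hMa t htm'⟩ _ _ _ _).1 h3 x
    rw [hA t htm', hB t htm', ← h4]
    exact h5

theorem IsVelocitySolution.exists_isSolution (hT : 0 < T)
    (hre : ∀ x y : H, inner ℝ x y = RCLike.re (inner 𝕜 x y))
    (ha : IsVBounded T a) (hb : IsVBounded T b)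
    (hA : ∀ t ∈ Icc 0 T, ∀ u v, A t u v = RCLike.re (a t u v))
    (hB : ∀ t ∈ Icc 0 T, ∀ u v, B t u v = RCLike.re (b t u v)) {v : ℝ → V} {w : ℝ → H}
    (h : IsVelocitySolution (ι.restrictScalars ℝ) 0 T A B f u₀ u₁ v w) :
    ∃ u : L2 T V, u ∈ MR ι T ∧ IsSolution ι a b f u₀ u₁ u := by
  obtain ⟨hv, hw, hvel, heq⟩ := h
  rw [← restrict_Ioo_eq_restrict_Ioc] at hv hw hvel heq
  set u' : L2 T V := hv.toLp v with hu'
  set u'' : L2 T H := hw.toLp w with hu''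
  have ev : u' =ᵐ[volume.restrict (Ioo 0 T)] v := hv.coeFn_toLp
  have ew : u'' =ᵐ[volume.restrict (Ioo 0 T)] w := hw.coeFn_toLp
  have hcont := continuousOn_const (c := u₀).add (u'.continuousOn_primitive hT.le)
  have hcont' := continuousOn_const (c := ι u₁).add (u''.continuousOn_primitive hT.le)
  have hum : MemLp (fun t => u₀ + ∫ s in 0..t, u' s) 2 (volume.restrict (Ioo 0 T)) := by
    obtain ⟨C, hC⟩ := isCompact_Icc.exists_bound_of_continuousOn hcont
    refine MemLp.of_bound
      (hcont.integrableOn_Icc.mono_set Ioo_subset_Icc_self).aestronglyMeasurable C ?_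
    filter_upwards [ae_restrict_mem measurableSet_Ioo] with t ht
    exact hC t (Ioo_subset_Icc_self ht)
  set u : L2 T V := hum.toLp _ with hu
  have eu : u =ᵐ[volume.restrict (Ioo 0 T)] fun t => u₀ + ∫ s in 0..t, u' s := hum.coeFn_toLp
  have hvel' : ι.compLp u' =ᵐ[volume.restrict (Ioo 0 T)] fun t => ι u₁ + ∫ s in 0..t, u'' s := by
    filter_upwards [hvel, ι.coeFn_compLp u', ev, ae_restrict_mem measurableSet_Ioo]
      with t h1 h2 h3 h4
    rw [h2, h3, integral_congr_of_ae_eq_Ioo ew h4]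
    exact h1
  have d1 : HasWeakDeriv 𝕜 u u' :=
    (hasWeakDeriv_iff u u').2 (isWeakDeriv_of_ae_eq hT.le u'.integrableOn eu)
  have d2 : HasWeakDeriv 𝕜 (ι.compLp u') u'' :=
    (hasWeakDeriv_iff _ u'').2 (isWeakDeriv_of_ae_eq hT.le u''.integrableOn hvel')
  -- Membership in `H²(0,T;H)` also needs the first derivative of `ι u`, obtained by commuting `ι`
  -- with the integral.
  have d3 : HasWeakDeriv 𝕜 (ι.compLp u) (ι.compLp u') := by
    refine (hasWeakDeriv_iff _ _).2 (isWeakDeriv_of_ae_eq hT.le (L2.integrableOn _) (c := ι u₀) ?_)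
    filter_upwards [eu, ι.coeFn_compLp u, ae_restrict_mem measurableSet_Ioo] with t h1 h2 h3
    rw [h2, h1, map_add, integral_congr_of_ae_eq_Ioo (ι.coeFn_compLp u') h3]
    congr 1
    exact ((ι.restrictScalars ℝ).intervalIntegral_comp_comm
      (((intervalIntegrable_iff_integrableOn_Ioo_of_le hT.le).2 u'.integrableOn).mono_set
        (uIcc_subset_uIcc left_mem_uIcc (by
          rw [uIcc_of_le hT.le]; exact Ioo_subset_Icc_self h3)))).symm
  refine ⟨u, ⟨⟨u', d1, trivial⟩, ι.compLp u', d3, u'', d2, trivial⟩, u', u'', d1, d2, ?_,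
    ⟨_, ⟨hcont, eu.symm⟩, by simp⟩, ⟨_, ⟨hcont', hvel'.symm⟩, by simp⟩⟩
  filter_upwards [heq, ev, ew, eu, ae_restrict_mem measurableSet_Ioo] with t h1 h2 h3 h4 htm
  have htm' := Ioo_subset_Icc_self htm
  obtain ⟨Ma, hMa⟩ := ha
  obtain ⟨Mb, hMb⟩ := hb
  refine (antidual_equation_iff hre ⟨Mb, hMb t htm'⟩ ⟨Ma, hMa t htm'⟩ _ _ _ _).2 fun x => ?_
  have h5 := h1 x
  rw [hA t htm', hB t htm', ← integral_congr_of_ae_eq_Ioo ev htm, ← h4, ← h2, ← h3] at h5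
  exact h5

theorem existsUnique_isSolution [TopologicalSpace.SeparableSpace V] (hT : 0 < T)
    (hre : ∀ x y : H, inner ℝ x y = RCLike.re (inner 𝕜 x y))
    {a₁ a₂ b₁ b₂ : ℝ → V →ₗ[𝕜] V →ₗ⋆[𝕜] 𝕜}
    (ha₁ : IsVBounded T a₁) (hb₁ : IsVBounded T b₁) (hb : IsCoerciveForm T b₁)
    (hs : IsSymmetricForm T b₁) (hla : IsPiecewiseLipschitz T a₁)
    (hlb : IsPiecewiseLipschitz T b₁) (hma : IsMeasurableForm T a₂) (hmb : IsMeasurableForm T b₂)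
    (ha₂ : IsVHBounded ι T a₂) (hb₂ : IsVHBounded ι T b₂) :
    (∃! u : L2 T V, u ∈ MR ι T ∧ IsSolution ι (a₁ + a₂) (b₁ + b₂) f u₀ u₁ u) ∧
    (∀ u : L2 T V, u ∈ MR ι T → IsSolution ι (a₁ + a₂) (b₁ + b₂) f u₀ u₁ u →
      ∃ (u' : L2 T V) (w : ℝ → H), HasWeakDeriv 𝕜 u u' ∧
        IsContRep (ι.compLp u') w ∧ ∀ t ∈ Set.Icc 0 T, w t ∈ Set.range ι) := by
  have : SecondCountableTopology V := UniformSpace.secondCountable_of_separable V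
  obtain ⟨A₁, A₂, B₁, B₂, D, L, M, α, hset, hA, hB⟩ :=
    exists_piecewiseSetting ι ha₁ hb₁ hb hs hla hlb hma hmb ha₂ hb₂
  have ha := ha₁.add_of_isVHBounded ha₂
  have hb := hb₁.add_of_isVHBounded hb₂
  have hf : MemLp f 2 (volume.restrict (Ioc 0 T)) := by
    rw [← restrict_Ioo_eq_restrict_Ioc]
    exact Lp.memLp f
  refine ⟨?_, ?_⟩
  · obtain ⟨v, w, hvw, -⟩ := hset.solvable hf le_rfl hT.le le_rfl u₀ u₁
    obtain ⟨u, hu⟩ := hvw.exists_isSolution hT hre ha hb hA hB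
    refine ⟨u, hu, ?_⟩
    rintro y ⟨-, y', y'', g1, g2, g3, ⟨r, g4, g5⟩, ⟨z, g6, g7⟩⟩
    obtain ⟨-, u', u'', h1, h2, h3, ⟨r', h4, h5⟩, ⟨z', h6, h7⟩⟩ := hu
    obtain ⟨ey, hy⟩ := isVelocitySolution_of_hasWeakDeriv hT hre ha hb hA hB g1 g2 g3 g4 g5 g6 g7
    obtain ⟨eu, hu⟩ := isVelocitySolution_of_hasWeakDeriv hT hre ha hb hA hB h1 h2 h3 h4 h5 h6 h7
    have heq := (hset.eq_of_isVelocitySolution hT.le le_rfl hy hu).1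
    refine Lp.ext ?_
    filter_upwards [ey, eu, ae_restrict_mem measurableSet_Ioo] with t k1 k2 k3
    rw [k1, k2, intervalIntegral.integral_of_le k3.1.le, intervalIntegral.integral_of_le k3.1.le]
    congr 1
    exact integral_congr_ae (ae_restrict_of_ae_restrict_of_subset
      (Ioc_subset_Ioc_right k3.2.le) heq)
  · rintro u - ⟨u', u'', h1, h2, h3, ⟨r, h4, h5⟩, ⟨z, h6, h7⟩⟩
    refine ⟨u', z, h1, h6, fun t ht => ?_⟩
    obtain ⟨-, hu⟩ := isVelocitySolution_of_hasWeakDeriv hT hre ha hb hA hB h1 h2 h3 h4 h5 h6 h7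
    -- Solve afresh on `[0,t]`: uniqueness there identifies the two velocities at time `t`, and the
    -- fresh one lies in `V`.
    obtain ⟨v, w, hvw, x, hx⟩ := hset.solvable hf le_rfl ht.1 ht.2 u₀ u₁
    have heq := (hset.eq_of_isVelocitySolution ht.1 ht.2 hvw (hu.mono ht.2)).2
    refine ⟨x, ?_⟩
    rw [h6.eq_add_integral hT ((hasWeakDeriv_iff _ u'').1 h2) t ht, h7, ← heq]
    exact hx

end Translation

end DampedWave

theorem mainTheorem3 {𝕜 : Type*} [RCLike 𝕜]
    {V : Type*} [NormedAddCommGroup V] [InnerProductSpace 𝕜 V] [CompleteSpace V]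
    [TopologicalSpace.SeparableSpace V]
    {H : Type*} [NormedAddCommGroup H] [InnerProductSpace 𝕜 H] [CompleteSpace H]
    [TopologicalSpace.SeparableSpace H]
    (ι : V →L[𝕜] H) (hι_inj : Function.Injective ι) (hι_dense : DenseRange ι)
    (T : ℝ) (hT : 0 < T)
    (a₁ a₂ b₁ b₂ : ℝ → V →ₗ[𝕜] V →ₗ⋆[𝕜] 𝕜)
    (ha₁_bdd : DampedWave.IsVBounded T a₁) (hb₁_bdd : DampedWave.IsVBounded T b₁)
    (ha₁_coer : DampedWave.IsCoerciveForm T a₁) (hb₁_coer : DampedWave.IsCoerciveForm T b₁)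
    (ha₁_symm : DampedWave.IsSymmetricForm T a₁) (hb₁_symm : DampedWave.IsSymmetricForm T b₁)
    (ha₁_lip : DampedWave.IsPiecewiseLipschitz T a₁)
    (hb₁_lip : DampedWave.IsPiecewiseLipschitz T b₁)
    (ha₂_meas : DampedWave.IsMeasurableForm T a₂) (hb₂_meas : DampedWave.IsMeasurableForm T b₂)
    (ha₂_bdd : DampedWave.IsVHBounded ι T a₂) (hb₂_bdd : DampedWave.IsVHBounded ι T b₂)
    (u₀ u₁ : V) (f : DampedWave.L2 T H) :
    (∃! u : DampedWave.L2 T V,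
      u ∈ DampedWave.MR ι T ∧ DampedWave.IsSolution ι (a₁ + a₂) (b₁ + b₂) f u₀ u₁ u) ∧
    (∀ u : DampedWave.L2 T V, u ∈ DampedWave.MR ι T →
      DampedWave.IsSolution ι (a₁ + a₂) (b₁ + b₂) f u₀ u₁ u →
      ∃ (u' : DampedWave.L2 T V) (w : ℝ → H), DampedWave.HasWeakDeriv 𝕜 u u' ∧
        DampedWave.IsContRep (ι.compLp u') w ∧ ∀ t ∈ Set.Icc 0 T, w t ∈ Set.range ι) := by
  -- The real inner product is the real part of the given one, so `hre` holds by `rfl`.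
  let _ := InnerProductSpace.rclikeToReal 𝕜 V
  let _ := InnerProductSpace.rclikeToReal 𝕜 H
  have : IsScalarTower ℝ 𝕜 V := ⟨fun r c x => by
    rw [RCLike.real_smul_eq_coe_mul, mul_smul]; rfl⟩
  have : IsScalarTower ℝ 𝕜 H := ⟨fun r c x => by
    rw [RCLike.real_smul_eq_coe_mul, mul_smul]; rfl⟩
  exact DampedWave.existsUnique_isSolution hT (fun _ _ => rfl) ha₁_bdd hb₁_bdd hb₁_coer hb₁_symm
    ha₁_lip hb₁_lip ha₂_meas hb₂_meas ha₂_bdd hb₂_bdd
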